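/- **Setting.** Let $k\ge 1$ and let $\Lambda$ be a finite, strongly connected $k$-graph with at least one vertex. That is, $\Lambda$ is a countable small category with degree functor $d:\Lambda\to\mathbb N^k$ having the factorization property (if $d(\lambda)=m+n$ then $\lambda=\mu\nu$ for unique $\mu,\nu$ with $d(\mu)=m$, $d(\nu)=n$); there are finitely many morphisms of each degree; and for all vertices $v,w\in\Lambda^0$ there is a morphism with range $v$ and source $w$. Let $A_i(v,w)$ be the number of morphisms of degree $e_i$ with range $v$ and source $w$, and let $\rho_i$ be the spectral radius of $A_i$. Assume that every vertex receives at least two edges of each colour, i.e. $\sum_{w}A_i(v,w)\ge 2$ for all $v\in\Lambda^0$ and $1\le i\le k$, and that $A=A_1\cdots A_k$ is irreducible. For $n\in\mathbb N^k$ put $\rho(\Lambda)^{n}=\rho_1^{n_1}\cdots\rho_k^{n_k}$. Let $\Lambda^\infty$ be the space of infinite paths (degree-preserving functors $x:\Omega_k\to\Lambda$, where $\Omega_k$ has object set $\mathbb N^k$ and exactly one morphism $(m,n)$, of range $m$, source $n$ and degree $n-m$, for each $m\le n$), with the topology generated by the cylinder sets $[\lambda]=\{x: x(0,d(\lambda))=\lambda\}$,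 $\lambda\in\Lambda$. Let $\mathcal B_\Lambda$ be the stationary $k$-Bratteli diagram of $\Lambda$: each level $n\ge 0$ is a copy of $\Lambda^0$, and the edges from level $n+1$ to level $n$ are the morphisms of degree $e_i$ with $i\equiv n+1 \pmod k$. Let $X=X_{\mathcal B_\Lambda}$ be its space of infinite paths and $F\mathcal B_\Lambda$ its set of finite paths with range in level $0$ (including the vertices, as paths of length $0$). For $\gamma\in F\mathcal B_\Lambda$ let $[\gamma]\subseteq X$ be the set of infinite paths with initial segment $\gamma$; these sets generate the topology of $X$. Cutting an infinite path into edges of colours $1,\dots,k,1,\dots,k,\dots$ defines a map $\Lambda^\infty\to X$. For $\delta\in(0,1)$ and a path $\eta\in F\mathcal B_\Lambda$ of length $qk+t$, $0\le t<k$, let $$w_\delta(\eta)=\big(\rho_1^{q+1}\cdots\rho_t^{q+1}\rho_{t+1}^{q}\cdots\rho_k^{q}\big)^{-1/\delta}\,x^\Lambda_{s(\eta)},$$ where $x^\Lambda\in(0,\infty)^{\Lambda^0}$ is the Perron–Frobenius eigenvector: $\sum_v x^\Lambda_v=1$ and $A_ix^\Lambda=\rho_ix^\Lambda$ for all $i$.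 For $x,y\in X$ let $d_\delta(x,y)$ be $0$ if $x=y$, $1$ if $x,y$ have different ranges, and otherwise $w_\delta$ of the longest common initial segment of $x$ and $y$. A *choice function* is a map $\tau=(\tau_+,\tau_-):F\mathcal B_\Lambda\to X\times X$ with $\tau_\pm(\gamma)\in[\gamma]$ and $d_\delta(\tau_+(\gamma),\tau_-(\gamma))=\operatorname{diam}[\gamma]$. On $\ell^2(F\mathcal B_\Lambda,\mathbb C^2)$ put $$\pi_\tau(f)=\bigoplus_{\gamma}\begin{pmatrix} f(\tau_+(\gamma))&0\\0&f(\tau_-(\gamma))\end{pmatrix},\qquad D=\bigoplus_\gamma \frac1{\operatorname{diam}[\gamma]}\begin{pmatrix}0&1\\1&0\end{pmatrix}.$$ For a positive operator $T$ let $\mathcal T(T)=\lim_{s\searrow1}(s-1)\operatorname{Tr}(T^s)$, whenever this limit exists and is finite. **Theorem.** The Perron–Frobenius eigenvector $x^\Lambda$ exists and is unique; the map $\Lambda^\infty\to X$ is a homeomorphism, by which we identify the two spaces; and there is a unique Borel measure $M$ on $\Lambda^\infty$ (the an Huef–Laca–Raeburn–Sims measure) with $$M([\lambda])=\rho(\Lambda)^{-d(\lambda)}\,x^\Lambda_{s(\lambda)}\qquad\text{for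 all }\lambda\in\Lambda;$$ it is a probability measure. For every $\delta\in(0,1)$, choice functions exist, and there is a finite nonzero Borel measure $\mu_\delta$ on $X$ such that, for every choice function $\tau$, $\mu_\delta$ is the unique finite Borel measure with $$\mu_\delta([\gamma])=\mathcal T\big(\pi_\tau(\chi_{[\gamma]})|D|^{-\delta}\big)\qquad\text{for all }\gamma\in F\mathcal B_\Lambda$$ (in particular the operators are positive and these limits exist and are finite). The normalization $\nu_\delta=\mu_\delta/\mu_\delta(X)$ agrees with $M$ on all Borel sets: $$\nu_\delta(O)=\frac{\mu_\delta(O)}{\mu_\delta(X)}=M(O)\qquad\text{for every Borel set }O\subseteq X.$$ Moreover, for every choice function $\tau$ and every clopen $O\subseteq X$ one has $\mu_\delta(O)=\mathcal T(\pi_\tau(\chi_O)|D|^{-\delta})$ and $\mu_\delta(X)=\mathcal T(|D|^{-\delta})$, so that $\nu_\delta(O)=\mathcal T(\pi_\tau(\chi_O)|D|^{-\delta})/\mathcal T(|D|^{-\delta})$. In particular $\nu_\delta$ is a probability measure that does not depend on $\delta$. -/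

import Mathlib

open MeasureTheory Filter Topology
open scoped ENNReal

universe u

/-! ### Bratteli diagrams, their path spaces and choice functions -/

/-- A Bratteli diagram.  `E n` is the set of edges from level `n + 1` to level `n`
(edges point towards level `0`): `s e` is the source of `e`, `r e` its range. -/
structure BratteliDiagram where
  V : ℕ → Type u
  E : ℕ → Type u
  finite_V : ∀ n, Finite (V n)
  finite_E : ∀ n, Finite (E n)
  r : ∀ {n}, E n → V n
  s : ∀ {n}, E n → V (n + 1)

namespace BratteliDiagram

variable (B : BratteliDiagram.{u})

/-- The finite paths of length `n` with range in level `0` and with source `v` in level `n`. -/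
inductive Path : (n : ℕ) → B.V n → Type u
  | nil (v : B.V 0) : Path 0 v
  | snoc {n : ℕ} {v : B.V n} (γ : Path n v) (e : B.E n) (h : B.r e = v) : Path (n + 1) (B.s e)

/-- All finite paths with range in level `0`; `γ.1` is the length and `γ.2.1` the source. -/
abbrev FinPath : Type u := Σ n : ℕ, Σ v : B.V n, B.Path n v

/-- The space of infinite paths. -/
@[ext] structure PathSpace where
  edge : ∀ n, B.E n
  compat : ∀ n, B.s (edge n) = B.r (edge (n + 1))

variable {B}

/-- The cylinder set of a finite path. -/
def Path.cylinder : ∀ {n : ℕ} {v : B.V n}, B.Path n v → Set B.PathSpace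
  | _, _, .nil v => {x | B.r (x.edge 0) = v}
  | _, _, .snoc γ e _ => {x | x ∈ γ.cylinder ∧ x.edge _ = e}

/-- The cylinder set `[γ]` of a finite path `γ`. -/
def FinPath.cylinder (γ : B.FinPath) : Set B.PathSpace := γ.2.2.cylinder

/-- The topology generated by the cylinder sets. -/
instance : TopologicalSpace B.PathSpace :=
  TopologicalSpace.generateFrom (Set.range (FinPath.cylinder (B := B)))

instance : MeasurableSpace B.PathSpace := borel _

instance : BorelSpace B.PathSpace := ⟨rfl⟩

/-- The `n`-th vertex of an infinite path. -/
def PathSpace.vtx (x : B.PathSpace) : ∀ n, B.V n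
  | 0 => B.r (x.edge 0)
  | n + 1 => B.s (x.edge n)

theorem PathSpace.r_edge (x : B.PathSpace) : ∀ n, B.r (x.edge n) = x.vtx n
  | 0 => rfl
  | n + 1 => (x.compat n).symm

/-- The initial segment of length `n` of an infinite path. -/
def PathSpace.takeAux (x : B.PathSpace) : ∀ n, B.Path n (x.vtx n)
  | 0 => .nil _
  | n + 1 => .snoc (x.takeAux n) (x.edge n) (x.r_edge n)

/-- The initial segment of length `n` of an infinite path. -/
def PathSpace.take (x : B.PathSpace) (n : ℕ) : B.FinPath := ⟨n, x.vtx n, x.takeAux n⟩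

/-- The longest common initial segment `x ∧ y` of two distinct infinite paths that have the same
range. -/
noncomputable def PathSpace.meet (x y : B.PathSpace) : B.FinPath :=
  x.take (sSup {n : ℕ | x.take n = y.take n})

open Classical in
/-- The ultrametric `d_w` of a weight `w`: `d_w(x, x) = 0`, `d_w(x, y) = 1` if `x` and `y` have no
common initial segment (not even a common range), and `d_w(x, y) = w(x ∧ y)` otherwise. -/
noncomputable def pathDist (w : B.FinPath → ℝ) (x y : B.PathSpace) : ℝ :=
  if x = y then 0
  else if B.r (x.edge 0) ≠ B.r (y.edge 0) then 1
  else w (x.meet y)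

/-- The diameter of the cylinder set `[γ]` for `d_w`. -/
noncomputable def cylDiam (w : B.FinPath → ℝ) (γ : B.FinPath) : ℝ :=
  sSup {t : ℝ | ∃ x ∈ γ.cylinder, ∃ y ∈ γ.cylinder, t = pathDist w x y}

/-- A choice function: it assigns to every finite path `γ` a pair of points of `[γ]` whose distance
is the diameter of `[γ]`. -/
structure ChoiceFunction (w : B.FinPath → ℝ) where
  pos : B.FinPath → B.PathSpace
  neg : B.FinPath → B.PathSpace
  pos_mem : ∀ γ, pos γ ∈ γ.cylinder
  neg_mem : ∀ γ, neg γ ∈ γ.cylinder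
  dist_eq : ∀ γ, pathDist w (pos γ) (neg γ) = cylDiam w γ

end BratteliDiagram

/-! ### Direct sums of operators on `ℓ²(ι, ℂ²)`, trace and Dixmier trace -/

/-- The Hilbert space `ℓ²(ι, ℂ²)`. -/
def L2C2 (ι : Type u) : Type u := lp (fun _ : ι => EuclideanSpace ℂ (Fin 2)) 2

section Operators

variable {ι : Type u}

noncomputable instance : NormedAddCommGroup (L2C2 ι) :=
  inferInstanceAs (NormedAddCommGroup (lp (fun _ : ι => EuclideanSpace ℂ (Fin 2)) 2))

noncomputable instance : InnerProductSpace ℂ (L2C2 ι) :=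
  inferInstanceAs (InnerProductSpace ℂ (lp (fun _ : ι => EuclideanSpace ℂ (Fin 2)) 2))

instance : CompleteSpace (L2C2 ι) :=
  inferInstanceAs (CompleteSpace (lp (fun _ : ι => EuclideanSpace ℂ (Fin 2)) 2))

/-- The coordinate `ψ(i)` of `ψ ∈ ℓ²(ι, ℂ²)`. -/
def L2C2.coord (ψ : L2C2 ι) (i : ι) : EuclideanSpace ℂ (Fin 2) := ψ.1 i

/-- The element of `ℓ²(ι, ℂ²)` with given square-summable coordinates. -/
def L2C2.mk (f : ι → EuclideanSpace ℂ (Fin 2)) (hf : Memℓp f 2) : L2C2 ι := ⟨f, hf⟩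

theorem L2C2.memℓp (ψ : L2C2 ι) : Memℓp ψ.coord 2 := ψ.2

@[ext] theorem L2C2.ext {ψ φ : L2C2 ι} (h : ∀ i, ψ.coord i = φ.coord i) : ψ = φ :=
  Subtype.ext (funext h)

@[simp] theorem L2C2.coord_mk (f : ι → EuclideanSpace ℂ (Fin 2)) (hf : Memℓp f 2) (i : ι) :
    (L2C2.mk f hf).coord i = f i := rfl

@[simp] theorem L2C2.coord_zero (i : ι) : (0 : L2C2 ι).coord i = 0 := rfl

@[simp] theorem L2C2.coord_add (ψ φ : L2C2 ι) (i : ι) :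
    (ψ + φ).coord i = ψ.coord i + φ.coord i := rfl

@[simp] theorem L2C2.coord_smul (c : ℂ) (ψ : L2C2 ι) (i : ι) :
    (c • ψ).coord i = c • ψ.coord i := rfl

/-- The operator of a `2 × 2` matrix on the Hilbert space `ℂ²`. -/
noncomputable def matOp (a : Matrix (Fin 2) (Fin 2) ℂ) :
    EuclideanSpace ℂ (Fin 2) →L[ℂ] EuclideanSpace ℂ (Fin 2) :=
  Matrix.toEuclideanCLM (n := Fin 2) (𝕜 := ℂ) a

theorem memℓp_blockDiag {a : ι → Matrix (Fin 2) (Fin 2) ℂ} {C : ℝ}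
    (hC : ∀ i, ‖matOp (a i)‖ ≤ C) (ψ : L2C2 ι) :
    Memℓp (fun i => matOp (a i) (ψ.coord i)) 2 := by
  have h : Memℓp ((C : ℂ) • ψ.coord) 2 := ψ.memℓp.const_smul (C : ℂ)
  refine (memℓp_gen_iff (by norm_num)).2 ?_
  refine Summable.of_nonneg_of_le (fun i => by positivity) (fun i => ?_)
    ((memℓp_gen_iff (by norm_num)).1 h)
  have h0 : 0 ≤ C := (norm_nonneg _).trans (hC i)
  have h1 : ‖matOp (a i) (ψ.coord i)‖ ≤ ‖((C : ℂ) • ψ.coord) i‖ := by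
    rw [Pi.smul_apply, norm_smul, Complex.norm_real, Real.norm_of_nonneg h0]
    exact (ContinuousLinearMap.le_opNorm _ _).trans
      (mul_le_mul_of_nonneg_right (hC i) (norm_nonneg _))
  exact Real.rpow_le_rpow (norm_nonneg _) h1 (by norm_num)

open Classical in
/-- The bounded operator `⨁ᵢ aᵢ` on `ℓ²(ι, ℂ²)` of a uniformly bounded family of `2 × 2` matrices
(and `0` if the family is not uniformly bounded). -/
noncomputable def blockDiag (a : ι → Matrix (Fin 2) (Fin 2) ℂ) : L2C2 ι →L[ℂ] L2C2 ι :=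
  if h : ∃ C : ℝ, ∀ i, ‖matOp (a i)‖ ≤ C then
    LinearMap.mkContinuous
      { toFun := fun ψ => L2C2.mk (fun i => matOp (a i) (ψ.coord i))
          (memℓp_blockDiag h.choose_spec ψ)
        map_add' := fun ψ φ => by ext1 i; simp
        map_smul' := fun c ψ => by ext1 i; simp }
      (max h.choose 0)
      (fun ψ => by
        have h0 : (0 : ℝ) ≤ max h.choose 0 := le_max_right _ _
        refine lp.norm_le_of_forall_sum_le (E := fun _ : ι => EuclideanSpace ℂ (Fin 2)) (p := 2)
          (by norm_num) (by positivity) (fun t => ?_)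
        have hψ := lp.sum_rpow_le_norm_rpow (E := fun _ : ι => EuclideanSpace ℂ (Fin 2)) (p := 2)
          (by norm_num) ψ t
        rw [Real.mul_rpow h0 (norm_nonneg _)]
        refine le_trans ?_ (mul_le_mul_of_nonneg_left hψ (by positivity))
        rw [Finset.mul_sum]
        refine Finset.sum_le_sum (fun i _ => ?_)
        rw [← Real.mul_rpow h0 (norm_nonneg _)]
        refine Real.rpow_le_rpow (norm_nonneg _) ?_ (by norm_num)
        exact (ContinuousLinearMap.le_opNorm _ _).trans
          (mul_le_mul_of_nonneg_right ((h.choose_spec i).trans (le_max_left _ _))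
            (norm_nonneg _)))
  else 0

theorem coord_blockDiag {a : ι → Matrix (Fin 2) (Fin 2) ℂ} {C : ℝ}
    (h : ∀ i, ‖matOp (a i)‖ ≤ C) (ψ : L2C2 ι) (i : ι) :
    (blockDiag a ψ).coord i = matOp (a i) (ψ.coord i) := by
  have h' : ∃ C : ℝ, ∀ i, ‖matOp (a i)‖ ≤ C := ⟨C, h⟩
  simp only [blockDiag, dif_pos h']
  rfl

open Classical in
/-- The vector `δ_i ⊗ e_j` of the standard orthonormal basis of `ℓ²(ι, ℂ²)`. -/
noncomputable def stdVec (i : ι) (j : Fin 2) : L2C2 ι :=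
  lp.single (E := fun _ : ι => EuclideanSpace ℂ (Fin 2)) 2 i (EuclideanSpace.single j (1 : ℂ))

/-- The trace of a positive operator on `ℓ²(ι, ℂ²)`, with values in `[0, ∞]`. -/
noncomputable def posTrace (T : L2C2 ι →L[ℂ] L2C2 ι) : ℝ≥0∞ :=
  ∑' i : ι, ∑ j : Fin 2, ENNReal.ofReal (inner ℂ (stdVec i j) (T (stdVec i j))).re

/-- `T` is a positive operator whose Dixmier trace `𝒯(T) = lim_{s ↘ 1} (s - 1) Tr(T ^ s)` exists
and is equal to `c`; here `T ^ s` is given by the continuous functional calculus. -/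
def HasDixmierTrace (T : L2C2 ι →L[ℂ] L2C2 ι) (c : ℝ≥0∞) : Prop :=
  0 ≤ T ∧ Tendsto (fun s : ℝ => ENNReal.ofReal (s - 1) * posTrace (T ^ s)) (𝓝[>] 1) (𝓝 c)

end Operators

/-! ### The Pearson-Bellissard spectral triple of a weighted Bratteli diagram -/

namespace BratteliDiagram

variable {B : BratteliDiagram.{u}}

/-- The representation `π_τ(f) = ⨁_γ diag(f(τ₊(γ)), f(τ₋(γ)))` of bounded functions `f`. -/
noncomputable def ChoiceFunction.rep {w : B.FinPath → ℝ} (τ : ChoiceFunction w)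
    (f : B.PathSpace → ℂ) : L2C2 B.FinPath →L[ℂ] L2C2 B.FinPath :=
  blockDiag fun γ => !![f (τ.pos γ), 0; 0, f (τ.neg γ)]

/-- The `γ`-block `diam[γ]⁻¹ (0 1; 1 0)` of the Dirac operator. -/
noncomputable def diracBlock (w : B.FinPath → ℝ) (γ : B.FinPath) : Matrix (Fin 2) (Fin 2) ℂ :=
  ((cylDiam w γ)⁻¹ : ℂ) • !![0, 1; 1, 0]

/-- The Dirac operator `D = ⨁_γ diam[γ]⁻¹ (0 1; 1 0)`, an unbounded operator with domain
`{ψ : Dψ ∈ ℓ²}`. -/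
noncomputable def dirac (w : B.FinPath → ℝ) : L2C2 B.FinPath →ₗ.[ℂ] L2C2 B.FinPath where
  domain :=
    { carrier := {ψ | Memℓp (fun γ => matOp (diracBlock w γ) (ψ.coord γ)) 2}
      add_mem' := fun {ψ φ} hψ hφ => by
        have := Memℓp.add hψ hφ
        change Memℓp (fun γ => matOp (diracBlock w γ) ((ψ + φ).coord γ)) 2
        simp only [L2C2.coord_add, map_add]
        exact this
      zero_mem' := by
        change Memℓp (fun γ => matOp (diracBlock w γ) ((0 : L2C2 B.FinPath).coord γ)) 2
        simp only [L2C2.coord_zero, map_zero]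
        exact zero_memℓp
      smul_mem' := fun c ψ hψ => by
        have := Memℓp.const_smul hψ c
        change Memℓp (fun γ => matOp (diracBlock w γ) ((c • ψ).coord γ)) 2
        simp only [L2C2.coord_smul, map_smul]
        exact this }
  toFun :=
    { toFun := fun ψ => L2C2.mk (fun γ => matOp (diracBlock w γ) (ψ.1.coord γ)) ψ.2
      map_add' := fun ψ φ => by
        ext1 γ
        simp only [L2C2.coord_mk, L2C2.coord_add, Submodule.coe_add, map_add]
      map_smul' := fun c ψ => by
        ext1 γ
        simp only [L2C2.coord_mk, L2C2.coord_smul, Submodule.coe_smul, map_smul,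
          RingHom.id_apply] }

/-- The inverse `D⁻¹ = ⨁_γ diam[γ] (0 1; 1 0)` of the Dirac operator, a bounded operator. -/
noncomputable def diracInv (w : B.FinPath → ℝ) : L2C2 B.FinPath →L[ℂ] L2C2 B.FinPath :=
  blockDiag fun γ => (cylDiam w γ : ℂ) • !![0, 1; 1, 0]

/-- `diracInv w` is the two-sided inverse of the Dirac operator. -/
theorem diracInv_spec (w : B.FinPath → ℝ) {C : ℝ}
    (hC : ∀ γ, cylDiam w γ ≤ C) (hpos : ∀ γ, 0 < cylDiam w γ) :
    (∀ ψ, ∃ h : diracInv w ψ ∈ (dirac w).domain, dirac w ⟨diracInv w ψ, h⟩ = ψ) ∧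
      ∀ ψ : (dirac w).domain, diracInv w (dirac w ψ) = ψ := by
  have hb : ∀ γ, ‖matOp ((cylDiam w γ : ℂ) • !![0, 1; 1, 0])‖ ≤ C * ‖matOp !![0, 1; 1, 0]‖ := by
    intro γ
    rw [matOp, map_smul, norm_smul, Complex.norm_real, Real.norm_of_nonneg (hpos γ).le]
    exact mul_le_mul_of_nonneg_right (hC γ) (norm_nonneg _)
  have hmul : ∀ a b : Matrix (Fin 2) (Fin 2) ℂ, a * b = 1 → ∀ v, matOp a (matOp b v) = v := by
    intro a b hab v
    have : matOp a * matOp b = 1 := by rw [matOp, matOp, ← map_mul, hab, map_one]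
    exact congrArg (fun T => T v) this
  have h1 : ∀ γ, diracBlock w γ * ((cylDiam w γ : ℂ) • !![0, 1; 1, 0]) = 1 := by
    intro γ
    have h0 : (cylDiam w γ : ℂ) ≠ 0 := Complex.ofReal_ne_zero.2 (hpos γ).ne'
    ext i j
    fin_cases i <;> fin_cases j <;> simp [diracBlock, Matrix.mul_apply, h0]
  have h2 : ∀ γ, ((cylDiam w γ : ℂ) • !![0, 1; 1, 0]) * diracBlock w γ = 1 := by
    intro γ
    have h0 : (cylDiam w γ : ℂ) ≠ 0 := Complex.ofReal_ne_zero.2 (hpos γ).ne'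
    ext i j
    fin_cases i <;> fin_cases j <;> simp [diracBlock, Matrix.mul_apply, h0]
  have h3 : ∀ (ψ : L2C2 B.FinPath) γ,
      matOp (diracBlock w γ) ((diracInv w ψ).coord γ) = ψ.coord γ := by
    intro ψ γ
    rw [diracInv, coord_blockDiag hb]
    exact hmul _ _ (h1 γ) _
  refine ⟨fun ψ => ⟨?_, ?_⟩, fun ψ => ?_⟩
  · change Memℓp (fun γ => matOp (diracBlock w γ) ((diracInv w ψ).coord γ)) 2
    simp only [h3]
    exact ψ.memℓp
  · ext1 γ
    exact h3 ψ γ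
  · ext1 γ
    rw [diracInv, coord_blockDiag hb]
    exact hmul _ _ (h2 γ) _

/-- The operator `|D|^{-t} = (|D|⁻¹) ^ t` for `t > 0`, where `|D|⁻¹ = |D⁻¹|`; absolute value and
power are given by the continuous functional calculus. -/
noncomputable def absDiracPow (w : B.FinPath → ℝ) (t : ℝ) :
    L2C2 B.FinPath →L[ℂ] L2C2 B.FinPath :=
  CFC.abs (diracInv w) ^ t

/-- The multiplier `χ_O`. -/
noncomputable def chi (O : Set B.PathSpace) : B.PathSpace → ℂ := O.indicator 1

end BratteliDiagram

/-! ### Higher-rank graphs -/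

/-- A `k`-graph: a countable small category, in arrows-only form, with a degree functor to `ℕ^k`
that has the factorization property.  `comp f g` is the composite `f g`, which is meaningful only
if `s f = r g`. -/
structure KGraph (k : ℕ) where
  Vert : Type u
  Mor : Type u
  countable_mor : Countable Mor
  r : Mor → Vert
  s : Mor → Vert
  one : Vert → Mor
  comp : Mor → Mor → Mor
  r_one : ∀ v, r (one v) = v
  s_one : ∀ v, s (one v) = v
  r_comp : ∀ f g, s f = r g → r (comp f g) = r f
  s_comp : ∀ f g, s f = r g → s (comp f g) = s g
  one_comp : ∀ f, comp (one (r f)) f = f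
  comp_one : ∀ f, comp f (one (s f)) = f
  assoc : ∀ f g h, s f = r g → s g = r h → comp (comp f g) h = comp f (comp g h)
  d : Mor → Fin k → ℕ
  d_one : ∀ v, d (one v) = 0
  d_comp : ∀ f g, s f = r g → d (comp f g) = d f + d g
  factorization : ∀ (l : Mor) (m n : Fin k → ℕ), d l = m + n →
    ∃! p : Mor × Mor, s p.1 = r p.2 ∧ d p.1 = m ∧ d p.2 = n ∧ comp p.1 p.2 = l

namespace KGraph

variable {k : ℕ} (Λ : KGraph.{u} k)

/-- `Λ` is finite: for every `n` there are only finitely many morphisms of degree `n`. -/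
class IsFinite : Prop where
  finite_deg : ∀ n : Fin k → ℕ, {l : Λ.Mor | Λ.d l = n}.Finite

instance [Λ.IsFinite] : Finite Λ.Vert := by
  have : Finite {l : Λ.Mor | Λ.d l = 0} := (IsFinite.finite_deg (Λ := Λ) 0).to_subtype
  refine Finite.of_injective
    (fun v : Λ.Vert => (⟨Λ.one v, Λ.d_one v⟩ : {l : Λ.Mor | Λ.d l = 0})) (fun v w h => ?_)
  have h' : Λ.one v = Λ.one w := congrArg Subtype.val h
  rw [← Λ.r_one v, h', Λ.r_one]

noncomputable instance [Λ.IsFinite] : Fintype Λ.Vert := Fintype.ofFinite _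

noncomputable instance : DecidableEq Λ.Vert := Classical.decEq _

/-- `Λ` is strongly connected: `v Λ w` is nonempty for all vertices `v`, `w`. -/
def StronglyConnected : Prop := ∀ v w : Λ.Vert, ∃ l : Λ.Mor, Λ.r l = v ∧ Λ.s l = w

/-- The `i`-th adjacency matrix: `A_i(v, w)` is the number of morphisms of degree `e_i` with range
`v` and source `w`. -/
noncomputable def adj (i : Fin k) : Matrix Λ.Vert Λ.Vert ℕ := fun v w =>
  Nat.card {l : Λ.Mor // Λ.d l = Pi.single i 1 ∧ Λ.r l = v ∧ Λ.s l = w}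

section Finite

variable [Λ.IsFinite]

/-- The product `A = A_1 ⋯ A_k`. -/
noncomputable def adjProd : Matrix Λ.Vert Λ.Vert ℕ := (List.ofFn Λ.adj).prod

/-- The spectral radius `ρ_i` of `A_i`. -/
noncomputable def rho (i : Fin k) : ℝ :=
  (spectralRadius ℂ ((Λ.adj i).map (Nat.cast : ℕ → ℂ))).toReal

/-- `ρ(Λ)^n = ρ_1^{n_1} ⋯ ρ_k^{n_k}`. -/
noncomputable def rhoPow (n : Fin k → ℕ) : ℝ := ∏ i, Λ.rho i ^ n i

/-- `x` is a positive vector of sum `1` with `A_i x = ρ_i x` for all `i`. -/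
structure IsPerronFrobenius (x : Λ.Vert → ℝ) : Prop where
  pos : ∀ v, 0 < x v
  sum_eq_one : ∑ v, x v = 1
  eigen : ∀ i, ((Λ.adj i).map (Nat.cast : ℕ → ℝ)).mulVec x = Λ.rho i • x

open Classical in
/-- The Perron-Frobenius eigenvector `x^Λ` (and `0` if there is none). -/
noncomputable def pf : Λ.Vert → ℝ :=
  if h : ∃ x, Λ.IsPerronFrobenius x then h.choose else 0

end Finite

/-- An infinite path: a degree-preserving functor from `Ω_k` to `Λ`, where `Ω_k` has the object set
`ℕ^k` and exactly one morphism `(m, n)`, of range `m`, source `n` and degree `n - m`, for each pair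
`m ≤ n`. -/
@[ext] structure InfPath where
  obj : (Fin k → ℕ) → Λ.Vert
  map : ∀ m n : Fin k → ℕ, m ≤ n → Λ.Mor
  r_map : ∀ m n h, Λ.r (map m n h) = obj m
  s_map : ∀ m n h, Λ.s (map m n h) = obj n
  d_map : ∀ m n h, Λ.d (map m n h) = n - m
  map_self : ∀ m, map m m le_rfl = Λ.one (obj m)
  map_comp : ∀ l m n (h : l ≤ m) (h' : m ≤ n),
    map l n (h.trans h') = Λ.comp (map l m h) (map m n h')

/-- The cylinder set `[l] = {x : x(0, d(l)) = l}`. -/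
def cylinder (l : Λ.Mor) : Set Λ.InfPath := {x | x.map 0 (Λ.d l) (fun _ => Nat.zero_le _) = l}

/-- The topology generated by the cylinder sets. -/
instance : TopologicalSpace Λ.InfPath :=
  TopologicalSpace.generateFrom (Set.range Λ.cylinder)

instance : MeasurableSpace Λ.InfPath := borel _

instance : BorelSpace Λ.InfPath := ⟨rfl⟩

/-- The defining property of the an Huef-Laca-Raeburn-Sims measure on `Λ^∞`:
`M([l]) = ρ(Λ)^{-d(l)} x^Λ_{s(l)}` for all `l`. -/
def IsAHLRSMeasure [Λ.IsFinite] (M : Measure Λ.InfPath) : Prop :=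
  ∀ l : Λ.Mor, M (Λ.cylinder l) = ENNReal.ofReal ((Λ.rhoPow (Λ.d l))⁻¹ * Λ.pf (Λ.s l))

section Bratteli

variable [NeZero k]

/-- The colour of the edges from level `n + 1` to level `n`: colours repeat cyclically. -/
def color (k : ℕ) [NeZero k] (n : ℕ) : Fin k := Fin.ofNat k n

/-- The degree of a path of length `n = q k + t`, `0 ≤ t < k`, whose edges have the colours
`1, …, k, 1, …, k, …`: it is `(q + 1, …, q + 1, q, …, q)` with `t` entries `q + 1`. -/
def rainbowDeg (k n : ℕ) : Fin k → ℕ := fun i => n / k + if (i : ℕ) < n % k then 1 else 0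


theorem rainbowDeg_succ (n : ℕ) :
    rainbowDeg k (n + 1) = rainbowDeg k n + Pi.single (color k n) 1 := by
  have hk : 0 < k := Nat.pos_of_ne_zero (NeZero.ne k)
  have hlt : n % k < k := Nat.mod_lt n hk
  funext i
  have hi : (i : ℕ) < k := i.2
  have hs : (Pi.single (color k n) 1 : Fin k → ℕ) i = if (i : ℕ) = n % k then 1 else 0 := by
    rw [Pi.single_apply]
    exact if_congr (Fin.ext_iff (a := i) (b := color k n)) rfl rfl
  rw [Pi.add_apply, hs]
  simp only [rainbowDeg]
  have hn : n + 1 = k * (n / k) + (n % k + 1) := by rw [← add_assoc, Nat.div_add_mod]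
  rcases Nat.lt_or_ge (n % k + 1) k with h | h
  · have h1 : (n + 1) / k = n / k := by
      rw [hn, Nat.mul_add_div hk, Nat.div_eq_of_lt h, add_zero]
    have h2 : (n + 1) % k = n % k + 1 := by
      rw [hn, Nat.mul_add_mod, Nat.mod_eq_of_lt h]
    rw [h1, h2]
    split_ifs <;> omega
  · have h' : n % k + 1 = k := le_antisymm hlt h
    have h1 : (n + 1) / k = n / k + 1 := by
      rw [hn, h', Nat.mul_add_div hk, Nat.div_self hk]
    have h2 : (n + 1) % k = 0 := by
      rw [hn, h', Nat.mul_add_mod, Nat.mod_self]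
    rw [h1, h2]
    split_ifs <;> omega

/-- The stationary `k`-Bratteli diagram of `Λ`: every level is a copy of the vertex set of `Λ`, and
the edges from level `n + 1` to level `n` are the morphisms of degree `e_i` where `i` is the colour
of level `n`; there are `A_i(p, q)` such edges of range `p` and source `q`. -/
def bratteli [Λ.IsFinite] : BratteliDiagram.{u} where
  V _ := Λ.Vert
  E n := {l : Λ.Mor // Λ.d l = Pi.single (color k n) 1}
  finite_V _ := inferInstance
  finite_E n := (IsFinite.finite_deg (Λ := Λ) (Pi.single (color k n) 1)).to_subtype
  r e := Λ.r e.1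
  s e := Λ.s e.1

/-- The identification of `Λ^∞` with the infinite path space of the Bratteli diagram: an infinite
path is cut into edges of the colours `1, …, k, 1, …, k, …`. -/
def toBratteli [Λ.IsFinite] (x : Λ.InfPath) : Λ.bratteli.PathSpace where
  edge n := ⟨x.map (rainbowDeg k n) (rainbowDeg k (n + 1))
    (by rw [rainbowDeg_succ]; exact le_self_add), by
      rw [x.d_map, rainbowDeg_succ, add_tsub_cancel_left]⟩
  compat n := (x.s_map _ _ _).trans (x.r_map _ _ _).symm

/-- The weight `w_δ(η) = (ρ_1^{q+1} ⋯ ρ_t^{q+1} ρ_{t+1}^q ⋯ ρ_k^q)^{-1/δ} x^Λ_{s(η)}` of a path of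
length `q k + t`. -/
noncomputable def weight [Λ.IsFinite] (δ : ℝ) (η : Λ.bratteli.FinPath) : ℝ :=
  Λ.rhoPow (rainbowDeg k η.1) ^ (-(1 / δ)) * Λ.pf η.2.1

/-- The Borel measure `μ` is the Dixmier trace measure of the spectral triple of the choice
function `τ`: it is finite and `μ([γ]) = 𝒯(π_τ(χ_{[γ]}) |D|^{-δ})` for every finite path `γ`. -/
structure IsDixmierMeasure [Λ.IsFinite] (δ : ℝ)
    (τ : BratteliDiagram.ChoiceFunction (Λ.weight δ)) (μ : Measure Λ.bratteli.PathSpace) :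
    Prop where
  finite : IsFiniteMeasure μ
  cylinder : ∀ γ : Λ.bratteli.FinPath, HasDixmierTrace
    (τ.rep (BratteliDiagram.chi γ.cylinder) * BratteliDiagram.absDiracPow (Λ.weight δ) δ)
    (μ γ.cylinder)

end Bratteli

end KGraph

/-!
The operator `(π_τ(χ_O) |D|^{-δ})^s` is diagonal with eigenvalues `0` and `w_δ(γ)^{δs}`, where
`w_δ(γ)^δ = ρ(Λ)^{-d(γ)} (x^Λ_{s(γ)})^δ`. Along a residue class of levels modulo `k`, its trace is
therefore a power series in `(ρ₁ ⋯ ρ_k)^{-(s-1)}` whose coefficients come from the matrices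
`(A / (ρ₁ ⋯ ρ_k))^p`. These converge in the sense of Abel to the rank-one projection `x^Λ ⊗ l` onto
the Perron–Frobenius eigenvector, where `l` is the left eigenvector with `l ⬝ x^Λ = 1`. Hence
`𝒯(π_τ(χ_O) |D|^{-δ})` is `M(O)` times the constant
`2 k (log (ρ₁ ⋯ ρ_k))⁻¹ ∑ᵥ l_v (x^Λ_v)^δ`, which does not depend on `O` or `τ`. For paths `γ` of
length `N`, only the levels `n ≥ N` contribute to the limit, and there `τ_±(η) ∈ [γ]` exactly when
`η` extends `γ`.
-/

/-! ### Perron–Frobenius theory -/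

section PerronFrobenius

open Matrix

variable {n : Type*} [Fintype n] {A : Matrix n n ℝ} {r : ℝ} {x : n → ℝ}

theorem mulVec_nonneg (hA : ∀ i j, 0 ≤ A i j) (hx : 0 ≤ x) : 0 ≤ A *ᵥ x :=
  fun i => dotProduct_nonneg_of_nonneg (hA i) hx

theorem mulVec_pos (hA : ∀ i j, 0 < A i j) (hx : 0 ≤ x) (hx0 : x ≠ 0) (i : n) :
    0 < (A *ᵥ x) i := by
  obtain ⟨j, hj⟩ := Function.ne_iff.1 hx0
  exact Finset.sum_pos' (fun j _ => mul_nonneg (hA i j).le (hx j))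
    ⟨j, Finset.mem_univ j, mul_pos (hA i j) ((hx j).lt_of_ne' hj)⟩

theorem exists_gt_smul_le {n : Type*} [Finite n] [Nonempty n] {x y : n → ℝ} (hx : ∀ i, 0 < x i)
    (h : ∀ i, r * x i < y i) : ∃ t > r, t • x ≤ y := by
  obtain ⟨i₀, hi₀⟩ := Finite.exists_min fun i => y i / x i
  exact ⟨y i₀ / x i₀, (lt_div_iff₀ (hx i₀)).2 (h i₀), fun i => (le_div_iff₀ (hx i)).1 (hi₀ i)⟩

theorem nonneg_of_pos_eigenvector [Nonempty n] (hA : ∀ i j, 0 ≤ A i j) (hx : ∀ i, 0 < x i)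
    (hAx : A *ᵥ x = r • x) : 0 ≤ r := by
  have i := Classical.arbitrary n
  have h : 0 ≤ (r • x) i := hAx ▸ mulVec_nonneg hA (fun j => (hx j).le) i
  exact nonneg_of_mul_nonneg_left h (hx i)

theorem norm_eigenvalue_le {μ : ℂ} (hA : ∀ i j, 0 ≤ A i j) (hx : ∀ i, 0 < x i)
    (hAx : A *ᵥ x = r • x) {v : n → ℂ} (hv : v ≠ 0)
    (hAv : A.map Complex.ofReal *ᵥ v = μ • v) : ‖μ‖ ≤ r := by
  obtain ⟨j, hj⟩ := Function.ne_iff.1 hv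
  have : Nonempty n := ⟨j⟩
  obtain ⟨i, hi⟩ := Finite.exists_max fun i => ‖v i‖ / x i
  set c := ‖v i‖ / x i with hc
  have hv_le (j : n) : ‖v j‖ ≤ c * x j := (div_le_iff₀ (hx j)).1 (hi j)
  have hvi : ‖v i‖ = c * x i := by rw [hc, div_mul_cancel₀ _ (hx i).ne']
  have hcx : 0 < c * x i :=
    mul_pos ((div_pos (norm_pos_iff.2 hj) (hx j)).trans_le (hi j)) (hx i)
  refine le_of_mul_le_mul_right ?_ hcx
  calc ‖μ‖ * (c * x i) = ‖(μ • v) i‖ := by rw [← hvi, Pi.smul_apply, norm_smul]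
    _ = ‖∑ j, (A i j : ℂ) * v j‖ := by rw [← hAv]; rfl
    _ ≤ ∑ j, A i j * (c * x j) := norm_sum_le_of_le _ fun j _ => by
        rw [norm_mul, Complex.norm_real, Real.norm_of_nonneg (hA i j)]
        exact mul_le_mul_of_nonneg_left (hv_le j) (hA i j)
    _ = (A *ᵥ (c • x)) i := rfl
    _ = r * (c * x i) := by rw [mulVec_smul, hAx, Pi.smul_apply, Pi.smul_apply, smul_eq_mul,
        smul_eq_mul, mul_left_comm]

/-- The Collatz–Wielandt set of a nonnegative matrix `A`: the pairs `(t, x)` with `t ≥ 0` and `x` in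
the standard simplex such that `t x ≤ A x`. The largest such `t` is the Perron eigenvalue. -/
def collatzWielandt (A : Matrix n n ℝ) : Set (ℝ × (n → ℝ)) :=
  {p | 0 ≤ p.1 ∧ p.2 ∈ stdSimplex ℝ n ∧ p.1 • p.2 ≤ A *ᵥ p.2}

theorem collatzWielandt_fst_le (hA : ∀ i j, 0 ≤ A i j) {p : ℝ × (n → ℝ)}
    (hp : p ∈ collatzWielandt A) : p.1 ≤ ∑ i, ∑ j, A i j := by
  obtain ⟨-, ⟨hx, hx1⟩, hle⟩ := hp
  have hx_le (j : n) : p.2 j ≤ 1 := hx1 ▸ Finset.single_le_sum (fun i _ => hx i) (Finset.mem_univ j)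
  calc p.1 = ∑ i, (p.1 • p.2) i := by
        simp only [Pi.smul_apply, smul_eq_mul, ← Finset.mul_sum, hx1, mul_one]
    _ ≤ ∑ i, (A *ᵥ p.2) i := Finset.sum_le_sum fun i _ => hle i
    _ ≤ ∑ i, ∑ j, A i j := Finset.sum_le_sum fun i _ => Finset.sum_le_sum fun j _ =>
        mul_le_of_le_one_right (hA i j) (hx_le j)

theorem isCompact_collatzWielandt (hA : ∀ i j, 0 ≤ A i j) : IsCompact (collatzWielandt A) := by
  have hclosed : IsClosed {p : ℝ × (n → ℝ) | p.1 • p.2 ≤ A *ᵥ p.2} :=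
    isClosed_le (by fun_prop) (by fun_prop)
  convert ((isCompact_Icc (a := (0 : ℝ)) (b := ∑ i, ∑ j, A i j)).prod
    (isCompact_stdSimplex ℝ n)).inter_right hclosed
  ext p
  exact ⟨fun h => ⟨⟨⟨h.1, collatzWielandt_fst_le hA h⟩, h.2.1⟩, h.2.2⟩,
    fun h => ⟨h.1.1.1, h.1.2, h.2⟩⟩

theorem collatzWielandt_nonempty [Nonempty n] (hA : ∀ i j, 0 ≤ A i j) :
    (collatzWielandt A).Nonempty := by
  classical
  have hx := single_mem_stdSimplex ℝ (Classical.arbitrary n)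
  exact ⟨(0, _), le_rfl, hx, (zero_smul ℝ _).trans_le (mulVec_nonneg hA hx.1)⟩

theorem mem_collatzWielandt_normalize [Nonempty n] (hr : 0 ≤ r) (hx : ∀ i, 0 < x i)
    (hle : r • x ≤ A *ᵥ x) : (r, (∑ i, x i)⁻¹ • x) ∈ collatzWielandt A := by
  have hS : 0 < ∑ i, x i := Finset.sum_pos (fun i _ => hx i) Finset.univ_nonempty
  refine ⟨hr, ⟨fun i => mul_nonneg (inv_nonneg.2 hS.le) (hx i).le, ?_⟩, ?_⟩
  · simp only [Pi.smul_apply, smul_eq_mul, ← Finset.mul_sum]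
    exact inv_mul_cancel₀ hS.ne'
  · simp only [mulVec_smul, smul_comm r]
    exact smul_le_smul_of_nonneg_left hle (inv_nonneg.2 hS.le)

theorem le_eigenvalue_of_forall_le_sum [Nonempty n] {c : ℝ} (hA : ∀ i j, 0 ≤ A i j)
    (hx : ∀ i, 0 < x i) (hAx : A *ᵥ x = r • x) (hc : ∀ i, c ≤ ∑ j, A i j) : c ≤ r := by
  obtain ⟨i, hi⟩ := Finite.exists_min x
  refine le_of_mul_le_mul_right ?_ (hx i)
  calc c * x i ≤ (∑ j, A i j) * x i := mul_le_mul_of_nonneg_right (hc i) (hx i).le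
    _ = ∑ j, A i j * x i := Finset.sum_mul ..
    _ ≤ ∑ j, A i j * x j :=
        Finset.sum_le_sum fun j _ => mul_le_mul_of_nonneg_left (hi j) (hA i j)
    _ = r * x i := congrFun hAx i

theorem exists_sum_pow_pos [DecidableEq n] (hA : A.IsIrreducible) :
    ∃ N : ℕ, ∀ i j, 0 < (∑ m ∈ Finset.range N, A ^ m) i j := by
  choose f _ hf using (isIrreducible_iff_exists_pow_pos hA.nonneg).1 hA
  refine ⟨(Finset.univ.sup fun p : n × n => f p.1 p.2) + 1, fun i j => ?_⟩
  rw [Matrix.sum_apply]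
  refine Finset.sum_pos' (fun m _ => pow_apply_nonneg hA.nonneg m i j) ⟨f i j, ?_, hf i j⟩
  exact Finset.mem_range_succ_iff.2
    (Finset.le_sup (f := fun p : n × n => f p.1 p.2) (Finset.mem_univ (i, j)))

theorem pow_mulVec_of_eigen [DecidableEq n] (h : A *ᵥ x = r • x) (m : ℕ) :
    A ^ m *ᵥ x = r ^ m • x := by
  induction m with
  | zero => simp
  | succ m ih => rw [pow_succ, ← mulVec_mulVec, h, mulVec_smul, ih, smul_smul, pow_succ']

theorem eigenvector_pos (hA : A.IsIrreducible) (hAx : A *ᵥ x = r • x) (hx : 0 ≤ x) (hx0 : x ≠ 0)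
    (i : n) : 0 < x i := by
  classical
  obtain ⟨N, hN⟩ := exists_sum_pow_pos hA
  have h := mulVec_pos hN hx hx0 i
  simp only [sum_mulVec, pow_mulVec_of_eigen hAx, ← Finset.sum_smul] at h
  exact (hx i).lt_of_ne fun h0 => h.ne' (by simp [← h0])

/-- Applying a positive polynomial in `A` to `r x ≤ A x` makes it strict in every coordinate. -/
theorem exists_gt_smul_le_mulVec [Nonempty n] (hA : A.IsIrreducible) (hx : 0 ≤ x) (hx0 : x ≠ 0)
    (hle : r • x ≤ A *ᵥ x) (hne : A *ᵥ x ≠ r • x) :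
    ∃ t > r, ∃ y : n → ℝ, (∀ i, 0 < y i) ∧ t • y ≤ A *ᵥ y := by
  classical
  obtain ⟨N, hN⟩ := exists_sum_pow_pos hA
  set P := ∑ m ∈ Finset.range N, A ^ m
  have hcomm : Commute P A := Commute.sum_left _ _ _ fun m _ => (Commute.refl A).pow_left m
  have hlt (i : n) : r * (P *ᵥ x) i < (A *ᵥ (P *ᵥ x)) i := by
    have h := mulVec_pos hN (sub_nonneg.2 hle) (sub_ne_zero.2 hne) i
    rwa [mulVec_sub, mulVec_smul, mulVec_mulVec, hcomm.eq, ← mulVec_mulVec, Pi.sub_apply,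
      sub_pos] at h
  obtain ⟨t, ht, hty⟩ := exists_gt_smul_le (mulVec_pos hN hx hx0) hlt
  exact ⟨t, ht, _, mulVec_pos hN hx hx0, hty⟩

theorem exists_pos_eigenvector [Nonempty n] (hA : A.IsIrreducible) :
    ∃ (r : ℝ) (x : n → ℝ), (∀ i, 0 < x i) ∧ ∑ i, x i = 1 ∧ A *ᵥ x = r • x := by
  obtain ⟨⟨r, x⟩, ⟨hr, hx, hle⟩, hmax⟩ := (isCompact_collatzWielandt hA.nonneg).exists_isMaxOn
    (collatzWielandt_nonempty hA.nonneg) continuous_fst.continuousOn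
  have hx0 : x ≠ 0 := by
    rintro rfl
    simpa using hx.2
  have heig : A *ᵥ x = r • x := by
    by_contra hne
    obtain ⟨t, ht, y, hy, hty⟩ := exists_gt_smul_le_mulVec hA hx.1 hx0 hle hne
    exact ht.not_ge (hmax (mem_collatzWielandt_normalize (hr.trans ht.le) hy hty))
  exact ⟨r, x, eigenvector_pos hA heig hx.1 hx0, hx.2, heig⟩

theorem eq_smul_of_eigen [Nonempty n] {y : n → ℝ} (hA : A.IsIrreducible) (hx : ∀ i, 0 < x i)
    (hAx : A *ᵥ x = r • x) (hAy : A *ᵥ y = r • y) : ∃ c : ℝ, y = c • x := by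
  obtain ⟨i₀, hi₀⟩ := Finite.exists_min fun i => y i / x i
  set c := y i₀ / x i₀ with hc
  refine ⟨c, sub_eq_zero.1 (by_contra fun hne => ?_)⟩
  have hnonneg : 0 ≤ y - c • x := fun i => sub_nonneg.2 ((le_div_iff₀ (hx i)).1 (hi₀ i))
  have heig : A *ᵥ (y - c • x) = r • (y - c • x) := by
    rw [mulVec_sub, mulVec_smul, hAx, hAy, smul_sub, smul_comm]
  have hpos := eigenvector_pos hA heig hnonneg hne i₀
  simp [hc, div_mul_cancel₀ _ (hx i₀).ne'] at hpos

theorem exists_pos_left_eigenvector [Nonempty n] (hA : A.IsIrreducible) (hx : ∀ i, 0 < x i)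
    (hAx : A *ᵥ x = r • x) :
    ∃ l : n → ℝ, (∀ i, 0 < l i) ∧ l ᵥ* A = r • l ∧ l ⬝ᵥ x = 1 := by
  obtain ⟨t, l, hl, -, hAl⟩ := exists_pos_eigenvector hA.transpose
  rw [mulVec_transpose] at hAl
  have hlx : 0 < l ⬝ᵥ x :=
    Finset.sum_pos (fun i _ => mul_pos (hl i) (hx i)) Finset.univ_nonempty
  have htr : t = r := by
    have h : t * (l ⬝ᵥ x) = r * (l ⬝ᵥ x) := by
      rw [← smul_eq_mul, ← smul_dotProduct, ← hAl, ← dotProduct_mulVec, hAx, dotProduct_smul,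
        smul_eq_mul]
    exact mul_right_cancel₀ hlx.ne' h
  refine ⟨(l ⬝ᵥ x)⁻¹ • l, fun i => mul_pos (inv_pos.2 hlx) (hl i), ?_, ?_⟩
  · rw [smul_vecMul, hAl, htr, smul_comm]
  · rw [smul_dotProduct, smul_eq_mul, inv_mul_cancel₀ hlx.ne']

/-- The range of `r - A` is the kernel of `l`, because the eigenvalue `r` is geometrically
simple. -/
theorem exists_eq_smul_add_sub_mulVec [Nonempty n] {l : n → ℝ} (hA : A.IsIrreducible)
    (hx : ∀ i, 0 < x i) (hAx : A *ᵥ x = r • x) (hlA : l ᵥ* A = r • l) (hlx : l ⬝ᵥ x = 1)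
    (z : n → ℝ) : ∃ u : n → ℝ, z = (l ⬝ᵥ z) • x + (r • u - A *ᵥ u) := by
  let T : (n → ℝ) →ₗ[ℝ] n → ℝ := r • LinearMap.id - A.mulVecLin
  let φ : Module.Dual ℝ (n → ℝ) := dotProductBilin ℝ ℝ l
  have hT (u : n → ℝ) : T u = r • u - A *ᵥ u := rfl
  have hφ (u : n → ℝ) : φ u = l ⬝ᵥ u := rfl
  have hx0 : x ≠ 0 := by
    rintro rfl
    simp at hlx
  have hker : LinearMap.ker T = ℝ ∙ x := by
    ext u
    rw [LinearMap.mem_ker, hT, sub_eq_zero, Submodule.mem_span_singleton]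
    refine ⟨fun h => ?_, ?_⟩
    · obtain ⟨c, hc⟩ := eq_smul_of_eigen hA hx hAx h.symm
      exact ⟨c, hc.symm⟩
    · rintro ⟨c, rfl⟩
      rw [mulVec_smul, hAx, smul_comm]
  have hrange : LinearMap.range T = LinearMap.ker φ := by
    refine Submodule.eq_of_le_of_finrank_eq ?_ ?_
    · rintro _ ⟨u, rfl⟩
      rw [LinearMap.mem_ker, hφ, hT, dotProduct_sub, dotProduct_mulVec, hlA, dotProduct_smul,
        smul_dotProduct, sub_self]
    · have hφ0 : φ ≠ 0 := fun h => one_ne_zero (hlx.symm.trans (LinearMap.congr_fun h x))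
      have h1 := LinearMap.finrank_range_add_finrank_ker T
      have h2 := Module.Dual.finrank_ker_add_one_of_ne_zero hφ0
      rw [hker, finrank_span_singleton hx0] at h1
      omega
  have hz : z - (l ⬝ᵥ z) • x ∈ LinearMap.range T := by
    rw [hrange, LinearMap.mem_ker, hφ, dotProduct_sub, dotProduct_smul, hlx, smul_eq_mul, mul_one,
      sub_self]
  obtain ⟨u, hu⟩ := hz
  exact ⟨u, by rw [← hT, hu, add_sub_cancel]⟩

theorem spectralRadius_toReal_of_pos_eigenvector [DecidableEq n] [Nonempty n]
    (hA : ∀ i j, 0 ≤ A i j) (hx : ∀ i, 0 < x i) (hAx : A *ᵥ x = r • x) :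
    (spectralRadius ℂ (A.map Complex.ofReal)).toReal = r := by
  have hr : 0 ≤ r := nonneg_of_pos_eigenvector hA hx hAx
  have hle : spectralRadius ℂ (A.map Complex.ofReal) ≤ ENNReal.ofReal r := by
    refine iSup₂_le fun μ hμ => ?_
    rw [← spectrum_toLin', ← Module.End.hasEigenvalue_iff_mem_spectrum] at hμ
    obtain ⟨v, hv⟩ := hμ.exists_hasEigenvector
    rw [← enorm_eq_nnnorm, ← ofReal_norm]
    exact ENNReal.ofReal_le_ofReal
      (norm_eigenvalue_le hA hx hAx hv.2 (by simpa using hv.apply_eq_smul))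
  have hmem : (r : ℂ) ∈ spectrum ℂ (A.map Complex.ofReal) := by
    rw [← spectrum_toLin', ← Module.End.hasEigenvalue_iff_mem_spectrum]
    refine Module.End.hasEigenvalue_of_hasEigenvector (x := fun i => (x i : ℂ))
      ⟨Module.End.mem_eigenspace_iff.2 ?_, fun h => (hx (Classical.arbitrary n)).ne' ?_⟩
    · ext i
      have h := congrArg Complex.ofReal (congrFun hAx i)
      simpa [mulVec, dotProduct] using h
    · exact Complex.ofReal_eq_zero.1 (congrFun h (Classical.arbitrary n))
  have hge : ENNReal.ofReal r ≤ spectralRadius ℂ (A.map Complex.ofReal) := by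
    refine le_of_eq_of_le ?_ (le_iSup₂ (r : ℂ) hmem)
    rw [← enorm_eq_nnnorm, ← ofReal_norm, Complex.norm_real, Real.norm_of_nonneg hr]
  rw [hle.antisymm hge, ENNReal.toReal_ofReal hr]

end PerronFrobenius

/-! ### Abel means and Dirichlet series -/

section AbelMean

/-- The Abel mean `(1 - s) ∑ sⁿ f(n)` of the sequence `f`, whose limit as `s ↗ 1` is the Abel
average of `f`. -/
noncomputable def abelMean (f : ℕ → ℝ) (s : ℝ) : ℝ := (1 - s) * ∑' n, s ^ n * f n

variable {f : ℕ → ℝ} {s K c : ℝ}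

theorem summable_pow_mul_of_abs_le (hs0 : 0 ≤ s) (hs1 : s < 1) (hf : ∀ n, |f n| ≤ K) :
    Summable fun n => s ^ n * f n := by
  refine ((summable_geometric_of_lt_one hs0 hs1).mul_right K).of_norm_bounded fun n => ?_
  rw [Real.norm_eq_abs, abs_mul, abs_of_nonneg (pow_nonneg hs0 n)]
  exact mul_le_mul_of_nonneg_left (hf n) (pow_nonneg hs0 n)

theorem abs_abelMean_le (hs0 : 0 ≤ s) (hs1 : s < 1) (hf : ∀ n, |f n| ≤ K) :
    |abelMean f s| ≤ K := by
  have hs : 0 < 1 - s := sub_pos.2 hs1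
  have hsum := (hasSum_geometric_of_lt_one hs0 hs1).mul_right K
  have hle : |∑' n, s ^ n * f n| ≤ (1 - s)⁻¹ * K := by
    rw [← Real.norm_eq_abs]
    refine tsum_of_norm_bounded hsum fun n => ?_
    rw [Real.norm_eq_abs, abs_mul, abs_of_nonneg (pow_nonneg hs0 n)]
    exact mul_le_mul_of_nonneg_left (hf n) (pow_nonneg hs0 n)
  calc |abelMean f s| = (1 - s) * |∑' n, s ^ n * f n| := by rw [abelMean, abs_mul, abs_of_pos hs]
    _ ≤ (1 - s) * ((1 - s)⁻¹ * K) := mul_le_mul_of_nonneg_left hle hs.le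
    _ = K := mul_inv_cancel_left₀ hs.ne' K

theorem abelMean_const_add_sub_succ (hs0 : 0 ≤ s) (hs1 : s < 1) (hf : ∀ n, |f n| ≤ K) :
    abelMean (fun n => c + (f n - f (n + 1))) s
      = c + (1 - s) * (f 0 - abelMean (fun n => f (n + 1)) s) := by
  have hsum := summable_pow_mul_of_abs_le hs0 hs1 hf
  have hsum' := summable_pow_mul_of_abs_le hs0 hs1 fun n => hf (n + 1)
  have hgeom := (summable_geometric_of_lt_one hs0 hs1).mul_right c
  have hshift : ∑' n, s ^ n * f n = f 0 + s * ∑' n, s ^ n * f (n + 1) := by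
    rw [hsum.tsum_eq_zero_add, ← tsum_mul_left]
    simp only [pow_zero, one_mul, pow_succ', mul_assoc]
  have hs : 1 - s ≠ 0 := (sub_pos.2 hs1).ne'
  simp only [abelMean, mul_add, mul_sub]
  rw [hgeom.tsum_add (hsum.sub hsum'), hsum.tsum_sub hsum', hshift, tsum_mul_right,
    tsum_geometric_of_lt_one hs0 hs1]
  field_simp
  ring

theorem Ico_zero_one_mem_nhdsLT_one : Set.Ico (0 : ℝ) 1 ∈ 𝓝[<] 1 :=
  Ico_mem_nhdsLT zero_lt_one

theorem tendsto_abelMean_const_add_sub_succ (hf : ∀ n, |f n| ≤ K) :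
    Tendsto (abelMean fun n => c + (f n - f (n + 1))) (𝓝[<] 1) (𝓝 c) := by
  have hbound : IsBoundedUnder (· ≤ ·) (𝓝[<] 1)
      ((‖·‖) ∘ fun s => f 0 - abelMean (fun n => f (n + 1)) s) := by
    refine isBoundedUnder_of_eventually_le (a := K + K) ?_
    filter_upwards [Ico_zero_one_mem_nhdsLT_one] with s hs
    exact (norm_sub_le _ _).trans
      (add_le_add (hf 0) (abs_abelMean_le hs.1 hs.2 fun n => hf (n + 1)))
  have hzero : Tendsto (fun s : ℝ => 1 - s) (𝓝[<] 1) (𝓝 0) := by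
    refine tendsto_nhdsWithin_of_tendsto_nhds ?_
    exact Continuous.tendsto' (by fun_prop) _ _ (sub_self 1)
  have hlim := (hzero.zero_mul_isBoundedUnder_le hbound).const_add c
  rw [add_zero] at hlim
  refine hlim.congr' ?_
  filter_upwards [Ico_zero_one_mem_nhdsLT_one] with s hs
  exact (abelMean_const_add_sub_succ hs.1 hs.2 hf).symm

end AbelMean

section MatrixAbelMean

open Matrix

variable {n : Type*} [Fintype n] {A : Matrix n n ℝ} {r : ℝ} {x : n → ℝ}

theorem exists_abs_dotProduct_mulVec_le (hx : ∀ i, 0 < x i) (m u : n → ℝ) :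
    ∃ K, ∀ (A : Matrix n n ℝ) (r : ℝ), (∀ i j, 0 ≤ A i j) → 0 < r → A *ᵥ x = r • x →
      |r⁻¹ * m ⬝ᵥ (A *ᵥ u)| ≤ K := by
  obtain ⟨c, hc⟩ := Finite.exists_le fun i => |u i| / x i
  have hu (i : n) : |u i| ≤ c * x i := (div_le_iff₀ (hx i)).1 (hc i)
  refine ⟨∑ i, |m i| * (c * x i), fun A r hA hr hAx => ?_⟩
  have hAu (i : n) : |(A *ᵥ u) i| ≤ c * (r * x i) := calc
    |(A *ᵥ u) i| ≤ ∑ j, A i j * (c * x j) := by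
        refine Finset.abs_sum_le_sum_abs _ _ |>.trans (Finset.sum_le_sum fun j _ => ?_)
        rw [abs_mul, abs_of_nonneg (hA i j)]
        exact mul_le_mul_of_nonneg_left (hu j) (hA i j)
    _ = (A *ᵥ (c • x)) i := rfl
    _ = c * (r * x i) := by rw [mulVec_smul, hAx]; rfl
  rw [abs_mul, abs_inv, abs_of_pos hr, inv_mul_le_iff₀ hr, Finset.mul_sum]
  refine Finset.abs_sum_le_sum_abs _ _ |>.trans (Finset.sum_le_sum fun i _ => ?_)
  calc |m i * (A *ᵥ u) i| ≤ |m i| * (c * (r * x i)) := by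
        rw [abs_mul]
        exact mul_le_mul_of_nonneg_left (hAu i) (abs_nonneg _)
    _ = r * (|m i| * (c * x i)) := by ring

theorem tendsto_abelMean_pow_mulVec [DecidableEq n] [Nonempty n] {l : n → ℝ}
    (hA : A.IsIrreducible) (hr : 0 < r) (hx : ∀ i, 0 < x i) (hAx : A *ᵥ x = r • x)
    (hlA : l ᵥ* A = r • l) (hlx : l ⬝ᵥ x = 1)
    (m z : n → ℝ) :
    Tendsto (abelMean fun p => (r ^ p)⁻¹ * m ⬝ᵥ (A ^ p *ᵥ z)) (𝓝[<] 1)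
      (𝓝 ((l ⬝ᵥ z) * (m ⬝ᵥ x))) := by
  obtain ⟨u, hu⟩ := exists_eq_smul_add_sub_mulVec hA hx hAx hlA hlx z
  obtain ⟨K, hbound⟩ := exists_abs_dotProduct_mulVec_le hx m (r • u)
  have hK (p : ℕ) : |(r ^ p)⁻¹ * m ⬝ᵥ (A ^ p *ᵥ (r • u))| ≤ K :=
    hbound _ _ (pow_apply_nonneg hA.nonneg p) (pow_pos hr p) (pow_mulVec_of_eigen hAx p)
  -- `A ^ p (r u - A u) / r ^ p` telescopes.
  refine (tendsto_abelMean_const_add_sub_succ hK).congr fun s => congrArg (abelMean · s) ?_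
  funext p
  have hz : A ^ p *ᵥ z
      = r ^ p • (l ⬝ᵥ z) • x + (A ^ p *ᵥ (r • u) - r⁻¹ • (A ^ (p + 1) *ᵥ (r • u))) := by
    conv_lhs => rw [hu]
    rw [mulVec_add, mulVec_sub, mulVec_smul _ (l ⬝ᵥ z), pow_mulVec_of_eigen hAx, pow_succ,
      ← mulVec_mulVec, mulVec_smul A, mulVec_smul _ r (A *ᵥ u), inv_smul_smul₀ hr.ne', smul_comm]
  rw [hz, dotProduct_add, dotProduct_sub]
  simp only [dotProduct_smul, smul_eq_mul]
  field_simp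
  ring

end MatrixAbelMean

section DirichletSeries

variable {k : ℕ} {a f : ℕ → ℝ} {R K ε : ℝ}

theorem mul_add_eq_pow_mul_of_periodic (hper : ∀ q, a (q + k) = R * a q) (p t : ℕ) :
    a (p * k + t) = R ^ p * a t := by
  induction p with
  | zero => simp
  | succ p ih => rw [add_one_mul, add_right_comm, hper, ih, pow_succ', mul_assoc]

theorem rpow_neg_mul_add_of_periodic (hR : 1 < R) (ha : ∀ q, 0 < a q)
    (hper : ∀ q, a (q + k) = R * a q) (p t : ℕ) :
    a (p * k + t) ^ (-ε) = (R ^ (-ε)) ^ p * a t ^ (-ε) := by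
  have hR0 : 0 ≤ R := zero_le_one.trans hR.le
  rw [mul_add_eq_pow_mul_of_periodic hper, Real.mul_rpow (pow_nonneg hR0 p) (ha t).le,
    Real.rpow_pow_comm hR0]

theorem hasSum_rpow_neg_mul [NeZero k] (hR : 1 < R) (ha : ∀ q, 0 < a q)
    (hper : ∀ q, a (q + k) = R * a q) (hf : ∀ q, |f q| ≤ K) (hε : 0 < ε) :
    HasSum (fun q => a q ^ (-ε) * f q)
      (∑ t : Fin k, a t ^ (-ε) * ∑' p, (R ^ (-ε)) ^ p * f (p * k + t)) := by
  have hs0 : 0 ≤ R ^ (-ε) := Real.rpow_nonneg (zero_le_one.trans hR.le) _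
  have hs1 : R ^ (-ε) < 1 := Real.rpow_lt_one_of_one_lt_of_neg hR (neg_lt_zero.2 hε)
  set e : Fin k × ℕ ≃ ℕ := (Equiv.prodComm _ _).trans (Nat.divModEquiv k).symm
  set g : Fin k × ℕ → ℝ := fun i => a i.1 ^ (-ε) * ((R ^ (-ε)) ^ i.2 * f (i.2 * k + i.1))
  have hg : (fun q => a q ^ (-ε) * f q) ∘ e = g := by
    funext i
    have h := rpow_neg_mul_add_of_periodic (ε := ε) hR ha hper i.2 i.1
    simp only [Function.comp_apply, e, g, Equiv.trans_apply, Equiv.prodComm_apply,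
      Nat.divModEquiv_symm_apply, Prod.fst_swap, Prod.snd_swap]
    rw [h]
    ring
  have hfiber (t : Fin k) : Summable fun p : ℕ => g (t, p) := by
    have h := summable_pow_mul_of_abs_le hs0 hs1 fun p => hf (p * k + t)
    exact h.mul_left (a t ^ (-ε))
  have habs : Summable fun i => |g i| :=
    (summable_prod_of_nonneg fun _ => abs_nonneg _).2 ⟨fun t => (hfiber t).abs, .of_finite⟩
  have hsum : Summable g := habs.of_abs
  have htsum : ∑' i, g i = ∑ t : Fin k, a t ^ (-ε) * ∑' p, (R ^ (-ε)) ^ p * f (p * k + t) := by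
    rw [hsum.tsum_prod' hfiber, tsum_fintype]
    simp only [g, tsum_mul_left]
  rw [← e.hasSum_iff, hg, ← htsum]
  exact hsum.hasSum

theorem tendsto_div_one_sub_rpow_neg (hR : 1 < R) :
    Tendsto (fun ε : ℝ => ε / (1 - R ^ (-ε))) (𝓝[>] 0) (𝓝 (Real.log R)⁻¹) := by
  have hderiv : HasDerivAt (fun ε : ℝ => 1 - R ^ (-ε)) (Real.log R) 0 := by
    simpa using ((hasDerivAt_neg (0 : ℝ)).const_rpow (zero_lt_one.trans hR)).const_sub 1
  have h := (hasDerivAt_iff_tendsto_slope.1 hderiv).inv₀ (Real.log_pos hR).ne'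
  refine (h.mono_left (nhdsWithin_mono 0 fun ε hε => ne_of_gt hε)).congr fun ε => ?_
  simp [slope, div_eq_inv_mul]

theorem tendsto_const_rpow_neg_nhdsGT_zero {b : ℝ} (hb : 0 < b) :
    Tendsto (fun ε : ℝ => b ^ (-ε)) (𝓝[>] 0) (𝓝 1) := by
  have h := (Real.continuousAt_const_rpow hb.ne' (b := -0)).tendsto.comp (continuous_neg.tendsto 0)
  rw [neg_zero, Real.rpow_zero] at h
  exact tendsto_nhdsWithin_of_tendsto_nhds h

theorem tendsto_mul_tsum_rpow_neg_mul [NeZero k] (hR : 1 < R) (ha : ∀ q, 0 < a q)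
    (hper : ∀ q, a (q + k) = R * a q) (hf : ∀ q, |f q| ≤ K) {L : Fin k → ℝ}
    (hL : ∀ t : Fin k, Tendsto (abelMean fun p => f (p * k + t)) (𝓝[<] 1) (𝓝 (L t))) :
    Tendsto (fun ε => ε * ∑' q, a q ^ (-ε) * f q) (𝓝[>] 0) (𝓝 ((Real.log R)⁻¹ * ∑ t, L t)) := by
  have hs : Tendsto (fun ε : ℝ => R ^ (-ε)) (𝓝[>] 0) (𝓝[<] 1) :=
    tendsto_nhdsWithin_iff.2 ⟨tendsto_const_rpow_neg_nhdsGT_zero (zero_lt_one.trans hR), by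
      filter_upwards [self_mem_nhdsWithin] with ε hε
      exact Real.rpow_lt_one_of_one_lt_of_neg hR (neg_lt_zero.2 hε)⟩
  have hlim := (tendsto_div_one_sub_rpow_neg hR).mul (tendsto_finsetSum Finset.univ
    fun (t : Fin k) _ => (tendsto_const_rpow_neg_nhdsGT_zero (ha t)).mul ((hL t).comp hs))
  simp only [one_mul] at hlim
  refine hlim.congr' ?_
  filter_upwards [self_mem_nhdsWithin] with ε hε
  have hne : 1 - R ^ (-ε) ≠ 0 :=
    (sub_pos.2 (Real.rpow_lt_one_of_one_lt_of_neg hR (neg_lt_zero.2 hε))).ne'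
  simp only [(hasSum_rpow_neg_mul hR ha hper hf hε).tsum_eq, Function.comp_apply, abelMean,
    mul_left_comm _ (1 - R ^ (-ε)), ← Finset.mul_sum]
  field_simp

end DirichletSeries

theorem tendsto_mul_tsum_of_tail {h : ℝ → ℕ → ℝ≥0∞} {N : ℕ} {K : ℕ → ℝ≥0∞}
    (hK : ∀ n < N, K n ≠ ∞) (hbd : ∀ s n, 1 < s → n < N → h s n ≤ K n) {t : ℝ → ℕ → ℝ}
    (ht0 : ∀ s q, 1 < s → 0 ≤ t s q) (hts : ∀ s, 1 < s → Summable (t s))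
    (hht : ∀ s q, 1 < s → h s (N + q) = ENNReal.ofReal (t s q)) {c : ℝ}
    (hc : Tendsto (fun s => (s - 1) * ∑' q, t s q) (𝓝[>] 1) (𝓝 c)) :
    Tendsto (fun s : ℝ => ENNReal.ofReal (s - 1) * ∑' n, h s n) (𝓝[>] 1)
      (𝓝 (ENNReal.ofReal c)) := by
  have hsub : Tendsto (fun s : ℝ => ENNReal.ofReal (s - 1)) (𝓝[>] 1) (𝓝 0) :=
    tendsto_nhdsWithin_of_tendsto_nhds ((ENNReal.continuous_ofReal.comp
      (continuous_sub_right 1)).tendsto' _ _ (by simp))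
  have hhead : Tendsto (fun s : ℝ => ∑ n ∈ Finset.range N, ENNReal.ofReal (s - 1) * h s n)
      (𝓝[>] 1) (𝓝 (∑ _n ∈ Finset.range N, 0)) := by
    refine tendsto_finsetSum _ fun n hn => ?_
    rw [Finset.mem_range] at hn
    have hKn := ENNReal.Tendsto.mul_const (b := K n) hsub (Or.inr (hK n hn))
    rw [zero_mul] at hKn
    refine tendsto_of_tendsto_of_tendsto_of_le_of_le' tendsto_const_nhds hKn
      (Eventually.of_forall fun _ => zero_le) ?_
    filter_upwards [self_mem_nhdsWithin] with s hs using mul_le_mul_right (hbd s n hs hn) _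
  have hsum := hhead.add ((ENNReal.continuous_ofReal.tendsto c).comp hc)
  rw [Finset.sum_const_zero, zero_add] at hsum
  refine hsum.congr' ?_
  filter_upwards [self_mem_nhdsWithin] with s (hs : 1 < s)
  rw [← Summable.sum_add_tsum_nat_add' (k := N) ENNReal.summable, mul_add, Finset.mul_sum]
  simp only [add_comm _ N, hht s _ hs]
  rw [← ENNReal.ofReal_tsum_of_nonneg (fun q => ht0 s q hs) (hts s hs),
    ← ENNReal.ofReal_mul (sub_nonneg.2 hs.le)]
  rfl

/-! ### Diagonal operators on `ℓ²(ι, ℂ²)` and their traces -/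

section Eigenvectors

variable {H : Type*} [NormedAddCommGroup H] [InnerProductSpace ℂ H]

theorem mem_spectrum_real_of_eigenvector {T : H →L[ℂ] H} {v : H} (hv0 : v ≠ 0) {c : ℝ}
    (hv : T v = (c : ℂ) • v) : c ∈ spectrum ℝ T := by
  rw [← spectrum.algebraMap_mem_iff ℂ, Complex.coe_algebraMap, spectrum.mem_iff]
  intro hu
  obtain ⟨S, hS⟩ := hu.exists_left_inv
  have hker : (algebraMap ℂ (H →L[ℂ] H) c - T) v = 0 := by
    simp [Algebra.algebraMap_eq_smul_one, hv]
  have hSv := congrArg (fun S : H →L[ℂ] H => S v) hS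
  exact hv0 (by simpa [hker] using hSv.symm)

variable [CompleteSpace H]

theorem cfcHom_apply_eigenvector {T : H →L[ℂ] H} (hT : IsSelfAdjoint T) {v : H}
    {c : spectrum ℝ T} (hv : T v = ((c : ℝ) : ℂ) • v) (g : C(spectrum ℝ T, ℝ)) :
    cfcHom hT g v = (g c : ℂ) • v := by
  induction g using ContinuousMap.induction_on_of_compact with
  | const r =>
    have hconst : ContinuousMap.const (spectrum ℝ T) r = algebraMap ℝ C(spectrum ℝ T, ℝ) r := rfl
    rw [hconst, AlgHomClass.commutes]
    simp [Algebra.algebraMap_eq_smul_one]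
  | id =>
    rw [cfcHom_id hT, hv]
    simp
  | star_id =>
    rw [show star (ContinuousMap.restrict (spectrum ℝ T) (ContinuousMap.id ℝ)) =
      ContinuousMap.restrict (spectrum ℝ T) (ContinuousMap.id ℝ) by ext; simp,
      cfcHom_id hT, hv]
    simp
  | add f g hf hg => simp [hf, hg, add_smul]
  | mul f g hf hg =>
    rw [map_mul, mul_apply_eq_comp, hg, map_smul, hf, smul_smul, ContinuousMap.mul_apply,
      Complex.ofReal_mul, mul_comm]
  | frequently f hf =>
    have hleft : Continuous fun g : C(spectrum ℝ T, ℝ) => cfcHom hT g v :=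
      (ContinuousLinearMap.apply ℂ H v).continuous.comp (cfcHom_continuous hT)
    have hright : Continuous fun g : C(spectrum ℝ T, ℝ) => (g c : ℂ) • v :=
      (Complex.continuous_ofReal.comp (continuous_eval_const c)).smul continuous_const
    exact (isClosed_eq hleft hright).mem_of_frequently_of_tendsto hf tendsto_id

theorem cfc_apply_eigenvector {T : H →L[ℂ] H} (hT : IsSelfAdjoint T) {f : ℝ → ℝ}
    (hf : Continuous f) {v : H} {c : ℝ} (hv : T v = (c : ℂ) • v) :
    cfc f T v = (f c : ℂ) • v := by
  rcases eq_or_ne v 0 with rfl | hv0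
  · simp
  rw [cfc_apply f T hT hf.continuousOn]
  exact cfcHom_apply_eigenvector hT (c := ⟨c, mem_spectrum_real_of_eigenvector hv0 hv⟩) hv _

theorem rpow_apply_eigenvector {T : H →L[ℂ] H} (hT : 0 ≤ T) {v : H} {c : ℝ}
    (hv : T v = (c : ℂ) • v) {s : ℝ} (hs : 0 < s) : (T ^ s) v = ((c ^ s : ℝ) : ℂ) • v := by
  rw [CFC.rpow_eq_cfc_real hT]
  exact cfc_apply_eigenvector hT.isSelfAdjoint (Real.continuous_rpow_const hs.le) hv

theorem abs_apply_eigenvector {T : H →L[ℂ] H} {v : H} {c : ℝ} (hc : 0 ≤ c)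
    (hv : (star T * T) v = ((c ^ 2 : ℝ) : ℂ) • v) : CFC.abs T v = (c : ℂ) • v := by
  rw [CFC.abs, CFC.sqrt_eq_rpow, rpow_apply_eigenvector (star_mul_self_nonneg T) hv (by norm_num),
    ← Real.sqrt_eq_rpow, Real.sqrt_sq hc]

end Eigenvectors

section Operators

variable {ι : Type u}

theorem L2C2.inner_eq_tsum (ψ φ : L2C2 ι) :
    inner ℂ ψ φ = ∑' i, inner ℂ (ψ.coord i) (φ.coord i) :=
  lp.inner_eq_tsum (𝕜 := ℂ) (G := fun _ : ι => EuclideanSpace ℂ (Fin 2)) ψ φ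

open Classical in
theorem coord_stdVec (i : ι) (j : Fin 2) (i' : ι) :
    (stdVec i j).coord i' = if i' = i then EuclideanSpace.single j (1 : ℂ) else 0 := by
  have := lp.single_apply (E := fun _ : ι => EuclideanSpace ℂ (Fin 2)) 2 i
    (EuclideanSpace.single j (1 : ℂ)) i'
  refine this.trans ?_
  by_cases h : i' = i
  · subst h; simp
  · simp [h]

theorem inner_stdVec_self (i : ι) (j : Fin 2) : inner ℂ (stdVec i j) (stdVec i j) = (1 : ℂ) := by
  classical
  rw [L2C2.inner_eq_tsum, tsum_eq_single i]
  · simp [coord_stdVec]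
  · intro i' h
    simp [coord_stdVec, h]

theorem L2C2.hasSum_stdVec (ψ : L2C2 ι) :
    HasSum (fun i => ∑ j : Fin 2, (ψ.coord i) j • stdVec i j) ψ := by
  classical
  refine HasSum.congr_fun (lp.hasSum_single
    (E := fun _ : ι => EuclideanSpace ℂ (Fin 2)) (p := 2) (by norm_num) ψ) fun i => ?_
  ext1 i'
  rw [Fin.sum_univ_two, coord_add, coord_smul, coord_smul, coord_stdVec, coord_stdVec]
  refine Eq.trans ?_ (lp.single_apply (E := fun _ : ι => EuclideanSpace ℂ (Fin 2)) 2 i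
    (ψ.coord i) i').symm
  by_cases h : i' = i
  · subst h
    ext l
    fin_cases l <;> simp
  · simp [h]

theorem L2C2.clm_ext {S T : L2C2 ι →L[ℂ] L2C2 ι} (h : ∀ i j, S (stdVec i j) = T (stdVec i j)) :
    S = T := by
  ext1 ψ
  refine (S.hasSum ψ.hasSum_stdVec).unique ((T.hasSum ψ.hasSum_stdVec).congr_fun fun i => ?_)
  simp [h]

theorem isSelfAdjoint_blockDiag {a : ι → Matrix (Fin 2) (Fin 2) ℂ} {C : ℝ}
    (hC : ∀ i, ‖matOp (a i)‖ ≤ C) (ha : ∀ i, (a i).IsHermitian) :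
    IsSelfAdjoint (blockDiag a) := by
  rw [ContinuousLinearMap.isSelfAdjoint_iff_isSymmetric]
  intro ψ φ
  simp only [ContinuousLinearMap.coe_coe]
  rw [L2C2.inner_eq_tsum, L2C2.inner_eq_tsum]
  refine tsum_congr fun i => ?_
  rw [coord_blockDiag hC, coord_blockDiag hC]
  have hsa : IsSelfAdjoint (matOp (a i)) := by
    rw [IsSelfAdjoint, matOp, ← map_star]
    exact congrArg _ (ha i)
  exact (ContinuousLinearMap.isSelfAdjoint_iff_isSymmetric.1 hsa) _ _

theorem matOp_single (a : Matrix (Fin 2) (Fin 2) ℂ) (j : Fin 2) :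
    matOp a (EuclideanSpace.single j 1) = ∑ l, a l j • EuclideanSpace.single l (1 : ℂ) := by
  ext l
  rw [matOp, Matrix.ofLp_toEuclideanCLM, PiLp.ofLp_single, Matrix.mulVec_single,
    Fin.sum_univ_two]
  fin_cases l <;> simp

theorem blockDiag_stdVec {a : ι → Matrix (Fin 2) (Fin 2) ℂ} {C : ℝ}
    (ha : ∀ i, ‖matOp (a i)‖ ≤ C) (i : ι) (j : Fin 2) :
    blockDiag a (stdVec i j) = ∑ l, a i l j • stdVec i l := by
  classical
  ext1 i'
  rw [coord_blockDiag ha, Fin.sum_univ_two, L2C2.coord_add, L2C2.coord_smul, L2C2.coord_smul,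
    coord_stdVec, coord_stdVec, coord_stdVec]
  by_cases h : i' = i
  · subst h
    simp [matOp_single, Fin.sum_univ_two]
  · simp [h]

theorem norm_matOp_smul_le (b : Matrix (Fin 2) (Fin 2) ℂ) {c C : ℝ} (h0 : 0 ≤ c) (hC : c ≤ C) :
    ‖matOp ((c : ℂ) • b)‖ ≤ C * ‖matOp b‖ := by
  rw [matOp, map_smul, norm_smul, Complex.norm_real, Real.norm_of_nonneg h0]
  exact mul_le_mul_of_nonneg_right hC (norm_nonneg _)

theorem norm_matOp_diag_le {p q : ℂ} (hp : ‖p‖ ≤ 1) (hq : ‖q‖ ≤ 1) :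
    ‖matOp !![p, 0; 0, q]‖ ≤ ‖matOp !![1, 0; 0, 0]‖ + ‖matOp !![0, 0; 0, 1]‖ := by
  have h : (!![p, 0; 0, q] : Matrix (Fin 2) (Fin 2) ℂ) =
      p • !![1, 0; 0, 0] + q • !![0, 0; 0, 1] := by
    ext i j; fin_cases i <;> fin_cases j <;> simp
  rw [h, matOp, map_add, map_smul, map_smul]
  refine (norm_add_le _ _).trans (add_le_add ?_ ?_)
  · rw [norm_smul]; exact mul_le_of_le_one_left (norm_nonneg _) hp
  · rw [norm_smul]; exact mul_le_of_le_one_left (norm_nonneg _) hq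

theorem posTrace_rpow_of_diag {T : L2C2 ι →L[ℂ] L2C2 ι} (hT : 0 ≤ T) {t : ι → Fin 2 → ℝ}
    (h : ∀ i j, T (stdVec i j) = (t i j : ℂ) • stdVec i j) {s : ℝ} (hs : 0 < s) :
    posTrace (T ^ s) = ∑' i, ∑ j, ENNReal.ofReal (t i j ^ s) := by
  refine tsum_congr fun i => Finset.sum_congr rfl fun j _ => ?_
  rw [rpow_apply_eigenvector hT (h i j) hs, inner_smul_right, inner_stdVec_self, mul_one,
    Complex.ofReal_re]

end Operators

namespace BratteliDiagram

variable {B : BratteliDiagram.{u}} {w : B.FinPath → ℝ} {C : ℝ}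

theorem norm_chi_le (O : Set B.PathSpace) (x : B.PathSpace) : ‖chi O x‖ ≤ 1 := by
  by_cases h : x ∈ O <;> simp [chi, h]

theorem norm_rep_chi_le (τ : ChoiceFunction w) (O : Set B.PathSpace) (γ : B.FinPath) :
    ‖matOp !![chi O (τ.pos γ), 0; 0, chi O (τ.neg γ)]‖ ≤
      ‖matOp !![1, 0; 0, 0]‖ + ‖matOp !![0, 0; 0, 1]‖ :=
  norm_matOp_diag_le (norm_chi_le O _) (norm_chi_le O _)

theorem isSelfAdjoint_rep_chi (τ : ChoiceFunction w) (O : Set B.PathSpace) :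
    IsSelfAdjoint (τ.rep (chi O)) := by
  classical
  refine isSelfAdjoint_blockDiag (norm_rep_chi_le τ O) fun γ => ?_
  ext i j
  fin_cases i <;> fin_cases j <;>
    simp [Matrix.conjTranspose_apply, chi, Set.indicator_apply]

/-- The point `τ₊(γ)` for `j = 0` and `τ₋(γ)` for `j = 1`, so that the basis vector `δ_γ ⊗ e_j` is
an eigenvector of `π_τ(f)` of eigenvalue `f (τ.pt γ j)`. -/
def ChoiceFunction.pt (τ : ChoiceFunction w) (γ : B.FinPath) : Fin 2 → B.PathSpace :=
  ![τ.pos γ, τ.neg γ]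

theorem rep_chi_stdVec (τ : ChoiceFunction w) (O : Set B.PathSpace) (γ : B.FinPath) (j : Fin 2) :
    τ.rep (chi O) (stdVec γ j) = chi O (τ.pt γ j) • stdVec γ j := by
  rw [ChoiceFunction.rep, blockDiag_stdVec (norm_rep_chi_le τ O), Fin.sum_univ_two]
  fin_cases j <;> simp [ChoiceFunction.pt]

theorem diracInv_sq_stdVec (h0 : ∀ γ, 0 ≤ cylDiam w γ) (hC : ∀ γ, cylDiam w γ ≤ C)
    (γ : B.FinPath) (j : Fin 2) :
    (star (diracInv w) * diracInv w) (stdVec γ j) =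
      ((cylDiam w γ ^ 2 : ℝ) : ℂ) • stdVec γ j := by
  have hb := fun γ => norm_matOp_smul_le !![0, 1; 1, 0] (h0 γ) (hC γ)
  have hsa : star (diracInv w) = diracInv w := by
    refine isSelfAdjoint_blockDiag hb fun γ => ?_
    ext i j
    fin_cases i <;> fin_cases j <;> simp [Matrix.conjTranspose_apply]
  rw [hsa, mul_apply_eq_comp, diracInv, blockDiag_stdVec hb, Fin.sum_univ_two,
    map_add, map_smul, map_smul, blockDiag_stdVec hb, blockDiag_stdVec hb, sq, Complex.ofReal_mul]
  fin_cases j <;> simp [smul_smul, -Complex.coe_smul, -Complex.real_smul]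

theorem absDiracPow_nonneg (w : B.FinPath → ℝ) (t : ℝ) : 0 ≤ absDiracPow w t := CFC.rpow_nonneg

theorem absDiracPow_stdVec (h0 : ∀ γ, 0 ≤ cylDiam w γ) (hC : ∀ γ, cylDiam w γ ≤ C) {t : ℝ}
    (ht : 0 < t) (γ : B.FinPath) (j : Fin 2) :
    absDiracPow w t (stdVec γ j) = ((cylDiam w γ ^ t : ℝ) : ℂ) • stdVec γ j := by
  rw [absDiracPow]
  exact rpow_apply_eigenvector (CFC.abs_nonneg (diracInv w))
    (abs_apply_eigenvector (h0 γ) (diracInv_sq_stdVec h0 hC γ j)) ht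

theorem rep_mul_absDiracPow_stdVec (h0 : ∀ γ, 0 ≤ cylDiam w γ) (hC : ∀ γ, cylDiam w γ ≤ C)
    (τ : ChoiceFunction w) (O : Set B.PathSpace) {t : ℝ} (ht : 0 < t) (γ : B.FinPath)
    (j : Fin 2) :
    (τ.rep (chi O) * absDiracPow w t) (stdVec γ j) =
      ((O.indicator (fun _ => cylDiam w γ ^ t) (τ.pt γ j) : ℝ) : ℂ) • stdVec γ j := by
  rw [mul_apply_eq_comp, absDiracPow_stdVec h0 hC ht, map_smul, rep_chi_stdVec, smul_smul]
  by_cases h : τ.pt γ j ∈ O <;> simp [chi, h]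

/- `π_τ(χ_O)` is a self-adjoint projection that commutes with `|D|^{-t}`, so the product is
`π_τ(χ_O) |D|^{-t} π_τ(χ_O)`. -/
theorem rep_mul_absDiracPow_nonneg (h0 : ∀ γ, 0 ≤ cylDiam w γ) (hC : ∀ γ, cylDiam w γ ≤ C)
    (τ : ChoiceFunction w) (O : Set B.PathSpace) {t : ℝ} (ht : 0 < t) :
    0 ≤ τ.rep (chi O) * absDiracPow w t := by
  have h : τ.rep (chi O) * absDiracPow w t =
      star (τ.rep (chi O)) * absDiracPow w t * τ.rep (chi O) := by
    refine L2C2.clm_ext fun γ j => ?_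
    rw [(isSelfAdjoint_rep_chi τ O).star_eq, mul_apply_eq_comp (_ * _), rep_chi_stdVec, map_smul,
      rep_mul_absDiracPow_stdVec h0 hC τ O ht, smul_smul]
    by_cases h : τ.pt γ j ∈ O <;> simp [chi, h]
  rw [h]
  exact star_left_conjugate_nonneg (absDiracPow_nonneg w t) _

theorem posTrace_rep_mul_absDiracPow (h0 : ∀ γ, 0 ≤ cylDiam w γ) (hC : ∀ γ, cylDiam w γ ≤ C)
    (τ : ChoiceFunction w) (O : Set B.PathSpace) {t s : ℝ} (ht : 0 < t) (hs : 0 < s) :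
    posTrace ((τ.rep (chi O) * absDiracPow w t) ^ s) =
      ∑' γ, ∑ j, O.indicator (fun _ => ENNReal.ofReal (cylDiam w γ ^ (t * s))) (τ.pt γ j) := by
  rw [posTrace_rpow_of_diag (rep_mul_absDiracPow_nonneg h0 hC τ O ht)
    (rep_mul_absDiracPow_stdVec h0 hC τ O ht) hs]
  refine tsum_congr fun γ => Finset.sum_congr rfl fun j _ => ?_
  by_cases h : τ.pt γ j ∈ O
  · rw [Set.indicator_of_mem h, Set.indicator_of_mem h, Real.rpow_mul (h0 γ)]
  · rw [Set.indicator_of_notMem h, Set.indicator_of_notMem h, Real.zero_rpow hs.ne',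
      ENNReal.ofReal_zero]

theorem rep_chi_univ (τ : ChoiceFunction w) : τ.rep (chi Set.univ) = 1 :=
  L2C2.clm_ext fun γ j => by
    rw [rep_chi_stdVec, chi, Set.indicator_of_mem (Set.mem_univ _), Pi.one_apply, one_smul]
    rfl

end BratteliDiagram

/-! ### The path space of a Bratteli diagram -/

namespace BratteliDiagram

variable {B : BratteliDiagram.{u}}

variable (B) in
/-- The finite paths of length `n` with range in level `0`. -/
abbrev PathN (n : ℕ) : Type u := Σ v : B.V n, B.Path n v

/-- Extend a finite path by an edge. -/
def PathN.snoc {n : ℕ} (g : B.PathN n) (e : {e : B.E n // B.r e = g.1}) : B.PathN (n + 1) :=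
  ⟨B.s e.1, .snoc g.2 e.1 e.2⟩

/-- Remove the last edge of a finite path. -/
def PathN.init {n : ℕ} : B.PathN (n + 1) → B.PathN n
  | ⟨_, .snoc γ _ _⟩ => ⟨_, γ⟩

/-- The last edge of a finite path. -/
def PathN.last {n : ℕ} : (g : B.PathN (n + 1)) → {e : B.E n // B.r e = g.init.1}
  | ⟨_, .snoc _ e h⟩ => ⟨e, h⟩

def pathSuccEquiv (n : ℕ) :
    B.PathN (n + 1) ≃ Σ g : B.PathN n, {e : B.E n // B.r e = g.1} where
  toFun g := ⟨g.init, g.last⟩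
  invFun p := p.1.snoc p.2
  left_inv := by rintro ⟨_, _, _⟩; rfl
  right_inv _ := rfl

def pathZeroEquiv : B.PathN 0 ≃ B.V 0 where
  toFun g := g.1
  invFun v := ⟨v, .nil v⟩
  left_inv := by rintro ⟨_, ⟨⟩⟩; rfl
  right_inv _ := rfl

instance (n : ℕ) : Finite (B.V n) := B.finite_V n

instance (n : ℕ) : Finite (B.E n) := B.finite_E n

instance finite_pathN (n : ℕ) : Finite (B.PathN n) := by
  induction n with
  | zero => exact Finite.of_equiv _ pathZeroEquiv.symm
  | succ n ih => exact Finite.of_equiv _ (pathSuccEquiv n).symm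

noncomputable instance (n : ℕ) : Fintype (B.PathN n) := Fintype.ofFinite _

noncomputable instance (n : ℕ) (v : B.V n) : Fintype {e : B.E n // B.r e = v} :=
  Fintype.ofFinite _

/-- Remove the last `q` edges of a finite path. -/
def PathN.trunc {n : ℕ} : ∀ q, B.PathN (n + q) → B.PathN n
  | 0, g => g
  | q + 1, g => PathN.trunc q g.init

theorem sum_pathN_succ {α : Type*} [AddCommMonoid α] {n : ℕ} (F : B.PathN (n + 1) → α) :
    ∑ g, F g = ∑ g : B.PathN n, ∑ e, F (g.snoc e) := by
  rw [← (pathSuccEquiv n).symm.sum_comp, Fintype.sum_sigma]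
  rfl

/-- The initial segment of length `n` of an infinite path. -/
def PathSpace.takeN (x : B.PathSpace) (n : ℕ) : B.PathN n := ⟨x.vtx n, x.takeAux n⟩

theorem PathSpace.takeN_succ (x : B.PathSpace) (n : ℕ) :
    x.takeN (n + 1) = (x.takeN n).snoc ⟨x.edge n, x.r_edge n⟩ := rfl

theorem snoc_eq_snoc_iff {n : ℕ} {g g' : B.PathN n} {e : {e : B.E n // B.r e = g.1}}
    {e' : {e : B.E n // B.r e = g'.1}} :
    g.snoc e = g'.snoc e' ↔ g = g' ∧ e.1 = e'.1 := by
  constructor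
  · intro h
    exact ⟨congrArg PathN.init h, congrArg (fun g : B.PathN (n + 1) => g.last.1) h⟩
  · rintro ⟨rfl, h⟩
    rw [Subtype.ext h]

theorem PathSpace.takeN_succ_eq_iff {x y : B.PathSpace} {n : ℕ} :
    x.takeN (n + 1) = y.takeN (n + 1) ↔ x.takeN n = y.takeN n ∧ x.edge n = y.edge n := by
  rw [takeN_succ, takeN_succ]
  exact snoc_eq_snoc_iff

theorem PathSpace.takeN_zero_eq_iff {x y : B.PathSpace} :
    x.takeN 0 = y.takeN 0 ↔ B.r (x.edge 0) = B.r (y.edge 0) :=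
  (pathZeroEquiv.apply_eq_iff_eq (x := x.takeN 0) (y := y.takeN 0)).symm

theorem PathSpace.takeN_eq_mono {x y : B.PathSpace} {m n : ℕ} (hmn : m ≤ n)
    (h : x.takeN n = y.takeN n) : x.takeN m = y.takeN m := by
  induction hmn with
  | refl => exact h
  | step _ ih => exact ih (congrArg PathN.init h)

theorem PathSpace.trunc_takeN (x : B.PathSpace) (n q : ℕ) :
    (x.takeN (n + q)).trunc q = x.takeN n := by
  induction q with
  | zero => rfl
  | succ _ ih => exact ih

theorem PathSpace.eq_of_takeN_eq {x y : B.PathSpace} (h : ∀ n, x.takeN n = y.takeN n) : x = y :=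
  PathSpace.ext (funext fun n => (takeN_succ_eq_iff.1 (h (n + 1))).2)

theorem PathSpace.exists_takeN_ne {x y : B.PathSpace} (hxy : x ≠ y) :
    ∃ n, x.takeN n ≠ y.takeN n := by
  by_contra! h
  exact hxy (PathSpace.eq_of_takeN_eq h)

theorem PathSpace.take_eq_iff {x y : B.PathSpace} {n : ℕ} :
    x.take n = y.take n ↔ x.takeN n = y.takeN n :=
  ⟨fun h => eq_of_heq (Sigma.mk.inj h).2, fun h => congrArg (Sigma.mk n) h⟩

theorem mem_cylinder_iff_takeN {n : ℕ} (g : B.PathN n) (x : B.PathSpace) :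
    x ∈ g.2.cylinder ↔ x.takeN n = g := by
  induction n with
  | zero =>
    obtain ⟨v, ⟨⟩⟩ := g
    exact pathZeroEquiv.apply_eq_iff_eq (x := x.takeN 0) (y := ⟨v, .nil v⟩)
  | succ n ih =>
    obtain ⟨_, γ⟩ := g
    cases γ with
    | @snoc _ v γ e h =>
      rw [PathSpace.takeN_succ]
      exact (and_congr (ih ⟨v, γ⟩) Iff.rfl).trans (snoc_eq_snoc_iff (g := x.takeN n)
        (g' := (⟨v, γ⟩ : B.PathN n)) (e := ⟨x.edge n, x.r_edge n⟩) (e' := ⟨e, h⟩)).symm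

theorem FinPath.cylinder_mk {n : ℕ} (g : B.PathN n) :
    FinPath.cylinder (⟨n, g⟩ : B.FinPath) = {x | x.takeN n = g} :=
  Set.ext fun x => mem_cylinder_iff_takeN g x

theorem FinPath.mem_cylinder_iff (γ : B.FinPath) (x : B.PathSpace) :
    x ∈ γ.cylinder ↔ x.takeN γ.1 = γ.2 := mem_cylinder_iff_takeN γ.2 x

theorem PathSpace.takeN_eq_trunc {n q : ℕ} {g : B.PathN (n + q)} {x : B.PathSpace}
    (hx : x ∈ FinPath.cylinder (⟨n + q, g⟩ : B.FinPath)) : x.takeN n = g.trunc q := by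
  rw [← PathSpace.trunc_takeN, (FinPath.mem_cylinder_iff ⟨n + q, g⟩ x).1 hx]

theorem isTopologicalBasis_cylinder :
    TopologicalSpace.IsTopologicalBasis (Set.range (FinPath.cylinder (B := B))) where
  exists_subset_inter := by
    rintro _ ⟨γ, rfl⟩ _ ⟨γ', rfl⟩ x ⟨hx, hx'⟩
    rw [FinPath.mem_cylinder_iff] at hx hx'
    refine ⟨_, ⟨x.take (max γ.1 γ'.1), rfl⟩, (FinPath.mem_cylinder_iff _ _).2 rfl, fun y hy => ?_⟩
    rw [FinPath.mem_cylinder_iff] at hy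
    constructor
    · rw [FinPath.mem_cylinder_iff, ← hx]
      exact PathSpace.takeN_eq_mono (le_max_left _ _) hy
    · rw [FinPath.mem_cylinder_iff, ← hx']
      exact PathSpace.takeN_eq_mono (le_max_right _ _) hy
  sUnion_eq := Set.eq_univ_of_forall fun x =>
    ⟨_, ⟨x.take 0, rfl⟩, (FinPath.mem_cylinder_iff _ _).2 rfl⟩
  eq_generateFrom := rfl

theorem PathSpace.nhds_hasBasis (x : B.PathSpace) :
    (𝓝 x).HasBasis (fun _ : ℕ => True) fun n => {y | y.takeN n = x.takeN n} := by
  refine ⟨fun U => ?_⟩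
  rw [isTopologicalBasis_cylinder.mem_nhds_iff]
  constructor
  · rintro ⟨_, ⟨γ, rfl⟩, hx, hU⟩
    rw [FinPath.mem_cylinder_iff] at hx
    exact ⟨γ.1, trivial, fun y hy => hU ((FinPath.mem_cylinder_iff _ _).2 (hx ▸ hy))⟩
  · rintro ⟨n, -, hU⟩
    exact ⟨_, ⟨x.take n, rfl⟩, (FinPath.mem_cylinder_iff _ _).2 rfl, fun y hy =>
      hU ((FinPath.mem_cylinder_iff _ _).1 hy)⟩

theorem PathSpace.isClopen_takeN_preimage {n : ℕ} (S : Set (B.PathN n)) :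
    IsClopen {x : B.PathSpace | x.takeN n ∈ S} := by
  have hopen : ∀ S : Set (B.PathN n), IsOpen {x : B.PathSpace | x.takeN n ∈ S} := fun S =>
    isOpen_iff_mem_nhds.2 fun x hx => x.nhds_hasBasis.mem_iff.2
      ⟨n, trivial, fun y (hy : y.takeN n = x.takeN n) => by
        change y.takeN n ∈ S; rw [hy]; exact hx⟩
  exact ⟨⟨hopen Sᶜ⟩, hopen S⟩

theorem FinPath.isClopen_cylinder (γ : B.FinPath) : IsClopen γ.cylinder := by
  obtain ⟨n, g⟩ := γ
  rw [FinPath.cylinder_mk]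
  exact PathSpace.isClopen_takeN_preimage {g}

instance : T2Space B.PathSpace := ⟨fun x y hxy => by
  obtain ⟨n, hn⟩ := PathSpace.exists_takeN_ne hxy
  exact ⟨{z | z.takeN n ∈ ({x.takeN n} : Set _)}, {z | z.takeN n ∈ ({x.takeN n}ᶜ : Set _)},
    (PathSpace.isClopen_takeN_preimage _).2, (PathSpace.isClopen_takeN_preimage _).2,
    rfl, Ne.symm hn, Set.disjoint_left.2 fun z hz hz' => hz' hz⟩⟩

instance : SecondCountableTopology B.PathSpace :=
  ⟨⟨_, Set.countable_range _, rfl⟩⟩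

theorem PathSpace.exists_eventually_edge_eq (U : Ultrafilter B.PathSpace) (n : ℕ) :
    ∃ e : B.E n, ∀ᶠ x in (U : Filter B.PathSpace), x.edge n = e := by
  obtain ⟨e, he⟩ := (U.map fun x : B.PathSpace => x.edge n).eq_pure_of_finite
  have hmem : {e} ∈ U.map fun x : B.PathSpace => x.edge n := he ▸ Set.mem_singleton e
  exact ⟨e, hmem⟩

instance : CompactSpace B.PathSpace := ⟨by
  rw [isCompact_iff_ultrafilter_le_nhds]
  intro U _
  choose e he using PathSpace.exists_eventually_edge_eq U
  have hcompat : ∀ n, B.s (e n) = B.r (e (n + 1)) := fun n => by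
    obtain ⟨x, hx, hx'⟩ := ((he n).and (he (n + 1))).exists
    rw [← hx, ← hx', x.compat]
  let y : B.PathSpace := ⟨e, hcompat⟩
  refine ⟨y, Set.mem_univ y, y.nhds_hasBasis.ge_iff.2 fun n _ => ?_⟩
  change ∀ᶠ x in (U : Filter B.PathSpace), x.takeN n = y.takeN n
  induction n with
  | zero =>
    filter_upwards [he 0] with x hx
    rw [PathSpace.takeN_zero_eq_iff, hx]
  | succ n ih =>
    filter_upwards [ih, he n] with x hx hx'
    exact PathSpace.takeN_succ_eq_iff.2 ⟨hx, hx'⟩⟩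

theorem exists_eq_preimage_takeN {O : Set B.PathSpace} (hO : IsClopen O) :
    ∃ (N : ℕ) (S : Set (B.PathN N)), O = {x | x.takeN N ∈ S} := by
  have hloc : ∀ x : B.PathSpace, ∃ n, ∀ y, y.takeN n = x.takeN n → (y ∈ O ↔ x ∈ O) := by
    intro x
    by_cases hx : x ∈ O
    · obtain ⟨n, -, hn⟩ := x.nhds_hasBasis.mem_iff.1 (hO.2.mem_nhds hx)
      exact ⟨n, fun y hy => iff_of_true (hn hy) hx⟩
    · obtain ⟨n, -, hn⟩ := x.nhds_hasBasis.mem_iff.1 (hO.compl.2.mem_nhds hx)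
      exact ⟨n, fun y hy => iff_of_false (hn hy) hx⟩
  choose n hn using hloc
  obtain ⟨t, ht⟩ := CompactSpace.elim_nhds_subcover
    (fun x : B.PathSpace => {y | y.takeN (n x) = x.takeN (n x)})
    (fun x => x.nhds_hasBasis.mem_of_mem trivial)
  have hunif : ∀ x y : B.PathSpace, x.takeN (t.sup n) = y.takeN (t.sup n) → x ∈ O → y ∈ O := by
    intro x y hxy hx
    obtain ⟨z, hz, hxz⟩ := Set.mem_iUnion₂.1 (ht.ge (Set.mem_univ x))
    have hyz : y.takeN (n z) = z.takeN (n z) :=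
      (PathSpace.takeN_eq_mono (Finset.le_sup hz) hxy).symm.trans hxz
    rw [hn z y hyz, ← hn z x hxz]
    exact hx
  refine ⟨t.sup n, (fun x => x.takeN (t.sup n)) '' O, Set.ext fun x => ⟨fun hx => ⟨x, hx, rfl⟩, ?_⟩⟩
  rintro ⟨y, hy, hxy⟩
  exact hunif y x hxy hy

theorem exists_tail [∀ j, Nonempty (B.V j)] (h : ∀ n (v : B.V n), ∃ e : B.E n, B.r e = v)
    (n : ℕ) (v : B.V n) :
    ∃ f : ∀ j, B.E j, B.r (f n) = v ∧ ∀ j, n ≤ j → B.s (f j) = B.r (f (j + 1)) := by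
  classical
  choose e he using h
  let v₀ : ∀ j, B.V j := Function.update (fun j => Classical.arbitrary (B.V j)) n v
  let f : ∀ j, B.E j := fun j => Nat.rec (motive := B.E) (e 0 (v₀ 0))
    (fun j ej => if j + 1 = n then e (j + 1) (v₀ (j + 1)) else e (j + 1) (B.s ej)) j
  refine ⟨f, ?_, fun j hj => ?_⟩
  · have hf : f n = e n (v₀ n) := by
      rcases n with _ | n
      · rfl
      · exact if_pos rfl
    rw [hf, he]
    exact Function.update_self n v _
  · have hf : f (j + 1) = e (j + 1) (B.s (f j)) := if_neg (by omega)
    rw [hf, he]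

theorem exists_path_append {n : ℕ} (g : B.PathN n) (f : ∀ j, B.E j) (hf : B.r (f n) = g.1)
    (hc : ∀ j, n ≤ j → B.s (f j) = B.r (f (j + 1))) :
    ∃ x : B.PathSpace, x.takeN n = g ∧ ∀ j, n ≤ j → x.edge j = f j := by
  classical
  induction n generalizing f with
  | zero =>
    refine ⟨⟨f, fun j => hc j (Nat.zero_le j)⟩, ?_, fun _ _ => rfl⟩
    exact pathZeroEquiv.injective hf
  | succ n ih =>
    obtain ⟨g, e, rfl⟩ : ∃ (g' : B.PathN n) (e : _), g = g'.snoc e :=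
      ⟨g.init, g.last, ((pathSuccEquiv n).symm_apply_apply g).symm⟩
    have hne : ∀ j, n < j → Function.update f n e.1 j = f j := fun j hj =>
      Function.update_of_ne (by omega) _ _
    obtain ⟨x, hx, hxf⟩ := ih g (Function.update f n e.1)
      (by rw [Function.update_self]; exact e.2) (fun j hj => by
        rw [hne (j + 1) (by omega)]
        rcases eq_or_lt_of_le hj with rfl | hj
        · rw [Function.update_self]; exact hf.symm
        · rw [hne j hj]; exact hc j hj)
    refine ⟨x, ?_, fun j hj => by rw [hxf j (by omega), hne j (by omega)]⟩
    rw [PathSpace.takeN_succ]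
    refine snoc_eq_snoc_iff.2 ⟨hx, ?_⟩
    change x.edge n = e.1
    rw [hxf n le_rfl, Function.update_self]

theorem FinPath.cylinder_nonempty [∀ j, Nonempty (B.V j)]
    (h : ∀ n (v : B.V n), ∃ e : B.E n, B.r e = v) (γ : B.FinPath) : γ.cylinder.Nonempty := by
  obtain ⟨n, g⟩ := γ
  obtain ⟨f, hf, hc⟩ := exists_tail h n g.1
  obtain ⟨x, hx, -⟩ := exists_path_append g f hf hc
  exact ⟨x, (FinPath.mem_cylinder_iff _ _).2 hx⟩

variable {w : B.FinPath → ℝ}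

theorem PathSpace.bddAbove_take_eq {x y : B.PathSpace} (hxy : x ≠ y) :
    BddAbove {n : ℕ | x.take n = y.take n} := by
  obtain ⟨n, hn⟩ := PathSpace.exists_takeN_ne hxy
  refine ⟨n, fun m (hm : x.take m = y.take m) => ?_⟩
  by_contra! hlt
  exact hn (PathSpace.takeN_eq_mono hlt.le (PathSpace.take_eq_iff.1 hm))

theorem weight_take_antitone (hw : ∀ n (g : B.PathN n) e, w ⟨n + 1, g.snoc e⟩ ≤ w ⟨n, g⟩)
    (x : B.PathSpace) : Antitone fun n => w (x.take n) :=
  antitone_nat_of_succ_le fun n => hw n (x.takeN n) ⟨x.edge n, x.r_edge n⟩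

theorem pathDist_le (h0 : ∀ γ, 0 ≤ w γ)
    (hw : ∀ n (g : B.PathN n) e, w ⟨n + 1, g.snoc e⟩ ≤ w ⟨n, g⟩) {γ : B.FinPath}
    {x y : B.PathSpace} (hx : x ∈ γ.cylinder) (hy : y ∈ γ.cylinder) : pathDist w x y ≤ w γ := by
  rw [FinPath.mem_cylinder_iff] at hx hy
  unfold pathDist
  split_ifs with hxy hr
  · exact h0 γ
  · exact absurd (PathSpace.takeN_zero_eq_iff.1
      (PathSpace.takeN_eq_mono (Nat.zero_le _) (hx.trans hy.symm))) hr
  · have hmem : γ.1 ∈ {n : ℕ | x.take n = y.take n} := PathSpace.take_eq_iff.2 (hx.trans hy.symm)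
    have hle := le_csSup (PathSpace.bddAbove_take_eq hxy) hmem
    calc w (x.meet y) ≤ w (x.take γ.1) := weight_take_antitone hw x hle
      _ = w γ := congrArg w (Sigma.ext rfl (heq_of_eq hx))

theorem pathDist_eq_of_edge_ne {γ : B.FinPath} {x y : B.PathSpace} (hx : x ∈ γ.cylinder)
    (hy : y ∈ γ.cylinder) (hne : x.edge γ.1 ≠ y.edge γ.1) : pathDist w x y = w γ := by
  rw [FinPath.mem_cylinder_iff] at hx hy
  have hxy : x ≠ y := fun h => hne (by rw [h])
  have hr : B.r (x.edge 0) = B.r (y.edge 0) := PathSpace.takeN_zero_eq_iff.1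
    (PathSpace.takeN_eq_mono (Nat.zero_le _) (hx.trans hy.symm))
  have hlen : {n : ℕ | x.take n = y.take n} = Set.Iic γ.1 := by
    ext m
    refine PathSpace.take_eq_iff.trans ⟨fun h => ?_, fun h =>
      PathSpace.takeN_eq_mono h (hx.trans hy.symm)⟩
    by_contra hlt
    exact hne (PathSpace.takeN_succ_eq_iff.1
      (PathSpace.takeN_eq_mono (Nat.succ_le_of_lt (not_le.1 hlt)) h)).2
  rw [pathDist, if_neg hxy, if_neg (not_not.2 hr), PathSpace.meet, hlen, csSup_Iic]
  exact congrArg w (Sigma.ext rfl (heq_of_eq hx))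

theorem exists_mem_cylinder_edge_ne [∀ j, Nonempty (B.V j)]
    (htwo : ∀ n (v : B.V n), ∃ e e' : B.E n, e ≠ e' ∧ B.r e = v ∧ B.r e' = v) (γ : B.FinPath) :
    ∃ x ∈ γ.cylinder, ∃ y ∈ γ.cylinder, x.edge γ.1 ≠ y.edge γ.1 := by
  obtain ⟨n, g⟩ := γ
  obtain ⟨e, e', hne, he, he'⟩ := htwo n g.1
  have hone : ∀ n (v : B.V n), ∃ e : B.E n, B.r e = v := fun n v =>
    let ⟨e, _, _, he, _⟩ := htwo n v
    ⟨e, he⟩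
  have hext : ∀ e : {e : B.E n // B.r e = g.1},
      ∃ x ∈ FinPath.cylinder (⟨n, g⟩ : B.FinPath), x.edge n = e.1 := by
    intro e
    obtain ⟨x, hx⟩ := FinPath.cylinder_nonempty hone ⟨n + 1, PathN.snoc g e⟩
    rw [FinPath.mem_cylinder_iff] at hx
    obtain ⟨hg, he⟩ := snoc_eq_snoc_iff.1 ((x.takeN_succ n).symm.trans hx)
    exact ⟨x, (FinPath.mem_cylinder_iff _ _).2 hg, he⟩
  obtain ⟨x, hx, hxe⟩ := hext ⟨e, he⟩
  obtain ⟨y, hy, hye⟩ := hext ⟨e', he'⟩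
  exact ⟨x, hx, y, hy, fun hxy => hne (hxe.symm.trans (hxy.trans hye))⟩

theorem cylDiam_eq [∀ j, Nonempty (B.V j)]
    (htwo : ∀ n (v : B.V n), ∃ e e' : B.E n, e ≠ e' ∧ B.r e = v ∧ B.r e' = v)
    (h0 : ∀ γ, 0 ≤ w γ) (hw : ∀ n (g : B.PathN n) e, w ⟨n + 1, g.snoc e⟩ ≤ w ⟨n, g⟩)
    (γ : B.FinPath) : cylDiam w γ = w γ := by
  obtain ⟨x, hx, y, hy, hne⟩ := exists_mem_cylinder_edge_ne htwo γ
  refine IsGreatest.csSup_eq ⟨⟨x, hx, y, hy, (pathDist_eq_of_edge_ne hx hy hne).symm⟩, ?_⟩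
  rintro _ ⟨x, hx, y, hy, rfl⟩
  exact pathDist_le h0 hw hx hy

theorem nonempty_choiceFunction [∀ j, Nonempty (B.V j)]
    (htwo : ∀ n (v : B.V n), ∃ e e' : B.E n, e ≠ e' ∧ B.r e = v ∧ B.r e' = v)
    (h0 : ∀ γ, 0 ≤ w γ) (hw : ∀ n (g : B.PathN n) e, w ⟨n + 1, g.snoc e⟩ ≤ w ⟨n, g⟩) :
    Nonempty (ChoiceFunction w) := by
  choose x hx y hy hne using exists_mem_cylinder_edge_ne htwo
  exact ⟨⟨x, y, hx, hy, fun γ => by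
    rw [cylDiam_eq htwo h0 hw, pathDist_eq_of_edge_ne (hx γ) (hy γ) (hne γ)]⟩⟩

theorem measure_preimage_takeN (μ : Measure B.PathSpace) {n : ℕ} (S : Set (B.PathN n)) :
    μ {x | x.takeN n ∈ S} =
      ∑ g, S.indicator (fun g => μ (FinPath.cylinder (⟨n, g⟩ : B.FinPath))) g := by
  classical
  have hsum := sum_measure_preimage_singleton (μ := μ) (Finset.univ.filter (· ∈ S))
    (f := fun x : B.PathSpace => x.takeN n)
    (fun g _ => (PathSpace.isClopen_takeN_preimage {g}).2.measurableSet)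
  rw [Finset.sum_filter] at hsum
  simp only [Finset.coe_filter, Finset.mem_univ, true_and] at hsum
  refine hsum.symm.trans (Finset.sum_congr rfl fun g _ => ?_)
  rw [Set.indicator_apply, FinPath.cylinder_mk]
  rfl

theorem measure_univ_eq_sum (μ : Measure B.PathSpace) :
    μ Set.univ = ∑ g : B.PathN 0, μ (FinPath.cylinder (⟨0, g⟩ : B.FinPath)) := by
  simpa using measure_preimage_takeN μ (n := 0) Set.univ

theorem FinPath.cylinder_subset {γ γ' : B.FinPath} (hlen : γ.1 ≤ γ'.1)
    (h : (γ.cylinder ∩ γ'.cylinder).Nonempty) : γ'.cylinder ⊆ γ.cylinder := by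
  obtain ⟨x, hx, hx'⟩ := h
  intro y hy
  rw [FinPath.mem_cylinder_iff] at hx hx' hy ⊢
  rw [← hx]
  exact PathSpace.takeN_eq_mono hlen (hy.trans hx'.symm)

theorem isPiSystem_cylinder : IsPiSystem (Set.range (FinPath.cylinder (B := B))) := by
  rintro _ ⟨γ, rfl⟩ _ ⟨γ', rfl⟩ hne
  rcases le_total γ.1 γ'.1 with hlen | hlen
  · exact ⟨γ', (Set.inter_eq_right.2 (FinPath.cylinder_subset hlen hne)).symm⟩
  · rw [Set.inter_comm] at hne
    exact ⟨γ, (Set.inter_eq_left.2 (FinPath.cylinder_subset hlen hne)).symm⟩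

theorem measure_ext_cylinder {μ ν : Measure B.PathSpace} [IsFiniteMeasure μ]
    (h : ∀ γ : B.FinPath, μ γ.cylinder = ν γ.cylinder) : μ = ν := by
  refine ext_of_generate_finite _ isTopologicalBasis_cylinder.borel_eq_generateFrom
    isPiSystem_cylinder ?_ ?_
  · rintro _ ⟨γ, rfl⟩
    exact h γ
  · simp only [measure_univ_eq_sum, h]

theorem sum_trunc_mul {R : Type*} [NonUnitalNonAssocSemiring R] {p : B.FinPath → R}
    (hp : ∀ n (g : B.PathN n), ∑ e, p ⟨n + 1, g.snoc e⟩ = p ⟨n, g⟩) {n : ℕ}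
    (φ : B.PathN n → R) (q : ℕ) :
    ∑ g : B.PathN (n + q), φ (g.trunc q) * p ⟨n + q, g⟩ = ∑ g, φ g * p ⟨n, g⟩ := by
  induction q with
  | zero => rfl
  | succ q ih =>
    rw [← ih]
    refine (sum_pathN_succ _).trans (Finset.sum_congr rfl fun g _ => ?_)
    rw [← hp, Finset.mul_sum]
    rfl

/-- The atomic measure with mass `p γ` at the point `pt γ` for every path `γ` of length `n`; as
`n` grows, these measures approximate the measure with the values `p γ` on cylinder sets. -/
noncomputable def atomicMeasure (p : B.FinPath → ℝ≥0∞) (pt : B.FinPath → B.PathSpace) (n : ℕ) :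
    Measure B.PathSpace :=
  ∑ g : B.PathN n, p ⟨n, g⟩ • Measure.dirac (pt ⟨n, g⟩)

theorem atomicMeasure_preimage_takeN {p : B.FinPath → ℝ≥0∞}
    (hp : ∀ n (g : B.PathN n), ∑ e, p ⟨n + 1, g.snoc e⟩ = p ⟨n, g⟩)
    {pt : B.FinPath → B.PathSpace} (hpt : ∀ γ, pt γ ∈ γ.cylinder) {n : ℕ} (S : Set (B.PathN n))
    (q : ℕ) :
    atomicMeasure p pt (n + q) {x | x.takeN n ∈ S} = ∑ g, S.indicator 1 g * p ⟨n, g⟩ := by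
  rw [← sum_trunc_mul hp, atomicMeasure, Measure.finsetSum_apply]
  refine Finset.sum_congr rfl fun g _ => ?_
  have hmem : pt ⟨n + q, g⟩ ∈ {x : B.PathSpace | x.takeN n ∈ S} ↔ g.trunc q ∈ S := by
    rw [← PathSpace.takeN_eq_trunc (hpt ⟨n + q, g⟩)]
    rfl
  rw [Measure.smul_apply, smul_eq_mul, mul_comm,
    Measure.dirac_apply' _ (PathSpace.isClopen_takeN_preimage S).2.measurableSet]
  by_cases hS : g.trunc q ∈ S
  · rw [Set.indicator_of_mem (hmem.2 hS), Set.indicator_of_mem hS, Pi.one_apply, Pi.one_apply]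
  · rw [Set.indicator_of_notMem (mt hmem.1 hS), Set.indicator_of_notMem hS]

end BratteliDiagram

theorem exists_probabilityMeasure_of_tendsto {X : Type*} [TopologicalSpace X] [CompactSpace X]
    [TopologicalSpace.MetrizableSpace X] [MeasurableSpace X] [BorelSpace X] {ι : Type*}
    {O : ι → Set X} (hO : ∀ i, IsClopen (O i)) {p : ι → ℝ≥0∞} (ν : ℕ → ProbabilityMeasure X)
    (hν : ∀ i, Tendsto (fun n => (ν n : Measure X) (O i)) atTop (𝓝 (p i))) :
    ∃ μ : ProbabilityMeasure X, ∀ i, (μ : Measure X) (O i) = p i := by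
  obtain ⟨μ, -, hμ⟩ := isCompact_iff_ultrafilter_le_nhds.1
    (isCompact_univ (X := ProbabilityMeasure X)) ((hyperfilter ℕ).map ν) (by simp)
  have hlim : Tendsto ν (hyperfilter ℕ : Filter ℕ) (𝓝 μ) := hμ
  refine ⟨μ, fun i => ?_⟩
  let _ : MetricSpace X := TopologicalSpace.metrizableSpaceMetric X
  have hfrontier : (μ : Measure X) (frontier (O i)) = 0 := by
    rw [(hO i).frontier_eq, measure_empty]
  exact tendsto_nhds_unique
    (ProbabilityMeasure.tendsto_measure_of_null_frontier_of_tendsto' hlim hfrontier)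
    ((hν i).mono_left Nat.hyperfilter_le_atTop)

namespace BratteliDiagram

variable {B : BratteliDiagram.{u}}

theorem exists_probabilityMeasure {p : B.FinPath → ℝ≥0∞}
    (hne : ∀ γ : B.FinPath, γ.cylinder.Nonempty) (hone : ∑ g : B.PathN 0, p ⟨0, g⟩ = 1)
    (hp : ∀ n (g : B.PathN n), ∑ e, p ⟨n + 1, g.snoc e⟩ = p ⟨n, g⟩) :
    ∃ μ : Measure B.PathSpace, IsProbabilityMeasure μ ∧ ∀ γ : B.FinPath, μ γ.cylinder = p γ := by
  choose pt hpt using hne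
  have hprob : ∀ n, IsProbabilityMeasure (atomicMeasure p pt n) := fun n => by
    have huniv := atomicMeasure_preimage_takeN hp hpt (n := 0) Set.univ n
    rw [zero_add] at huniv
    exact ⟨by simpa [hone] using huniv⟩
  have hlim : ∀ γ : B.FinPath,
      Tendsto (fun n => atomicMeasure p pt n γ.cylinder) atTop (𝓝 (p γ)) := by
    classical
    rintro ⟨n, g⟩
    refine tendsto_const_nhds.congr' ?_
    filter_upwards [eventually_ge_atTop n] with m hm
    obtain ⟨q, rfl⟩ := Nat.exists_eq_add_of_le hm
    have hval := atomicMeasure_preimage_takeN hp hpt {g} q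
    simp only [Set.indicator_apply, Set.mem_singleton_iff, Pi.one_apply, ite_mul, one_mul,
      zero_mul, Finset.sum_ite_eq', Finset.mem_univ, if_true] at hval
    rw [FinPath.cylinder_mk]
    exact hval.symm
  obtain ⟨μ, hμ⟩ := exists_probabilityMeasure_of_tendsto FinPath.isClopen_cylinder
    (fun n => ⟨atomicMeasure p pt n, hprob n⟩) hlim
  exact ⟨μ, inferInstance, hμ⟩

end BratteliDiagram

theorem HasDixmierTrace.unique {ι : Type*} {T : L2C2 ι →L[ℂ] L2C2 ι} {a b : ℝ≥0∞}
    (ha : HasDixmierTrace T a) (hb : HasDixmierTrace T b) : a = b :=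
  tendsto_nhds_unique ha.2 hb.2

namespace BratteliDiagram

variable {B : BratteliDiagram.{u}} {w : B.FinPath → ℝ}

theorem ChoiceFunction.pt_mem_cylinder (τ : ChoiceFunction w) (γ : B.FinPath) :
    ∀ j, τ.pt γ j ∈ γ.cylinder :=
  Fin.forall_fin_two.2 ⟨τ.pos_mem γ, τ.neg_mem γ⟩

/-- The contribution of the paths of length `n` to the trace of `(π_τ(χ_O) |D|^{-δ})^s`, where
`t = δ s`. -/
noncomputable def ChoiceFunction.levelTrace (τ : ChoiceFunction w) (O : Set B.PathSpace) (t : ℝ)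
    (n : ℕ) : ℝ≥0∞ :=
  ∑ g : B.PathN n, ∑ j, O.indicator (fun _ => ENNReal.ofReal (w ⟨n, g⟩ ^ t)) (τ.pt ⟨n, g⟩ j)

theorem ChoiceFunction.levelTrace_le (h0 : ∀ γ, 0 ≤ w γ) (h1 : ∀ γ, w γ ≤ 1)
    (τ : ChoiceFunction w) (O : Set B.PathSpace) {t : ℝ} (ht : 0 ≤ t) (n : ℕ) :
    τ.levelTrace O t n ≤ ∑ _g : B.PathN n, ∑ _j : Fin 2, 1 :=
  Finset.sum_le_sum fun _ _ => Finset.sum_le_sum fun _ _ =>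
    (Set.indicator_le_self' (fun _ _ => zero_le) _).trans
      (ENNReal.ofReal_le_one.2 (Real.rpow_le_one (h0 _) (h1 _) ht))

theorem ChoiceFunction.levelTrace_takeN (h0 : ∀ γ, 0 ≤ w γ) (τ : ChoiceFunction w) {N : ℕ}
    (S : Set (B.PathN N)) (t : ℝ) (q : ℕ) :
    τ.levelTrace {x | x.takeN N ∈ S} t (N + q) = ENNReal.ofReal
      (2 * ∑ g : B.PathN (N + q), S.indicator 1 (g.trunc q) * w ⟨N + q, g⟩ ^ t) := by
  have hpt (g : B.PathN (N + q)) (j : Fin 2) :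
      (τ.pt ⟨N + q, g⟩ j).takeN N = g.trunc q :=
    PathSpace.takeN_eq_trunc (τ.pt_mem_cylinder _ j)
  have hnonneg (g : B.PathN (N + q)) :
      0 ≤ S.indicator (1 : B.PathN N → ℝ) (g.trunc q) * w ⟨N + q, g⟩ ^ t :=
    mul_nonneg (Set.indicator_nonneg (fun _ _ => zero_le_one) _) (Real.rpow_nonneg (h0 _) t)
  rw [ENNReal.ofReal_mul zero_le_two, ENNReal.ofReal_sum_of_nonneg fun g _ => hnonneg g,
    Finset.mul_sum, ChoiceFunction.levelTrace]
  refine Finset.sum_congr rfl fun g _ => ?_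
  by_cases hg : g.trunc q ∈ S <;> simp [hpt, hg]

theorem ChoiceFunction.posTrace_eq_tsum_levelTrace (h0 : ∀ γ, 0 ≤ w γ) (h1 : ∀ γ, w γ ≤ 1)
    (hdiam : ∀ γ, cylDiam w γ = w γ) (τ : ChoiceFunction w) (O : Set B.PathSpace) {δ s : ℝ}
    (hδ : 0 < δ) (hs : 0 < s) :
    posTrace ((τ.rep (chi O) * absDiracPow w δ) ^ s) = ∑' n, τ.levelTrace O (δ * s) n := by
  rw [posTrace_rep_mul_absDiracPow (fun γ => (h0 γ).trans_eq (hdiam γ).symm)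
    (fun γ => (hdiam γ).trans_le (h1 γ)) τ O hδ hs]
  simp only [hdiam]
  rw [ENNReal.tsum_sigma']
  exact tsum_congr fun n => tsum_fintype _

end BratteliDiagram

/-! ### Counting morphisms of a higher-rank graph -/

namespace KGraph

open Matrix

variable {k : ℕ} {Λ : KGraph.{u} k}

theorem comp_inj {f g f' g' : Λ.Mor} (h : Λ.s f = Λ.r g) (h' : Λ.s f' = Λ.r g')
    (hd : Λ.d f = Λ.d f') (he : Λ.comp f g = Λ.comp f' g') : f = f' ∧ g = g' := by
  have hdg : Λ.d g = Λ.d g' := by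
    have hdc := congrArg Λ.d he
    rw [Λ.d_comp _ _ h, Λ.d_comp _ _ h', hd] at hdc
    exact add_left_cancel hdc
  exact Prod.mk.inj ((Λ.factorization _ _ _ (Λ.d_comp _ _ h')).unique
    (y₁ := (f, g)) (y₂ := (f', g')) ⟨h, hd, hdg, he⟩ ⟨h', rfl, rfl, rfl⟩)

theorem comp_left_cancel {f g g' : Λ.Mor} (h : Λ.s f = Λ.r g) (h' : Λ.s f = Λ.r g')
    (he : Λ.comp f g = Λ.comp f g') : g = g' := (comp_inj h h' rfl he).2

theorem exists_comp_of_le (l : Λ.Mor) {m : Fin k → ℕ} (hm : m ≤ Λ.d l) :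
    ∃ f g, Λ.s f = Λ.r g ∧ Λ.d f = m ∧ Λ.comp f g = l := by
  obtain ⟨p, ⟨hs, hd, -, hc⟩, -⟩ :=
    Λ.factorization l m (Λ.d l - m) (add_tsub_cancel_of_le hm).symm
  exact ⟨p.1, p.2, hs, hd, hc⟩

theorem eq_one_of_d_eq_zero {l : Λ.Mor} (h : Λ.d l = 0) : l = Λ.one (Λ.s l) :=
  (comp_inj (f := Λ.one (Λ.r l)) (g := l) (f' := l) (g' := Λ.one (Λ.s l))
    (Λ.s_one _) (Λ.r_one _).symm (by rw [Λ.d_one, h]) (by rw [Λ.one_comp, Λ.comp_one])).2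

theorem one_injective : Function.Injective Λ.one := fun v w h => by
  rw [← Λ.r_one v, h, Λ.r_one]

/-- Unique factorization: a morphism of degree `m + n` with range `v` and source `w` is a
composite of morphisms of degrees `m` and `n` through some vertex. -/
noncomputable def factorEquiv (m n : Fin k → ℕ) (v w : Λ.Vert) :
    (Σ u, {f : Λ.Mor // Λ.d f = m ∧ Λ.r f = v ∧ Λ.s f = u} ×
      {g : Λ.Mor // Λ.d g = n ∧ Λ.r g = u ∧ Λ.s g = w}) ≃
      {l : Λ.Mor // Λ.d l = m + n ∧ Λ.r l = v ∧ Λ.s l = w} := by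
  refine Equiv.ofBijective (fun p =>
    have h : Λ.s p.2.1.1 = Λ.r p.2.2.1 := p.2.1.2.2.2.trans p.2.2.2.2.1.symm
    ⟨Λ.comp p.2.1.1 p.2.2.1, by rw [Λ.d_comp _ _ h, p.2.1.2.1, p.2.2.2.1],
      by rw [Λ.r_comp _ _ h, p.2.1.2.2.1], by rw [Λ.s_comp _ _ h, p.2.2.2.2.2]⟩) ⟨?_, ?_⟩
  · rintro ⟨u, ⟨f, hfd, hfr, hfs⟩, ⟨g, hgd, hgr, hgs⟩⟩
      ⟨u', ⟨f', hfd', hfr', hfs'⟩, ⟨g', hgd', hgr', hgs'⟩⟩ h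
    obtain ⟨rfl, rfl⟩ := comp_inj (hfs.trans hgr.symm) (hfs'.trans hgr'.symm)
      (hfd.trans hfd'.symm) (congrArg Subtype.val h)
    obtain rfl : u = u' := hfs.symm.trans hfs'
    rfl
  · rintro ⟨l, hld, hlr, hls⟩
    obtain ⟨f, g, hfg, hd, rfl⟩ := exists_comp_of_le l (m := m) (by rw [hld]; exact le_self_add)
    rw [Λ.d_comp _ _ hfg, hd] at hld
    rw [Λ.r_comp _ _ hfg] at hlr
    rw [Λ.s_comp _ _ hfg] at hls
    exact ⟨⟨Λ.s f, ⟨f, hd, hlr, rfl⟩, ⟨g, add_left_cancel hld, hfg.symm, hls⟩⟩, rfl⟩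

variable (Λ) in
/-- The matrix whose `(v, w)`-entry is the number of morphisms of degree `m` with range `v` and
source `w`; for `m = e_i` it is the adjacency matrix `A_i`. -/
noncomputable def countMatrix (m : Fin k → ℕ) : Matrix Λ.Vert Λ.Vert ℝ := fun v w =>
  (Nat.card {l : Λ.Mor // Λ.d l = m ∧ Λ.r l = v ∧ Λ.s l = w} : ℝ)

theorem countMatrix_nonneg (m : Fin k → ℕ) (v w : Λ.Vert) : 0 ≤ Λ.countMatrix m v w :=
  Nat.cast_nonneg _

theorem countMatrix_single (i : Fin k) :
    Λ.countMatrix (Pi.single i 1) = (Λ.adj i).map (Nat.cast : ℕ → ℝ) := rfl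

theorem countMatrix_zero : Λ.countMatrix 0 = 1 := by
  ext v w
  rw [one_apply, countMatrix]
  split_ifs with h
  · subst h
    rw [Nat.cast_eq_one, Nat.card_eq_one_iff_unique]
    refine ⟨⟨?_⟩, ⟨⟨Λ.one v, Λ.d_one v, Λ.r_one v, Λ.s_one v⟩⟩⟩
    rintro ⟨l, hd, -, hs⟩ ⟨l', hd', -, hs'⟩
    exact Subtype.ext ((eq_one_of_d_eq_zero hd).trans
      ((congrArg Λ.one (hs.trans hs'.symm)).trans (eq_one_of_d_eq_zero hd').symm))
  · rw [Nat.cast_eq_zero, Nat.card_eq_zero]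
    refine Or.inl ⟨?_⟩
    rintro ⟨l, hd, rfl, rfl⟩
    apply h
    rw [eq_one_of_d_eq_zero hd, Λ.r_one, Λ.s_one]

section Finite

variable [Λ.IsFinite]

theorem finite_of_deg {m : Fin k → ℕ} (P : Λ.Mor → Prop) (h : ∀ l, P l → Λ.d l = m) :
    Finite {l : Λ.Mor // P l} :=
  ((IsFinite.finite_deg (Λ := Λ) m).subset h).to_subtype

instance (m : Fin k → ℕ) (v w : Λ.Vert) :
    Finite {l : Λ.Mor // Λ.d l = m ∧ Λ.r l = v ∧ Λ.s l = w} := finite_of_deg _ fun _ h => h.1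

instance (m : Fin k → ℕ) (v : Λ.Vert) : Finite {l : Λ.Mor // Λ.d l = m ∧ Λ.r l = v} :=
  finite_of_deg _ fun _ h => h.1

noncomputable instance (m : Fin k → ℕ) (v : Λ.Vert) :
    Fintype {l : Λ.Mor // Λ.d l = m ∧ Λ.r l = v} := Fintype.ofFinite _

theorem countMatrix_add (m n : Fin k → ℕ) :
    Λ.countMatrix (m + n) = Λ.countMatrix m * Λ.countMatrix n := by
  ext v w
  rw [mul_apply, countMatrix, ← Nat.card_congr (factorEquiv m n v w), Nat.card_sigma]
  simp only [Nat.card_prod, Nat.cast_sum, Nat.cast_mul, countMatrix]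

theorem countMatrix_commute (m n : Fin k → ℕ) :
    Commute (Λ.countMatrix m) (Λ.countMatrix n) := by
  rw [Commute, SemiconjBy, ← countMatrix_add, ← countMatrix_add, add_comm]

theorem adjProd_map_cast : Λ.adjProd.map (Nat.cast : ℕ → ℝ) = Λ.countMatrix 1 := by
  have hprod : ∀ L : List (Fin k), (L.map fun i => (Λ.adj i).map (Nat.cast : ℕ → ℝ)).prod =
      Λ.countMatrix (L.map fun i => Pi.single i 1).sum := fun L => by
    induction L with
    | nil => exact countMatrix_zero.symm
    | cons i L ih =>
      rw [List.map_cons, List.prod_cons, List.map_cons, List.sum_cons, countMatrix_add, ih,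
        countMatrix_single]
  have hmap := map_list_prod (Nat.castRingHom ℝ).mapMatrix (List.ofFn Λ.adj)
  rw [List.ofFn_eq_map, List.map_map] at hmap
  rw [adjProd, List.ofFn_eq_map]
  refine hmap.trans ((hprod _).trans ?_)
  rw [← List.ofFn_eq_map, List.sum_ofFn]
  congr 1
  ext j
  simp [Finset.sum_apply, Pi.single_apply]

theorem sum_source_eq (m : Fin k → ℕ) (v : Λ.Vert) (F : Λ.Vert → ℝ) :
    ∑ l : {l : Λ.Mor // Λ.d l = m ∧ Λ.r l = v}, F (Λ.s l.1) = (Λ.countMatrix m *ᵥ F) v := by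
  classical
  have hcard : ∀ w, ((Finset.univ.filter fun l : {l : Λ.Mor // Λ.d l = m ∧ Λ.r l = v} =>
      Λ.s l.1 = w).card : ℝ) = Λ.countMatrix m v w := fun w => by
    rw [← Fintype.card_subtype, ← Nat.card_eq_fintype_card, countMatrix]
    exact congrArg Nat.cast (Nat.card_congr ((Equiv.subtypeSubtypeEquivSubtypeInter
      (fun l : Λ.Mor => Λ.d l = m ∧ Λ.r l = v) (fun l => Λ.s l = w)).trans
      (Equiv.subtypeEquivRight fun l => and_assoc)))
  rw [← Finset.sum_fiberwise_of_maps_to (t := Finset.univ) (g := fun l => Λ.s l.1)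
    (fun _ _ => Finset.mem_univ _)]
  refine Finset.sum_congr rfl fun w _ => ?_
  rw [Finset.sum_congr rfl (g := fun _ => F w)
    (fun l hl => by rw [(Finset.mem_filter.1 hl).2]), Finset.sum_const, nsmul_eq_mul, hcard]

/-! ### The Perron–Frobenius eigenvector of a higher-rank graph -/

theorem rhoPow_zero : Λ.rhoPow 0 = 1 := by simp [rhoPow]

theorem rhoPow_add (m n : Fin k → ℕ) : Λ.rhoPow (m + n) = Λ.rhoPow m * Λ.rhoPow n := by
  simp [rhoPow, pow_add, Finset.prod_mul_distrib]

theorem rhoPow_single (i : Fin k) : Λ.rhoPow (Pi.single i 1) = Λ.rho i := by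
  rw [rhoPow, Finset.prod_eq_single i] <;> simp +contextual

theorem IsPerronFrobenius.countMatrix_mulVec {x : Λ.Vert → ℝ} (hx : Λ.IsPerronFrobenius x)
    (m : Fin k → ℕ) : Λ.countMatrix m *ᵥ x = Λ.rhoPow m • x := by
  have hadd : ∀ m n : Fin k → ℕ, Λ.countMatrix m *ᵥ x = Λ.rhoPow m • x →
      Λ.countMatrix n *ᵥ x = Λ.rhoPow n • x →
      Λ.countMatrix (m + n) *ᵥ x = Λ.rhoPow (m + n) • x := fun m n hm hn => by
    rw [countMatrix_add, ← mulVec_mulVec, hn, mulVec_smul, hm, smul_smul, rhoPow_add, mul_comm]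
  have hzero : Λ.countMatrix 0 *ᵥ x = Λ.rhoPow 0 • x := by
    rw [countMatrix_zero, rhoPow_zero, one_mulVec, one_smul]
  have hm : m = ∑ i, m i • Pi.single i 1 := by
    ext j
    simp [Finset.sum_apply, Pi.single_apply]
  rw [hm]
  refine Finset.sum_induction _ (fun m => Λ.countMatrix m *ᵥ x = Λ.rhoPow m • x) hadd hzero
    fun i _ => ?_
  induction m i with
  | zero => simpa using hzero
  | succ n ih =>
    rw [succ_nsmul]
    refine hadd _ _ ih ?_
    rw [countMatrix_single, rhoPow_single]
    exact hx.eigen i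

theorem IsPerronFrobenius.nonempty {x : Λ.Vert → ℝ} (hx : Λ.IsPerronFrobenius x) :
    Nonempty Λ.Vert := by
  by_contra h
  have := not_nonempty_iff.1 h
  simpa using hx.sum_eq_one

theorem IsPerronFrobenius.le_one {x : Λ.Vert → ℝ} (hx : Λ.IsPerronFrobenius x) (v : Λ.Vert) :
    x v ≤ 1 := by
  rw [← hx.sum_eq_one]
  exact Finset.single_le_sum (fun w _ => (hx.pos w).le) (Finset.mem_univ v)

theorem IsPerronFrobenius.one_lt_rho {x : Λ.Vert → ℝ} (hx : Λ.IsPerronFrobenius x)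
    (htwo : ∀ (i : Fin k) (v : Λ.Vert), 2 ≤ ∑ w, Λ.adj i v w) (i : Fin k) : 1 < Λ.rho i := by
  have := hx.nonempty
  refine one_lt_two.trans_le ?_
  refine le_eigenvalue_of_forall_le_sum (fun _ _ => Nat.cast_nonneg _) hx.pos (hx.eigen i)
    fun v => ?_
  have hv : (2 : ℝ) ≤ ∑ w, (Λ.adj i v w : ℝ) := by exact_mod_cast htwo i v
  exact hv

variable [Nonempty Λ.Vert]

theorem rho_eq_of_pos_eigenvector {i : Fin k} {x : Λ.Vert → ℝ} {c : ℝ} (hx : ∀ v, 0 < x v)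
    (hAx : Λ.countMatrix (Pi.single i 1) *ᵥ x = c • x) : Λ.rho i = c := by
  rw [← spectralRadius_toReal_of_pos_eigenvector (countMatrix_nonneg _) hx hAx, rho,
    countMatrix_single, Matrix.map_map]
  rfl

theorem existsUnique_isPerronFrobenius
    (hirr : (Λ.adjProd.map (Nat.cast : ℕ → ℝ)).IsIrreducible) :
    ∃! x, Λ.IsPerronFrobenius x := by
  rw [adjProd_map_cast] at hirr
  obtain ⟨t, x, hx, hsum, hAx⟩ := exists_pos_eigenvector hirr
  have hpf : Λ.IsPerronFrobenius x := by
    refine ⟨hx, hsum, fun i => ?_⟩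
    have hcomm : Λ.countMatrix 1 *ᵥ (Λ.countMatrix (Pi.single i 1) *ᵥ x) =
        t • (Λ.countMatrix (Pi.single i 1) *ᵥ x) := by
      rw [mulVec_mulVec, (countMatrix_commute _ _).eq, ← mulVec_mulVec, hAx, mulVec_smul]
    obtain ⟨c, hc⟩ := eq_smul_of_eigen hirr hx hAx hcomm
    rw [rho_eq_of_pos_eigenvector hx hc]
    exact hc
  refine ⟨x, hpf, fun y hy => ?_⟩
  obtain ⟨c, rfl⟩ := eq_smul_of_eigen hirr hx (hpf.countMatrix_mulVec 1) (hy.countMatrix_mulVec 1)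
  have hc := hy.sum_eq_one
  simp only [Pi.smul_apply, smul_eq_mul, ← Finset.mul_sum, hsum, mul_one] at hc
  rw [hc, one_smul]

theorem isPerronFrobenius_pf (hirr : (Λ.adjProd.map (Nat.cast : ℕ → ℝ)).IsIrreducible) :
    Λ.IsPerronFrobenius Λ.pf := by
  have hex := (existsUnique_isPerronFrobenius hirr).exists
  rw [pf, dif_pos hex]
  exact hex.choose_spec

end Finite

/-! ### Infinite paths -/

/-- The initial segment of degree `n` of an infinite path. -/
def InfPath.pre (x : Λ.InfPath) (n : Fin k → ℕ) : Λ.Mor := x.map 0 n (fun _ => Nat.zero_le _)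

@[simp] theorem InfPath.d_pre (x : Λ.InfPath) (n : Fin k → ℕ) : Λ.d (x.pre n) = n := by
  rw [pre, x.d_map, tsub_zero]

@[simp] theorem InfPath.s_pre (x : Λ.InfPath) (n : Fin k → ℕ) : Λ.s (x.pre n) = x.obj n :=
  x.s_map _ _ _

theorem InfPath.pre_comp (x : Λ.InfPath) {m n : Fin k → ℕ} (h : m ≤ n) :
    x.pre n = Λ.comp (x.pre m) (x.map m n h) := x.map_comp 0 m n _ h

theorem mem_cylinder_iff {l : Λ.Mor} {x : Λ.InfPath} : x ∈ Λ.cylinder l ↔ x.pre (Λ.d l) = l :=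
  Iff.rfl

theorem InfPath.pre_eq_of_le {x y : Λ.InfPath} {m n : Fin k → ℕ} (h : m ≤ n)
    (hn : x.pre n = y.pre n) : x.pre m = y.pre m ∧ x.map m n h = y.map m n h := by
  rw [x.pre_comp h, y.pre_comp h] at hn
  exact comp_inj (by rw [s_pre, x.r_map]) (by rw [s_pre, y.r_map]) (by simp only [d_pre]) hn

theorem InfPath.ext_of_cofinal {x y : Λ.InfPath}
    (h : ∀ m, ∃ n, m ≤ n ∧ x.pre n = y.pre n) : x = y := by
  have hpre : ∀ m, x.pre m = y.pre m := fun m =>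
    let ⟨_, hmn, hn⟩ := h m
    (pre_eq_of_le hmn hn).1
  refine InfPath.ext (funext fun m => ?_) ?_
  · rw [← s_pre, ← s_pre, hpre]
  · funext m n hmn
    exact (pre_eq_of_le hmn (hpre n)).2

/-- `f` is an initial segment of `l`: `l = f g` for some morphism `g`. -/
def IsPrefix (f l : Λ.Mor) : Prop := ∃ g, Λ.s f = Λ.r g ∧ Λ.comp f g = l

theorem IsPrefix.refl (l : Λ.Mor) : IsPrefix l l :=
  ⟨Λ.one (Λ.s l), (Λ.r_one _).symm, Λ.comp_one l⟩

theorem IsPrefix.trans {e f l : Λ.Mor} (hef : IsPrefix e f) (hfl : IsPrefix f l) :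
    IsPrefix e l := by
  obtain ⟨g, hg, rfl⟩ := hef
  obtain ⟨b, hb, rfl⟩ := hfl
  rw [Λ.s_comp _ _ hg] at hb
  exact ⟨Λ.comp g b, by rw [Λ.r_comp _ _ hb, hg], (Λ.assoc _ _ _ hg hb).symm⟩

theorem IsPrefix.eq_of_d_eq {f f' l : Λ.Mor} (h : IsPrefix f l) (h' : IsPrefix f' l)
    (hd : Λ.d f = Λ.d f') : f = f' := by
  obtain ⟨g, hg, hgl⟩ := h
  obtain ⟨g', hg', hgl'⟩ := h'
  exact (comp_inj hg hg' hd (hgl.trans hgl'.symm)).1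

theorem exists_isPrefix_of_le (l : Λ.Mor) {m : Fin k → ℕ} (hm : m ≤ Λ.d l) :
    ∃ f, Λ.d f = m ∧ IsPrefix f l :=
  let ⟨f, g, hfg, hd, hl⟩ := exists_comp_of_le l hm
  ⟨f, hd, g, hfg, hl⟩

theorem IsPrefix.of_d_le {e f l : Λ.Mor} (he : IsPrefix e l) (hf : IsPrefix f l)
    (hd : Λ.d e ≤ Λ.d f) : IsPrefix e f := by
  obtain ⟨e', hde, he'⟩ := exists_isPrefix_of_le f hd
  rwa [he.eq_of_d_eq (he'.trans hf) hde.symm]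

theorem exists_infPath_of_isPrefix {f : (Fin k → ℕ) → Λ.Mor} (hd : ∀ n, Λ.d (f n) = n)
    (hf : ∀ m n, m ≤ n → IsPrefix (f m) (f n)) : ∃ x : Λ.InfPath, ∀ n, x.pre n = f n := by
  choose b hb hbf using hf
  have hsb : ∀ m n h, Λ.s (b m n h) = Λ.s (f n) := fun m n h => by
    rw [← hbf m n h, Λ.s_comp _ _ (hb m n h)]
  let x : Λ.InfPath :=
    { obj := fun n => Λ.s (f n)
      map := b
      r_map := fun m n h => (hb m n h).symm
      s_map := hsb
      d_map := fun m n h => by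
        have hdeg := congrArg Λ.d (hbf m n h)
        rw [Λ.d_comp _ _ (hb m n h), hd, hd] at hdeg
        exact (tsub_eq_of_eq_add_rev hdeg.symm).symm
      map_self := fun m => comp_left_cancel (hb m m le_rfl) (Λ.r_one _).symm
        (by rw [hbf, Λ.comp_one])
      map_comp := fun l m n h h' => by
        have hsr : Λ.s (b l m h) = Λ.r (b m n h') := by rw [hsb, hb]
        refine comp_left_cancel (hb l n _) (by rw [Λ.r_comp _ _ hsr, hb]) ?_
        rw [hbf, ← Λ.assoc _ _ _ (hb l m h) hsr, hbf, hbf] }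
  refine ⟨x, fun n => ?_⟩
  have hzero : f 0 = Λ.one (Λ.r (x.pre n)) := by
    rw [eq_one_of_d_eq_zero (hd 0)]
    exact congrArg _ (hb 0 n _)
  have hcomp : Λ.comp (f 0) (x.pre n) = f n := hbf 0 n _
  rwa [hzero, Λ.one_comp] at hcomp

theorem exists_infPath {l : ℕ → Λ.Mor} (hl : ∀ j, IsPrefix (l j) (l (j + 1)))
    (hcof : ∀ n, ∃ j, n ≤ Λ.d (l j)) : ∃ x : Λ.InfPath, ∀ j, x.pre (Λ.d (l j)) = l j := by
  have hmono : ∀ i j, i ≤ j → IsPrefix (l i) (l j) := fun i j hij => by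
    induction hij with
    | refl => exact IsPrefix.refl _
    | step _ ih => exact ih.trans (hl _)
  choose J hJ using hcof
  choose f hdf hfl using fun n => exists_isPrefix_of_le (l (J n)) (hJ n)
  have hfJ : ∀ n j, J n ≤ j → IsPrefix (f n) (l j) := fun n j hj => (hfl n).trans (hmono _ _ hj)
  obtain ⟨x, hx⟩ := exists_infPath_of_isPrefix hdf fun m n hmn =>
    (hfJ m _ (le_max_left (J m) (J n))).of_d_le (hfJ n _ (le_max_right (J m) (J n)))
      (by rwa [hdf, hdf])
  refine ⟨x, fun j => (hx _).trans ?_⟩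
  exact (hfJ _ _ (le_max_left _ j)).eq_of_d_eq (hmono j _ (le_max_right _ j)) (hdf _)

section Rainbow

theorem rainbowDeg_zero : rainbowDeg k 0 = 0 := by
  ext i
  simp [rainbowDeg]

variable [NeZero k]

theorem rainbowDeg_mono : Monotone (rainbowDeg k) :=
  monotone_nat_of_le_succ fun n => by rw [rainbowDeg_succ]; exact le_self_add

theorem rainbowDeg_add_period (n : ℕ) : rainbowDeg k (n + k) = rainbowDeg k n + 1 := by
  ext i
  simp only [rainbowDeg, Pi.add_apply, Pi.one_apply,
    Nat.add_div_right n (Nat.pos_of_ne_zero (NeZero.ne k)), Nat.add_mod_right]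
  omega

theorem exists_le_rainbowDeg (m : Fin k → ℕ) : ∃ n, m ≤ rainbowDeg k n := by
  refine ⟨(Finset.univ.sup m) * k, fun i => ?_⟩
  rw [rainbowDeg, Nat.mul_div_cancel _ (Nat.pos_of_ne_zero (NeZero.ne k))]
  exact (Finset.le_sup (Finset.mem_univ i)).trans le_self_add

theorem cylinder_nonempty (h : ∀ (i : Fin k) (v : Λ.Vert), ∃ e, Λ.d e = Pi.single i 1 ∧ Λ.r e = v)
    (l : Λ.Mor) : (Λ.cylinder l).Nonempty := by
  choose e hde hre using h
  let L : ℕ → Λ.Mor := fun j => Nat.rec l (fun j f => Λ.comp f (e (color k j) (Λ.s f))) j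
  have hd : ∀ j, Λ.d (L j) = Λ.d l + rainbowDeg k j := fun j => by
    induction j with
    | zero => rw [rainbowDeg_zero, add_zero]; rfl
    | succ j ih =>
      change Λ.d (Λ.comp (L j) _) = _
      rw [Λ.d_comp _ _ (hre _ _).symm, ih, hde, rainbowDeg_succ, add_assoc]
  obtain ⟨x, hx⟩ := exists_infPath (l := L) (fun j => ⟨_, (hre _ _).symm, rfl⟩) fun n =>
    let ⟨j, hj⟩ := exists_le_rainbowDeg n
    ⟨j, by rw [hd]; exact hj.trans le_add_self⟩
  exact ⟨x, hx 0⟩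

variable [Λ.IsFinite]

theorem vtx_toBratteli (x : Λ.InfPath) (n : ℕ) :
    (Λ.toBratteli x).vtx n = x.obj (rainbowDeg k n) := by
  rw [← BratteliDiagram.PathSpace.r_edge]
  exact x.r_map _ _ _

theorem takeN_toBratteli_eq_iff {x y : Λ.InfPath} {n : ℕ} :
    (Λ.toBratteli x).takeN n = (Λ.toBratteli y).takeN n ↔
      x.pre (rainbowDeg k n) = y.pre (rainbowDeg k n) := by
  induction n with
  | zero =>
    have hpre : ∀ x : Λ.InfPath, x.pre (rainbowDeg k 0) = Λ.one (x.obj (rainbowDeg k 0)) := by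
      intro x
      rw [← InfPath.s_pre]
      exact eq_one_of_d_eq_zero (by rw [InfPath.d_pre, rainbowDeg_zero])
    rw [BratteliDiagram.PathSpace.takeN_zero_eq_iff, hpre, hpre, one_injective.eq_iff,
      ← vtx_toBratteli, ← vtx_toBratteli]
    exact Iff.rfl
  | succ n ih =>
    have hle : rainbowDeg k n ≤ rainbowDeg k (n + 1) := rainbowDeg_mono (Nat.le_succ n)
    rw [BratteliDiagram.PathSpace.takeN_succ_eq_iff, ih]
    constructor
    · rintro ⟨hpre, hedge⟩
      have hmap : x.map _ _ hle = y.map _ _ hle := congrArg Subtype.val hedge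
      rw [x.pre_comp hle, y.pre_comp hle, hpre, hmap]
    · intro h
      obtain ⟨hpre, hmap⟩ := InfPath.pre_eq_of_le hle h
      exact ⟨hpre, Subtype.ext hmap⟩

theorem toBratteli_injective : Function.Injective Λ.toBratteli := fun x y h =>
  InfPath.ext_of_cofinal fun m =>
    let ⟨n, hn⟩ := exists_le_rainbowDeg m
    ⟨_, hn, takeN_toBratteli_eq_iff.1 (by rw [h])⟩

theorem toBratteli_surjective : Function.Surjective Λ.toBratteli := by
  intro y
  let l : ℕ → Λ.Mor := fun j =>
    Nat.rec (Λ.one (Λ.r (y.edge 0).1)) (fun j f => Λ.comp f (y.edge j).1) j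
  have hs : ∀ j, Λ.s (l j) = Λ.r (y.edge j).1 := fun j => by
    induction j with
    | zero => exact Λ.s_one _
    | succ j ih => exact (Λ.s_comp _ _ ih).trans (y.compat j)
  have hd : ∀ j, Λ.d (l j) = rainbowDeg k j := fun j => by
    induction j with
    | zero => rw [rainbowDeg_zero]; exact Λ.d_one _
    | succ j ih => rw [rainbowDeg_succ, ← ih, ← (y.edge j).2]; exact Λ.d_comp _ _ (hs j)
  obtain ⟨x, hx⟩ := exists_infPath (l := l) (fun j => ⟨_, hs j, rfl⟩) fun n => by
    simp only [hd]
    exact exists_le_rainbowDeg n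
  simp only [hd] at hx
  refine ⟨x, BratteliDiagram.PathSpace.ext (funext fun j => Subtype.ext ?_)⟩
  have hle : rainbowDeg k j ≤ rainbowDeg k (j + 1) := rainbowDeg_mono (Nat.le_succ j)
  change x.map _ _ hle = (y.edge j).1
  have hcomp := x.pre_comp hle
  rw [hx, hx] at hcomp
  refine (comp_left_cancel (hs j) ?_ hcomp).symm
  rw [x.r_map, ← InfPath.s_pre, hx]

theorem preimage_cylinder_take (x : Λ.InfPath) (n : ℕ) :
    Λ.toBratteli ⁻¹' ((Λ.toBratteli x).take n).cylinder =
      Λ.cylinder (x.pre (rainbowDeg k n)) := by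
  ext y
  rw [Set.mem_preimage, BratteliDiagram.FinPath.mem_cylinder_iff, mem_cylinder_iff,
    InfPath.d_pre]
  exact takeN_toBratteli_eq_iff

theorem continuous_toBratteli : Continuous Λ.toBratteli := by
  refine continuous_generateFrom_iff.2 ?_
  rintro _ ⟨γ, rfl⟩
  obtain hempty | ⟨x, hx⟩ := (Λ.toBratteli ⁻¹' γ.cylinder).eq_empty_or_nonempty
  · rw [hempty]
    exact isOpen_empty
  · have hγ : γ = (Λ.toBratteli x).take γ.1 :=
      Sigma.ext rfl (heq_of_eq ((BratteliDiagram.FinPath.mem_cylinder_iff _ _).1 hx).symm)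
    rw [hγ, preimage_cylinder_take]
    exact TopologicalSpace.isOpen_generateFrom_of_mem ⟨_, rfl⟩

theorem isInducing_toBratteli : IsInducing Λ.toBratteli := by
  refine ⟨le_antisymm (continuous_iff_le_induced.1 continuous_toBratteli) (le_generateFrom ?_)⟩
  rintro _ ⟨l, rfl⟩
  obtain ⟨N, hN⟩ := exists_le_rainbowDeg (Λ.d l)
  refine isOpen_induced_iff.2 ⟨_, (BratteliDiagram.PathSpace.isClopen_takeN_preimage
    ((fun x => (Λ.toBratteli x).takeN N) '' Λ.cylinder l)).2, ?_⟩
  ext x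
  refine ⟨?_, fun hx => ⟨x, hx, rfl⟩⟩
  rintro ⟨y, hy, hxy⟩
  rw [mem_cylinder_iff] at hy ⊢
  rw [← (InfPath.pre_eq_of_le hN (takeN_toBratteli_eq_iff.1 hxy)).1, hy]

theorem isHomeomorph_toBratteli : IsHomeomorph Λ.toBratteli :=
  isHomeomorph_iff_isEmbedding_surjective.2
    ⟨⟨isInducing_toBratteli, toBratteli_injective⟩, toBratteli_surjective⟩

end Rainbow

/-! ### The weight on the path space -/

section Weight

variable [Λ.IsFinite]

theorem one_le_rhoPow (hρ : ∀ i, 1 < Λ.rho i) (m : Fin k → ℕ) : 1 ≤ Λ.rhoPow m :=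
  Finset.one_le_prod fun i _ => one_le_pow₀ (hρ i).le

theorem rhoPow_pos (hρ : ∀ i, 1 < Λ.rho i) (m : Fin k → ℕ) : 0 < Λ.rhoPow m :=
  one_pos.trans_le (one_le_rhoPow hρ m)

theorem one_lt_rhoPow_one [NeZero k] (hρ : ∀ i, 1 < Λ.rho i) : 1 < Λ.rhoPow 1 := by
  have hprod : ∏ _i : Fin k, (1 : ℝ) < ∏ i, Λ.rho i :=
    Finset.prod_lt_prod_of_nonempty (fun _ _ => one_pos) (fun i _ => hρ i) Finset.univ_nonempty
  simpa [rhoPow] using hprod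

theorem exists_pair_of_two_le (htwo : ∀ (i : Fin k) (v : Λ.Vert), 2 ≤ ∑ w, Λ.adj i v w)
    (i : Fin k) (v : Λ.Vert) :
    ∃ e e' : {l : Λ.Mor // Λ.d l = Pi.single i 1 ∧ Λ.r l = v}, e ≠ e' := by
  have hcard := sum_source_eq (Pi.single i 1) v fun _ => 1
  simp only [Finset.sum_const, Finset.card_univ, nsmul_eq_mul, mul_one, mulVec, dotProduct,
    countMatrix_single, map_apply] at hcard
  rw [← Fintype.one_lt_card_iff, ← Nat.cast_lt (α := ℝ), hcard]
  exact_mod_cast htwo i v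

variable [NeZero k]

/-- The source of a finite path of the Bratteli diagram, as a vertex of `Λ`. -/
def src {n : ℕ} (g : Λ.bratteli.PathN n) : Λ.Vert := g.1

theorem sum_src_snoc {n : ℕ} (g : Λ.bratteli.PathN n) (F : Λ.Vert → ℝ) :
    ∑ e, F (src (g.snoc e)) = (Λ.countMatrix (Pi.single (color k n) 1) *ᵥ F) (src g) := by
  rw [← sum_source_eq]
  let φ : {e : Λ.bratteli.E n // Λ.bratteli.r e = g.1} ≃
      {l : Λ.Mor // Λ.d l = Pi.single (color k n) 1 ∧ Λ.r l = src g} :=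
    { toFun := fun e => ⟨e.1.1, e.1.2, e.2⟩
      invFun := fun l => ⟨⟨l.1, l.2.1⟩, l.2.2⟩ }
  exact Fintype.sum_equiv φ _ _ fun _ => rfl

theorem rainbowDeg_sub_succ (N q : ℕ) :
    rainbowDeg k (N + (q + 1)) - rainbowDeg k N =
      rainbowDeg k (N + q) - rainbowDeg k N + Pi.single (color k (N + q)) 1 := by
  rw [← add_assoc, rainbowDeg_succ, tsub_add_eq_add_tsub (rainbowDeg_mono (Nat.le_add_right N q))]

theorem sum_trunc_mul_src {N : ℕ} (φ : Λ.bratteli.PathN N → ℝ) (q : ℕ) (F : Λ.Vert → ℝ) :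
    ∑ g : Λ.bratteli.PathN (N + q), φ (g.trunc q) * F (src g) =
      ∑ g, φ g * (Λ.countMatrix (rainbowDeg k (N + q) - rainbowDeg k N) *ᵥ F) (src g) := by
  induction q generalizing F with
  | zero =>
    simp only [add_zero, tsub_self, countMatrix_zero, one_mulVec]
    rfl
  | succ q ih =>
    rw [rainbowDeg_sub_succ, countMatrix_add, ← mulVec_mulVec, ← ih]
    refine (BratteliDiagram.sum_pathN_succ _).trans (Finset.sum_congr rfl fun g _ => ?_)
    rw [← sum_src_snoc, Finset.mul_sum]
    rfl

theorem IsPerronFrobenius.sum_src_snoc {x : Λ.Vert → ℝ} (hx : Λ.IsPerronFrobenius x) {n : ℕ}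
    (g : Λ.bratteli.PathN n) : ∑ e, x (src (g.snoc e)) = Λ.rho (color k n) * x (src g) := by
  rw [KGraph.sum_src_snoc, hx.countMatrix_mulVec, rhoPow_single, Pi.smul_apply, smul_eq_mul]

theorem exists_edge_pair (htwo : ∀ (i : Fin k) (v : Λ.Vert), 2 ≤ ∑ w, Λ.adj i v w) (n : ℕ)
    (v : Λ.bratteli.V n) :
    ∃ e e' : Λ.bratteli.E n, e ≠ e' ∧ Λ.bratteli.r e = v ∧ Λ.bratteli.r e' = v := by
  obtain ⟨e, e', hne⟩ := exists_pair_of_two_le htwo (color k n) v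
  exact ⟨⟨e.1, e.2.1⟩, ⟨e'.1, e'.2.1⟩, fun h => hne (Subtype.ext (Subtype.mk.inj h)),
    e.2.2, e'.2.2⟩

variable (hpf : Λ.IsPerronFrobenius Λ.pf)

include hpf

theorem weight_pos (hρ : ∀ i, 1 < Λ.rho i) (δ : ℝ) (γ : Λ.bratteli.FinPath) :
    0 < Λ.weight δ γ :=
  mul_pos (Real.rpow_pos_of_pos (rhoPow_pos hρ _) _) (hpf.pos _)

theorem weight_le_one (hρ : ∀ i, 1 < Λ.rho i) {δ : ℝ} (hδ : 0 < δ) (γ : Λ.bratteli.FinPath) :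
    Λ.weight δ γ ≤ 1 :=
  mul_le_one₀ (Real.rpow_le_one_of_one_le_of_nonpos (one_le_rhoPow hρ _)
    (neg_nonpos.2 (one_div_pos.2 hδ).le)) (hpf.pos _).le (hpf.le_one _)

theorem weight_snoc_le (hρ : ∀ i, 1 < Λ.rho i) {δ : ℝ} (hδ : 0 < δ) (hδ1 : δ ≤ 1) (n : ℕ)
    (g : Λ.bratteli.PathN n) (e : {e : Λ.bratteli.E n // Λ.bratteli.r e = g.1}) :
    Λ.weight δ ⟨n + 1, g.snoc e⟩ ≤ Λ.weight δ ⟨n, g⟩ := by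
  set i := color k n
  have hρi : 0 < Λ.rho i := one_pos.trans (hρ i)
  have hpf_le : Λ.pf (src (g.snoc e)) ≤ Λ.rho i * Λ.pf (src g) := by
    rw [← hpf.sum_src_snoc]
    exact Finset.single_le_sum (f := fun e => Λ.pf (src (g.snoc e)))
      (fun _ _ => (hpf.pos _).le) (Finset.mem_univ e)
  have hρ_le : Λ.rho i ^ (-(1 / δ)) ≤ (Λ.rho i)⁻¹ := by
    rw [← Real.rpow_neg_one]
    exact Real.rpow_le_rpow_of_exponent_le (hρ i).le
      (neg_le_neg ((one_le_div₀ hδ).2 hδ1))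
  change Λ.rhoPow (rainbowDeg k (n + 1)) ^ (-(1 / δ)) * Λ.pf (src (g.snoc e)) ≤
    Λ.rhoPow (rainbowDeg k n) ^ (-(1 / δ)) * Λ.pf (src g)
  rw [rainbowDeg_succ, rhoPow_add, rhoPow_single,
    Real.mul_rpow (rhoPow_pos hρ _).le hρi.le, mul_assoc]
  refine mul_le_mul_of_nonneg_left ?_ (Real.rpow_nonneg (rhoPow_pos hρ _).le _)
  calc Λ.rho i ^ (-(1 / δ)) * Λ.pf (src (g.snoc e))
      ≤ (Λ.rho i)⁻¹ * (Λ.rho i * Λ.pf (src g)) :=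
        mul_le_mul hρ_le hpf_le (hpf.pos _).le (inv_nonneg.2 hρi.le)
    _ = Λ.pf (src g) := inv_mul_cancel_left₀ hρi.ne' _

theorem nonempty_vertices (n : ℕ) : Nonempty (Λ.bratteli.V n) := hpf.nonempty

theorem cylDiam_weight (htwo : ∀ (i : Fin k) (v : Λ.Vert), 2 ≤ ∑ w, Λ.adj i v w) {δ : ℝ}
    (hδ : 0 < δ) (hδ1 : δ ≤ 1) (γ : Λ.bratteli.FinPath) :
    BratteliDiagram.cylDiam (Λ.weight δ) γ = Λ.weight δ γ :=
  have hρ := hpf.one_lt_rho htwo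
  have := nonempty_vertices hpf
  BratteliDiagram.cylDiam_eq (exists_edge_pair htwo) (fun γ => (weight_pos hpf hρ δ γ).le)
    (weight_snoc_le hpf hρ hδ hδ1) γ

theorem nonempty_choiceFunction (htwo : ∀ (i : Fin k) (v : Λ.Vert), 2 ≤ ∑ w, Λ.adj i v w)
    {δ : ℝ} (hδ : 0 < δ) (hδ1 : δ ≤ 1) :
    Nonempty (BratteliDiagram.ChoiceFunction (Λ.weight δ)) :=
  have hρ := hpf.one_lt_rho htwo
  have := nonempty_vertices hpf
  BratteliDiagram.nonempty_choiceFunction (exists_edge_pair htwo)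
    (fun γ => (weight_pos hpf hρ δ γ).le) (weight_snoc_le hpf hρ hδ hδ1)

theorem weight_rpow (hρ : ∀ i, 1 < Λ.rho i) {δ : ℝ} (hδ : δ ≠ 0) (s : ℝ) {n : ℕ}
    (g : Λ.bratteli.PathN n) :
    Λ.weight δ ⟨n, g⟩ ^ (δ * s) = Λ.rhoPow (rainbowDeg k n) ^ (-s) * Λ.pf (src g) ^ (δ * s) := by
  change (Λ.rhoPow (rainbowDeg k n) ^ (-(1 / δ)) * Λ.pf (src g)) ^ (δ * s) = _
  rw [Real.mul_rpow (Real.rpow_nonneg (rhoPow_pos hρ _).le _) (hpf.pos _).le,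
    ← Real.rpow_mul (rhoPow_pos hρ _).le]
  congr 2
  field_simp

end Weight

/-! ### The an Huef–Laca–Raeburn–Sims measure -/

section Measure

theorem measurableSet_cylinder (l : Λ.Mor) : MeasurableSet (Λ.cylinder l) :=
  (TopologicalSpace.isOpen_generateFrom_of_mem ⟨l, rfl⟩ : IsOpen (Λ.cylinder l)).measurableSet

theorem cylinder_eq_iUnion_comp (l : Λ.Mor) (m : Fin k → ℕ) :
    Λ.cylinder l =
      ⋃ b : {b : Λ.Mor // Λ.d b = m ∧ Λ.r b = Λ.s l}, Λ.cylinder (Λ.comp l b.1) := by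
  have hle : Λ.d l ≤ Λ.d l + m := le_self_add
  ext x
  rw [Set.mem_iUnion, mem_cylinder_iff]
  constructor
  · intro hx
    have hcomp := x.pre_comp hle
    rw [hx] at hcomp
    refine ⟨⟨x.map _ _ hle, by rw [x.d_map, add_tsub_cancel_left],
      by rw [x.r_map, ← InfPath.s_pre, hx]⟩, ?_⟩
    rw [mem_cylinder_iff, ← hcomp, InfPath.d_pre]
  · rintro ⟨⟨b, hbd, hbr⟩, hx⟩
    change x.pre (Λ.d (Λ.comp l b)) = Λ.comp l b at hx
    rw [Λ.d_comp _ _ hbr.symm, hbd, x.pre_comp hle] at hx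
    exact (comp_inj (by rw [InfPath.s_pre, x.r_map]) hbr.symm (by rw [InfPath.d_pre]) hx).1

theorem pairwise_disjoint_cylinder_comp (l : Λ.Mor) (m : Fin k → ℕ) :
    Pairwise (Function.onFun Disjoint
      fun b : {b : Λ.Mor // Λ.d b = m ∧ Λ.r b = Λ.s l} => Λ.cylinder (Λ.comp l b.1)) := by
  rintro ⟨b, hbd, hbr⟩ ⟨b', hbd', hbr'⟩ hne
  refine Set.disjoint_left.2 fun x hx hx' => hne (Subtype.ext ?_)
  change x.pre (Λ.d (Λ.comp l b)) = Λ.comp l b at hx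
  change x.pre (Λ.d (Λ.comp l b')) = Λ.comp l b' at hx'
  rw [Λ.d_comp _ _ hbr.symm, hbd] at hx
  rw [Λ.d_comp _ _ hbr'.symm, hbd'] at hx'
  exact comp_left_cancel hbr.symm hbr'.symm (hx.symm.trans hx')

variable [Λ.IsFinite]

theorem measure_cylinder_eq_sum (M : Measure Λ.InfPath) (l : Λ.Mor) (m : Fin k → ℕ) :
    M (Λ.cylinder l) =
      ∑ b : {b : Λ.Mor // Λ.d b = m ∧ Λ.r b = Λ.s l}, M (Λ.cylinder (Λ.comp l b.1)) := by
  rw [cylinder_eq_iUnion_comp l m, measure_iUnion (pairwise_disjoint_cylinder_comp l m)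
    fun b => measurableSet_cylinder _, tsum_fintype]

theorem inv_rhoPow_mul_pf_nonneg (hpf : Λ.IsPerronFrobenius Λ.pf) (hρ : ∀ i, 1 < Λ.rho i)
    (m : Fin k → ℕ) (v : Λ.Vert) : 0 ≤ (Λ.rhoPow m)⁻¹ * Λ.pf v :=
  mul_nonneg (inv_nonneg.2 (rhoPow_pos hρ m).le) (hpf.pos v).le

theorem isAHLRSMeasure_of_cofinal (hpf : Λ.IsPerronFrobenius Λ.pf) (hρ : ∀ i, 1 < Λ.rho i)
    {M : Measure Λ.InfPath} {D : Set (Fin k → ℕ)} (hD : ∀ m, ∃ n ∈ D, m ≤ n)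
    (hM : ∀ l, Λ.d l ∈ D →
      M (Λ.cylinder l) = ENNReal.ofReal ((Λ.rhoPow (Λ.d l))⁻¹ * Λ.pf (Λ.s l))) :
    Λ.IsAHLRSMeasure M := by
  intro l
  obtain ⟨n, hn, hle⟩ := hD (Λ.d l)
  obtain ⟨m, rfl⟩ := exists_add_of_le hle
  have hcomp : ∀ b : {b : Λ.Mor // Λ.d b = m ∧ Λ.r b = Λ.s l}, M (Λ.cylinder (Λ.comp l b.1)) =
      ENNReal.ofReal ((Λ.rhoPow (Λ.d l + m))⁻¹ * Λ.pf (Λ.s b.1)) := fun ⟨b, hbd, hbr⟩ => by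
    have hd : Λ.d (Λ.comp l b) = Λ.d l + m := by rw [Λ.d_comp _ _ hbr.symm, hbd]
    rw [hM _ (by rwa [hd]), hd, Λ.s_comp _ _ hbr.symm]
  rw [measure_cylinder_eq_sum M l m, Finset.sum_congr rfl fun b _ => hcomp b,
    ← ENNReal.ofReal_sum_of_nonneg fun b _ => inv_rhoPow_mul_pf_nonneg hpf hρ _ _,
    ← Finset.mul_sum, sum_source_eq, hpf.countMatrix_mulVec, rhoPow_add, mul_inv, Pi.smul_apply,
    smul_eq_mul, mul_assoc, inv_mul_cancel_left₀ (rhoPow_pos hρ m).ne']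

variable [NeZero k]

/-- The value `ρ(Λ)^{-d(γ)} x^Λ_{s(γ)}` of the an Huef–Laca–Raeburn–Sims measure on the cylinder
set of a path `γ` of the Bratteli diagram. -/
noncomputable def pathMass (γ : Λ.bratteli.FinPath) : ℝ :=
  (Λ.rhoPow (rainbowDeg k γ.1))⁻¹ * Λ.pf (src γ.2)

theorem pathMass_nonneg (hpf : Λ.IsPerronFrobenius Λ.pf) (hρ : ∀ i, 1 < Λ.rho i)
    (γ : Λ.bratteli.FinPath) : 0 ≤ pathMass γ :=
  inv_rhoPow_mul_pf_nonneg hpf hρ _ _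

theorem sum_pathMass_snoc (hpf : Λ.IsPerronFrobenius Λ.pf) (hρ : ∀ i, 1 < Λ.rho i) {n : ℕ}
    (g : Λ.bratteli.PathN n) : ∑ e, pathMass ⟨n + 1, g.snoc e⟩ = pathMass ⟨n, g⟩ := by
  simp only [pathMass]
  rw [← Finset.mul_sum, hpf.sum_src_snoc, rainbowDeg_succ, rhoPow_add, rhoPow_single, mul_inv,
    mul_assoc, inv_mul_cancel_left₀ (one_pos.trans (hρ _)).ne']

theorem pathMass_take (x : Λ.InfPath) (n : ℕ) : pathMass ((Λ.toBratteli x).take n) =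
    (Λ.rhoPow (rainbowDeg k n))⁻¹ * Λ.pf (Λ.s (x.pre (rainbowDeg k n))) := by
  rw [InfPath.s_pre, ← vtx_toBratteli]
  rfl

theorem map_toBratteli_cylinder_take (M : Measure Λ.InfPath) (x : Λ.InfPath) (n : ℕ) :
    M.map Λ.toBratteli ((Λ.toBratteli x).take n).cylinder =
      M (Λ.cylinder (x.pre (rainbowDeg k n))) := by
  rw [Measure.map_apply continuous_toBratteli.measurable
    (BratteliDiagram.FinPath.isClopen_cylinder _).2.measurableSet, preimage_cylinder_take]

variable (hpf : Λ.IsPerronFrobenius Λ.pf)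
  (htwo : ∀ (i : Fin k) (v : Λ.Vert), 2 ≤ ∑ w, Λ.adj i v w)

include hpf htwo

theorem bratteli_cylinder_nonempty (γ : Λ.bratteli.FinPath) : γ.cylinder.Nonempty :=
  have := nonempty_vertices hpf
  BratteliDiagram.FinPath.cylinder_nonempty (fun n v =>
    let ⟨e, _, _, he, _⟩ := exists_edge_pair htwo n v
    ⟨e, he⟩) γ

theorem isAHLRSMeasure_iff (M : Measure Λ.InfPath) :
    Λ.IsAHLRSMeasure M ↔ ∀ γ : Λ.bratteli.FinPath,
      M.map Λ.toBratteli γ.cylinder = ENNReal.ofReal (pathMass γ) := by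
  constructor
  · rintro hM ⟨n, g⟩
    obtain ⟨y, hy⟩ := bratteli_cylinder_nonempty hpf htwo ⟨n, g⟩
    obtain ⟨x, rfl⟩ := toBratteli_surjective y
    obtain rfl : (Λ.toBratteli x).takeN n = g :=
      (BratteliDiagram.FinPath.mem_cylinder_iff _ _).1 hy
    refine (map_toBratteli_cylinder_take M x n).trans ?_
    rw [hM, InfPath.d_pre, ← pathMass_take]
    rfl
  · intro hM
    refine isAHLRSMeasure_of_cofinal hpf (hpf.one_lt_rho htwo) (D := Set.range (rainbowDeg k))
      (fun m => let ⟨n, hn⟩ := exists_le_rainbowDeg m; ⟨_, ⟨n, rfl⟩, hn⟩) ?_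
    rintro l ⟨n, hn⟩
    obtain ⟨x, hx⟩ := cylinder_nonempty (fun i v =>
      let ⟨e, _⟩ := exists_pair_of_two_le htwo i v
      ⟨e.1, e.2⟩) l
    rw [mem_cylinder_iff, ← hn] at hx
    rw [← hn, ← hx, ← map_toBratteli_cylinder_take, hM, pathMass_take]

theorem exists_probabilityMeasure_pathMass :
    ∃ μ : Measure Λ.bratteli.PathSpace, IsProbabilityMeasure μ ∧
      ∀ γ : Λ.bratteli.FinPath, μ γ.cylinder = ENNReal.ofReal (pathMass γ) := by
  have hρ := hpf.one_lt_rho htwo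
  refine BratteliDiagram.exists_probabilityMeasure (bratteli_cylinder_nonempty hpf htwo) ?_
    fun n g => ?_
  · rw [← ENNReal.ofReal_sum_of_nonneg fun g _ => pathMass_nonneg hpf hρ _,
      ← ENNReal.ofReal_one, ← hpf.sum_eq_one]
    simp only [pathMass, rainbowDeg_zero, rhoPow_zero, inv_one, one_mul]
    let φ : Λ.bratteli.PathN 0 ≃ Λ.Vert := BratteliDiagram.pathZeroEquiv
    exact congrArg _ (Fintype.sum_equiv φ _ _ fun g => rfl)
  · rw [← ENNReal.ofReal_sum_of_nonneg fun e _ => pathMass_nonneg hpf hρ _,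
      sum_pathMass_snoc hpf hρ]

theorem exists_isAHLRSMeasure : ∃ M : Measure Λ.InfPath, IsProbabilityMeasure M ∧
    Λ.IsAHLRSMeasure M ∧ ∀ M', Λ.IsAHLRSMeasure M' → M' = M := by
  obtain ⟨μ, hμ, hμγ⟩ := exists_probabilityMeasure_pathMass hpf htwo
  let e : Λ.InfPath ≃ᵐ Λ.bratteli.PathSpace :=
    isHomeomorph_toBratteli.homeomorph.toMeasurableEquiv
  have hmap : (μ.map e.symm).map Λ.toBratteli = μ := e.map_map_symm
  refine ⟨μ.map e.symm, Measure.isProbabilityMeasure_map e.symm.measurable.aemeasurable,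
    (isAHLRSMeasure_iff hpf htwo _).2 fun γ => by rw [hmap, hμγ], fun M' hM' => ?_⟩
  have hM'map : μ = M'.map e := BratteliDiagram.measure_ext_cylinder fun γ =>
    (hμγ γ).trans ((isAHLRSMeasure_iff hpf htwo M').1 hM' γ).symm
  rw [hM'map, e.map_symm_map]

end Measure

/-! ### Dixmier traces -/

section Extension

theorem rainbowDeg_add_mul [NeZero k] (n p : ℕ) :
    rainbowDeg k (n + p * k) = rainbowDeg k n + p • 1 := by
  induction p with
  | zero => simp
  | succ p ih => rw [add_one_mul, ← add_assoc, rainbowDeg_add_period, ih, add_assoc, succ_nsmul]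

variable [Λ.IsFinite]

theorem rhoPow_nsmul (p : ℕ) (m : Fin k → ℕ) : Λ.rhoPow (p • m) = Λ.rhoPow m ^ p := by
  induction p with
  | zero => simp [rhoPow_zero]
  | succ p ih => rw [succ_nsmul, rhoPow_add, ih, pow_succ]

theorem countMatrix_nsmul (p : ℕ) (m : Fin k → ℕ) :
    Λ.countMatrix (p • m) = Λ.countMatrix m ^ p := by
  induction p with
  | zero => simp [countMatrix_zero]
  | succ p ih => rw [succ_nsmul, countMatrix_add, ih, pow_succ]

variable [NeZero k] {N : ℕ}

theorem rhoPow_rainbowDeg_add_period (q : ℕ) :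
    Λ.rhoPow (rainbowDeg k (N + (q + k))) =
      Λ.rhoPow 1 * Λ.rhoPow (rainbowDeg k (N + q)) := by
  rw [← add_assoc, rainbowDeg_add_period, rhoPow_add, mul_comm]

/-- The sum of `ρ(Λ)^{-d(γη)} φ(γ) F(s(η))` over the paths `γη` of length `N + q` of the Bratteli
diagram, where `γ` has length `N`. The weights of the extensions of a path are sums of this kind,
multiplied by small powers of `ρ(Λ)^{d(γη)}`. -/
noncomputable def extensionSum (φ : Λ.bratteli.PathN N → ℝ) (F : Λ.Vert → ℝ) (q : ℕ) : ℝ :=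
  (Λ.rhoPow (rainbowDeg k (N + q)))⁻¹ * ∑ g : Λ.bratteli.PathN (N + q), φ (g.trunc q) * F (src g)

/-- The total weight `∑ φ(γ)` of the paths `γ` with a given source. -/
noncomputable def sourceWeight (φ : Λ.bratteli.PathN N → ℝ) (v : Λ.Vert) : ℝ :=
  open Classical in ∑ g, if src g = v then φ g else 0

theorem sourceWeight_dotProduct (φ : Λ.bratteli.PathN N → ℝ) (F : Λ.Vert → ℝ) :
    sourceWeight φ ⬝ᵥ F = ∑ g, φ g * F (src g) := by
  simp only [dotProduct, sourceWeight, Finset.sum_mul, ite_mul, zero_mul]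
  rw [Finset.sum_comm]
  simp

theorem extensionSum_eq (φ : Λ.bratteli.PathN N → ℝ) (F : Λ.Vert → ℝ) (q : ℕ) :
    extensionSum φ F q = (Λ.rhoPow (rainbowDeg k (N + q)))⁻¹ *
      sourceWeight φ ⬝ᵥ (Λ.countMatrix (rainbowDeg k (N + q) - rainbowDeg k N) *ᵥ F) := by
  rw [extensionSum, sum_trunc_mul_src, sourceWeight_dotProduct]

theorem extensionSum_mul_add (φ : Λ.bratteli.PathN N → ℝ) (F : Λ.Vert → ℝ) (p t : ℕ) :
    extensionSum φ F (p * k + t) = (Λ.rhoPow 1 ^ p)⁻¹ *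
      ((Λ.rhoPow (rainbowDeg k (N + t)))⁻¹ •
        sourceWeight φ ᵥ* Λ.countMatrix (rainbowDeg k (N + t) - rainbowDeg k N)) ⬝ᵥ
      (Λ.countMatrix 1 ^ p *ᵥ F) := by
  rw [extensionSum_eq, add_comm (p * k), ← add_assoc, rainbowDeg_add_mul,
    ← tsub_add_eq_add_tsub (rainbowDeg_mono (Nat.le_add_right N t)), countMatrix_add,
    countMatrix_nsmul, rhoPow_add, rhoPow_nsmul, _root_.mul_inv_rev, smul_dotProduct, smul_eq_mul,
    ← dotProduct_mulVec, mulVec_mulVec, mul_assoc]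

variable (hpf : Λ.IsPerronFrobenius Λ.pf) (hρ : ∀ i, 1 < Λ.rho i)

include hpf hρ

theorem extensionSum_pf (φ : Λ.bratteli.PathN N → ℝ) (q : ℕ) :
    extensionSum φ Λ.pf q = ∑ g, φ g * pathMass ⟨N, g⟩ := by
  rw [← BratteliDiagram.sum_trunc_mul (fun _ => sum_pathMass_snoc hpf hρ) φ q, extensionSum,
    Finset.mul_sum]
  exact Finset.sum_congr rfl fun g _ => mul_left_comm _ _ _

theorem exists_abs_extensionSum_le (φ : Λ.bratteli.PathN N → ℝ) (F : Λ.Vert → ℝ) :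
    ∃ K, ∀ q, |extensionSum φ F q| ≤ K := by
  obtain ⟨c, hc⟩ := Finite.exists_le fun v => |F v| / Λ.pf v
  have hF (v : Λ.Vert) : |F v| ≤ c * Λ.pf v := (div_le_iff₀ (hpf.pos v)).1 (hc v)
  refine ⟨c * ∑ g, |φ g| * pathMass ⟨N, g⟩, fun q => ?_⟩
  rw [← extensionSum_pf hpf hρ (fun g => |φ g|) q, extensionSum, extensionSum, abs_mul, abs_inv,
    abs_of_pos (rhoPow_pos hρ _), mul_left_comm]
  refine mul_le_mul_of_nonneg_left ?_ (inv_nonneg.2 (rhoPow_pos hρ _).le)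
  calc |∑ g : Λ.bratteli.PathN (N + q), φ (g.trunc q) * F (src g)|
      ≤ ∑ g : Λ.bratteli.PathN (N + q), |φ (g.trunc q)| * (c * Λ.pf (src g)) := by
        refine (Finset.abs_sum_le_sum_abs _ _).trans (Finset.sum_le_sum fun g _ => ?_)
        rw [abs_mul]
        exact mul_le_mul_of_nonneg_left (hF _) (abs_nonneg _)
    _ = c * ∑ g : Λ.bratteli.PathN (N + q), |φ (g.trunc q)| * Λ.pf (src g) := by
        rw [Finset.mul_sum]
        exact Finset.sum_congr rfl fun g _ => mul_left_comm _ _ _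

theorem summable_rpow_mul_extensionSum (φ : Λ.bratteli.PathN N → ℝ) (F : Λ.Vert → ℝ) {ε : ℝ}
    (hε : 0 < ε) :
    Summable fun q => Λ.rhoPow (rainbowDeg k (N + q)) ^ (-ε) * extensionSum φ F q :=
  have ⟨_, hK⟩ := exists_abs_extensionSum_le hpf hρ φ F
  (hasSum_rpow_neg_mul (a := fun q => Λ.rhoPow (rainbowDeg k (N + q))) (one_lt_rhoPow_one hρ)
    (fun _ => rhoPow_pos hρ _) rhoPow_rainbowDeg_add_period hK hε).summable

theorem tendsto_mul_tsum_rpow_mul_extensionSum (hirr : (Λ.countMatrix 1).IsIrreducible)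
    {l : Λ.Vert → ℝ} (hlA : l ᵥ* Λ.countMatrix 1 = Λ.rhoPow 1 • l) (hl : l ⬝ᵥ Λ.pf = 1)
    (φ : Λ.bratteli.PathN N → ℝ) (F : Λ.Vert → ℝ) :
    Tendsto (fun ε : ℝ => ε * ∑' q, Λ.rhoPow (rainbowDeg k (N + q)) ^ (-ε) * extensionSum φ F q)
      (𝓝[>] 0) (𝓝 ((Real.log (Λ.rhoPow 1))⁻¹ * k * (l ⬝ᵥ F) * ∑ g, φ g * pathMass ⟨N, g⟩)) := by
  have := hpf.nonempty
  obtain ⟨K, hK⟩ := exists_abs_extensionSum_le hpf hρ φ F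
  have habel (t : Fin k) : Tendsto (abelMean fun p => extensionSum φ F (p * k + t)) (𝓝[<] 1)
      (𝓝 ((l ⬝ᵥ F) * ∑ g, φ g * pathMass ⟨N, g⟩)) := by
    rw [← extensionSum_pf hpf hρ φ t, extensionSum_eq, dotProduct_mulVec, ← smul_eq_mul (_⁻¹),
      ← smul_dotProduct]
    simp only [extensionSum_mul_add]
    exact tendsto_abelMean_pow_mulVec hirr (rhoPow_pos hρ 1) hpf.pos (hpf.countMatrix_mulVec 1)
      hlA hl _ F
  have hlim := tendsto_mul_tsum_rpow_neg_mul (a := fun q => Λ.rhoPow (rainbowDeg k (N + q)))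
    (one_lt_rhoPow_one hρ) (fun _ => rhoPow_pos hρ _) rhoPow_rainbowDeg_add_period hK habel
  rw [Finset.sum_const, Finset.card_univ, Fintype.card_fin, nsmul_eq_mul, ← mul_assoc,
    ← mul_assoc] at hlim
  exact hlim

theorem sum_trunc_mul_weight_rpow (φ : Λ.bratteli.PathN N → ℝ) {δ : ℝ} (hδ : δ ≠ 0) (s : ℝ)
    (q : ℕ) :
    ∑ g : Λ.bratteli.PathN (N + q), φ (g.trunc q) * Λ.weight δ ⟨N + q, g⟩ ^ (δ * s) =
      ∑ v, Λ.pf v ^ (δ * s) *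
        (Λ.rhoPow (rainbowDeg k (N + q)) ^ (-(s - 1)) * extensionSum φ (Pi.single v 1) q) := by
  classical
  have hs : Λ.rhoPow (rainbowDeg k (N + q)) ^ (-s) =
      Λ.rhoPow (rainbowDeg k (N + q)) ^ (-(s - 1)) * (Λ.rhoPow (rainbowDeg k (N + q)))⁻¹ := by
    rw [← Real.rpow_neg_one, ← Real.rpow_add (rhoPow_pos hρ _)]
    ring_nf
  simp only [weight_rpow hpf hρ hδ, extensionSum, Finset.mul_sum]
  rw [Finset.sum_comm]
  refine Finset.sum_congr rfl fun g _ => ?_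
  rw [Finset.sum_eq_single (src g) (fun v _ hv => by simp [hv.symm]) (by simp),
    Pi.single_eq_same, hs]
  ring

theorem summable_sum_trunc_mul_weight_rpow (φ : Λ.bratteli.PathN N → ℝ) {δ : ℝ} (hδ : δ ≠ 0)
    {s : ℝ} (hs : 1 < s) : Summable fun q =>
      ∑ g : Λ.bratteli.PathN (N + q), φ (g.trunc q) * Λ.weight δ ⟨N + q, g⟩ ^ (δ * s) := by
  classical
  simp only [sum_trunc_mul_weight_rpow hpf hρ φ hδ s]
  exact summable_sum fun v _ =>
    (summable_rpow_mul_extensionSum hpf hρ φ _ (sub_pos.2 hs)).mul_left _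

theorem tendsto_tsum_sum_trunc_mul_weight_rpow (hirr : (Λ.countMatrix 1).IsIrreducible)
    {l : Λ.Vert → ℝ} (hlA : l ᵥ* Λ.countMatrix 1 = Λ.rhoPow 1 • l) (hl : l ⬝ᵥ Λ.pf = 1)
    (φ : Λ.bratteli.PathN N → ℝ) {δ : ℝ} (hδ : δ ≠ 0) :
    Tendsto (fun s : ℝ => (s - 1) * ∑' q,
        ∑ g : Λ.bratteli.PathN (N + q), φ (g.trunc q) * Λ.weight δ ⟨N + q, g⟩ ^ (δ * s)) (𝓝[>] 1)
      (𝓝 ((Real.log (Λ.rhoPow 1))⁻¹ * k * (∑ v, Λ.pf v ^ δ * l v) *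
        ∑ g, φ g * pathMass ⟨N, g⟩)) := by
  classical
  have hsub : Tendsto (fun s : ℝ => s - 1) (𝓝[>] 1) (𝓝[>] 0) := by
    refine tendsto_nhdsWithin_iff.2 ⟨tendsto_nhdsWithin_of_tendsto_nhds ?_, ?_⟩
    · exact Continuous.tendsto' (by fun_prop) _ _ (sub_self 1)
    · filter_upwards [self_mem_nhdsWithin] with s (hs : 1 < s) using sub_pos.2 hs
  have hpow (v : Λ.Vert) :
      Tendsto (fun s : ℝ => Λ.pf v ^ (δ * s)) (𝓝[>] 1) (𝓝 (Λ.pf v ^ δ)) := by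
    have hcont : Continuous fun s : ℝ => Λ.pf v ^ (δ * s) :=
      continuous_const.rpow (by fun_prop) fun _ => Or.inl (hpf.pos v).ne'
    exact tendsto_nhdsWithin_of_tendsto_nhds (hcont.tendsto' _ _ (by rw [mul_one]))
  have hlim := tendsto_finsetSum Finset.univ fun v _ => (hpow v).mul
    ((tendsto_mul_tsum_rpow_mul_extensionSum hpf hρ hirr hlA hl φ (Pi.single v 1)).comp hsub)
  convert hlim.congr' ?_ using 2
  · generalize ∑ g, φ g * pathMass ⟨N, g⟩ = S
    rw [Finset.mul_sum, Finset.sum_mul]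
    refine Finset.sum_congr rfl fun v _ => ?_
    rw [dotProduct_single_one]
    ring
  · filter_upwards [self_mem_nhdsWithin] with s (hs : 1 < s)
    simp only [sum_trunc_mul_weight_rpow hpf hρ φ hδ s]
    rw [Summable.tsum_finsetSum fun v _ =>
      (summable_rpow_mul_extensionSum hpf hρ φ _ (sub_pos.2 hs)).mul_left _, Finset.mul_sum]
    refine Finset.sum_congr rfl fun v _ => ?_
    rw [tsum_mul_left, Function.comp_apply, mul_left_comm]

end Extension

section DixmierTrace

variable [NeZero k] [Λ.IsFinite] (hpf : Λ.IsPerronFrobenius Λ.pf)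
  (htwo : ∀ (i : Fin k) (v : Λ.Vert), 2 ≤ ∑ w, Λ.adj i v w)

include hpf htwo

theorem tendsto_mul_tsum_levelTrace (hirr : (Λ.countMatrix 1).IsIrreducible) {l : Λ.Vert → ℝ}
    (hlA : l ᵥ* Λ.countMatrix 1 = Λ.rhoPow 1 • l) (hl : l ⬝ᵥ Λ.pf = 1) {δ : ℝ} (hδ : 0 < δ)
    (τ : BratteliDiagram.ChoiceFunction (Λ.weight δ)) {N : ℕ} (S : Set (Λ.bratteli.PathN N)) :
    Tendsto (fun s : ℝ => ENNReal.ofReal (s - 1) *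
        ∑' n, τ.levelTrace {x | x.takeN N ∈ S} (δ * s) n) (𝓝[>] 1)
      (𝓝 (ENNReal.ofReal (2 * ((Real.log (Λ.rhoPow 1))⁻¹ * k * (∑ v, Λ.pf v ^ δ * l v) *
        ∑ g, S.indicator 1 g * pathMass ⟨N, g⟩)))) := by
  have hρ := hpf.one_lt_rho htwo
  have hw (γ : Λ.bratteli.FinPath) : 0 ≤ Λ.weight δ γ := (weight_pos hpf hρ δ γ).le
  have htail := (tendsto_tsum_sum_trunc_mul_weight_rpow hpf hρ hirr hlA hl (S.indicator 1)
    hδ.ne').const_mul 2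
  simp only [mul_left_comm (2 : ℝ) (_ - 1), ← tsum_mul_left (a := (2 : ℝ))] at htail
  refine tendsto_mul_tsum_of_tail (N := N)
    (K := fun n => ∑ _g : Λ.bratteli.PathN n, ∑ _j : Fin 2, 1)
    (fun n _ => by simp [ENNReal.mul_eq_top]) (fun s n hs _ => ?_) (fun s q _ => ?_)
    (fun s hs => ?_) (fun s q _ => τ.levelTrace_takeN hw S (δ * s) q) htail
  · exact τ.levelTrace_le hw (weight_le_one hpf hρ hδ) _ (mul_nonneg hδ.le (one_pos.trans hs).le) n
  · exact mul_nonneg zero_le_two (Finset.sum_nonneg fun g _ => mul_nonneg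
      (Set.indicator_nonneg (fun _ _ => zero_le_one) _) (Real.rpow_nonneg (hw _) _))
  · exact (summable_sum_trunc_mul_weight_rpow hpf hρ _ hδ.ne' hs).mul_left 2

theorem hasDixmierTrace_takeN (hirr : (Λ.countMatrix 1).IsIrreducible) {l : Λ.Vert → ℝ}
    (hlA : l ᵥ* Λ.countMatrix 1 = Λ.rhoPow 1 • l) (hl : l ⬝ᵥ Λ.pf = 1) {δ : ℝ} (hδ : 0 < δ)
    (hδ1 : δ ≤ 1) (τ : BratteliDiagram.ChoiceFunction (Λ.weight δ)) {N : ℕ}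
    (S : Set (Λ.bratteli.PathN N)) :
    HasDixmierTrace (τ.rep (BratteliDiagram.chi {x | x.takeN N ∈ S}) *
        BratteliDiagram.absDiracPow (Λ.weight δ) δ)
      (ENNReal.ofReal (2 * ((Real.log (Λ.rhoPow 1))⁻¹ * k * (∑ v, Λ.pf v ^ δ * l v) *
        ∑ g, S.indicator 1 g * pathMass ⟨N, g⟩))) := by
  have hρ := hpf.one_lt_rho htwo
  have hw0 (γ : Λ.bratteli.FinPath) : 0 ≤ Λ.weight δ γ := (weight_pos hpf hρ δ γ).le
  have hw1 := weight_le_one hpf hρ hδ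
  have hdiam := cylDiam_weight hpf htwo hδ hδ1
  refine ⟨BratteliDiagram.rep_mul_absDiracPow_nonneg (fun γ => (hw0 γ).trans_eq (hdiam γ).symm)
    (fun γ => (hdiam γ).trans_le (hw1 γ)) τ _ hδ, ?_⟩
  refine (tendsto_mul_tsum_levelTrace hpf htwo hirr hlA hl hδ τ S).congr' ?_
  filter_upwards [self_mem_nhdsWithin] with s (hs : 1 < s)
  rw [τ.posTrace_eq_tsum_levelTrace hw0 hw1 hdiam _ hδ (one_pos.trans hs)]

theorem map_toBratteli_preimage_takeN {M : Measure Λ.InfPath} (hM : Λ.IsAHLRSMeasure M) {N : ℕ}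
    (S : Set (Λ.bratteli.PathN N)) : M.map Λ.toBratteli {x | x.takeN N ∈ S} =
      ENNReal.ofReal (∑ g, S.indicator 1 g * pathMass ⟨N, g⟩) := by
  have hnonneg (g : Λ.bratteli.PathN N) :
      0 ≤ S.indicator (1 : Λ.bratteli.PathN N → ℝ) g * pathMass ⟨N, g⟩ :=
    mul_nonneg (Set.indicator_nonneg (fun _ _ => zero_le_one) _)
      (pathMass_nonneg hpf (hpf.one_lt_rho htwo) _)
  rw [BratteliDiagram.measure_preimage_takeN, ENNReal.ofReal_sum_of_nonneg fun g _ => hnonneg g]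
  refine Finset.sum_congr rfl fun g _ => ?_
  by_cases hg : g ∈ S <;> simp [hg, (isAHLRSMeasure_iff hpf htwo M).1 hM]

theorem exists_hasDixmierTrace (hirr : (Λ.countMatrix 1).IsIrreducible) {M : Measure Λ.InfPath}
    (hM : Λ.IsAHLRSMeasure M) {δ : ℝ} (hδ : 0 < δ) (hδ1 : δ ≤ 1) :
    ∃ C : ℝ, 0 < C ∧ ∀ (τ : BratteliDiagram.ChoiceFunction (Λ.weight δ))
      (O : Set Λ.bratteli.PathSpace), IsClopen O → HasDixmierTrace
        (τ.rep (BratteliDiagram.chi O) * BratteliDiagram.absDiracPow (Λ.weight δ) δ)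
        ((ENNReal.ofReal C • M.map Λ.toBratteli) O) := by
  have := hpf.nonempty
  have hρ := hpf.one_lt_rho htwo
  obtain ⟨l, hlpos, hlA, hl⟩ :=
    exists_pos_left_eigenvector hirr hpf.pos (hpf.countMatrix_mulVec 1)
  set C : ℝ := 2 * ((Real.log (Λ.rhoPow 1))⁻¹ * k * ∑ v, Λ.pf v ^ δ * l v) with hC
  have hCpos : 0 < C := mul_pos two_pos <| mul_pos
    (mul_pos (inv_pos.2 (Real.log_pos (one_lt_rhoPow_one hρ)))
      (Nat.cast_pos.2 (Nat.pos_of_ne_zero (NeZero.ne k))))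
    (Finset.sum_pos (fun v _ => mul_pos (Real.rpow_pos_of_pos (hpf.pos v) δ) (hlpos v))
      Finset.univ_nonempty)
  refine ⟨C, hCpos, fun τ O hO => ?_⟩
  obtain ⟨N, S, rfl⟩ := BratteliDiagram.exists_eq_preimage_takeN hO
  rw [Measure.smul_apply, smul_eq_mul, map_toBratteli_preimage_takeN hpf htwo hM,
    ← ENNReal.ofReal_mul hCpos.le, hC, mul_assoc 2]
  exact hasDixmierTrace_takeN hpf htwo hirr hlA hl hδ hδ1 τ S

end DixmierTrace

theorem isDixmierMeasure_of_isClopen [NeZero k] [Λ.IsFinite] {μ : Measure Λ.bratteli.PathSpace}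
    [IsFiniteMeasure μ] {δ : ℝ} {τ : BratteliDiagram.ChoiceFunction (Λ.weight δ)}
    (hμ : ∀ O : Set Λ.bratteli.PathSpace, IsClopen O → HasDixmierTrace
      (τ.rep (BratteliDiagram.chi O) * BratteliDiagram.absDiracPow (Λ.weight δ) δ) (μ O)) :
    Λ.IsDixmierMeasure δ τ μ :=
  ⟨inferInstance, fun γ => hμ _ γ.isClopen_cylinder⟩

theorem IsDixmierMeasure.unique [NeZero k] [Λ.IsFinite] {μ μ' : Measure Λ.bratteli.PathSpace}
    {δ : ℝ} {τ : BratteliDiagram.ChoiceFunction (Λ.weight δ)} (hμ : Λ.IsDixmierMeasure δ τ μ)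
    (hμ' : Λ.IsDixmierMeasure δ τ μ') : μ = μ' :=
  have := hμ.finite
  BratteliDiagram.measure_ext_cylinder fun γ => (hμ.cylinder γ).unique (hμ'.cylinder γ)

end KGraph

theorem inv_measure_univ_smul_smul {α : Type*} [MeasurableSpace α] (P : Measure α)
    [IsProbabilityMeasure P] {c : ℝ≥0∞} (hc0 : c ≠ 0) (hc : c ≠ ∞) :
    ((c • P) Set.univ)⁻¹ • c • P = P := by
  rw [Measure.smul_apply, measure_univ, smul_eq_mul, mul_one, smul_smul,
    ENNReal.inv_mul_cancel hc0 hc, one_smul]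

theorem theorem3p19 {k : ℕ} [NeZero k] (Λ : KGraph.{u} k) [Nonempty Λ.Vert] [Λ.IsFinite]
    (hconn : Λ.StronglyConnected)
    (htwo : ∀ (i : Fin k) (v : Λ.Vert), 2 ≤ ∑ w, Λ.adj i v w)
    (hirr : (Λ.adjProd.map (Nat.cast : ℕ → ℝ)).IsIrreducible) :
    (∃! x, Λ.IsPerronFrobenius x) ∧
    IsHomeomorph Λ.toBratteli ∧
    ∃ M : Measure Λ.InfPath,
      IsProbabilityMeasure M ∧
      Λ.IsAHLRSMeasure M ∧
      (∀ M' : Measure Λ.InfPath, Λ.IsAHLRSMeasure M' → M' = M) ∧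
      ∀ δ : ℝ, 0 < δ → δ < 1 →
        Nonempty (BratteliDiagram.ChoiceFunction (Λ.weight δ)) ∧
        ∃ μ : Measure Λ.bratteli.PathSpace,
          (∀ τ : BratteliDiagram.ChoiceFunction (Λ.weight δ),
            Λ.IsDixmierMeasure δ τ μ ∧
            (∀ μ' : Measure Λ.bratteli.PathSpace, Λ.IsDixmierMeasure δ τ μ' → μ' = μ) ∧
            (∀ O : Set Λ.bratteli.PathSpace, IsClopen O → HasDixmierTrace
              (τ.rep (BratteliDiagram.chi O) * BratteliDiagram.absDiracPow (Λ.weight δ) δ)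
              (μ O)) ∧
            HasDixmierTrace (BratteliDiagram.absDiracPow (Λ.weight δ) δ) (μ Set.univ)) ∧
          0 < μ Set.univ ∧ μ Set.univ < ∞ ∧
          IsProbabilityMeasure ((μ Set.univ)⁻¹ • μ) ∧
          ∀ O : Set Λ.bratteli.PathSpace, MeasurableSet O →
            ((μ Set.univ)⁻¹ • μ) O = M (Λ.toBratteli ⁻¹' O) := by
  have hpf := KGraph.isPerronFrobenius_pf hirr
  obtain ⟨M, hMprob, hM, hMuniq⟩ := KGraph.exists_isAHLRSMeasure hpf htwo
  refine ⟨KGraph.existsUnique_isPerronFrobenius hirr, KGraph.isHomeomorph_toBratteli, M, hMprob, hM,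
    hMuniq, fun δ hδ hδ1 => ⟨KGraph.nonempty_choiceFunction hpf htwo hδ hδ1.le, ?_⟩⟩
  obtain ⟨C, hC, htrace⟩ := KGraph.exists_hasDixmierTrace hpf htwo
    (KGraph.adjProd_map_cast (Λ := Λ) ▸ hirr) hM hδ hδ1.le
  have hmeas : Measurable Λ.toBratteli := KGraph.continuous_toBratteli.measurable
  have hmap : IsProbabilityMeasure (M.map Λ.toBratteli) :=
    Measure.isProbabilityMeasure_map hmeas.aemeasurable
  have hC0 : 0 < ENNReal.ofReal C := ENNReal.ofReal_pos.2 hC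
  have hfin := (M.map Λ.toBratteli).smul_finite (c := ENNReal.ofReal C) ENNReal.ofReal_ne_top
  have hnorm := inv_measure_univ_smul_smul (M.map Λ.toBratteli) hC0.ne' ENNReal.ofReal_ne_top
  have hdix (τ : BratteliDiagram.ChoiceFunction (Λ.weight δ)) :=
    KGraph.isDixmierMeasure_of_isClopen (μ := ENNReal.ofReal C • M.map Λ.toBratteli) (htrace τ)
  refine ⟨ENNReal.ofReal C • M.map Λ.toBratteli, fun τ => ⟨hdix τ, fun _ hμ' => hμ'.unique (hdix τ),
    htrace τ, ?_⟩, ?_, measure_lt_top _ _, by rwa [hnorm], fun O hO => ?_⟩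
  · simpa only [BratteliDiagram.rep_chi_univ, one_mul] using htrace τ _ isClopen_univ
  · rwa [Measure.smul_apply, measure_univ, smul_eq_mul, mul_one]
  · rw [hnorm, Measure.map_apply hmeas hO]
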